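/- \textbf{Setting.} Tessellate $\mathbb{R}^3$ by cubes of side $2$ centred at the points of $2\mathbb{Z}^3$ and divide each cube into $24$ pyramids, each spanned by the centre of the cube (coloured $D$), the centre of a face (coloured $C$) and the two ends of an edge of that face, the vertices of the cubes being coloured alternately $A$ and $B$. This is the coloured tessellation $\widetilde{B}_3$. A word in $A,B,C,D$ and a starting pyramid determine a gallery: reading from left to right, a letter $X$ means crossing the face opposite to the vertex coloured $X$ into the pyramid on the other side. A word also gives an isometry $s_1\circ s_2\circ\cdots$, its letters being read as the reflections in the faces of the starting pyramid. A gallery knots as $K$ if the polygonal curve through the barycentres of its pyramids is closed and simple and is ambient isotopic in $\mathbb{R}^3$ to $K$. \textbf{Cubic pieces.} A frame consists of orthogonal unit lattice vectors $T,N$ and $B=T\times N$. A framed cube moves by the letters $f,u,d,r,l$ to the adjacent cube in direction $T,N,-N,B,-B$ respectively, and the new frame $(T,N)$ is $(T,N),(N,-T),(-N,T),(B,N),(-B,N)$ respectively. Let $K$ be a knot that is ambient isotopic to a simple closed polygonal curve through the centres of $3(k+1)$ cubes which consists of a piece of $k+1$ cubes and of its images under $R$ and $R^2$ in this order, where $R$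 is a threefold rotation of the cubic lattice. Let $g=(c_1,\dots,c_k)$, $c_j\in\{f,u,d,r,l\}$, be the code of the piece, starting from a frame $F$ at its first cube $q$. Let $\tau$ be the rotation that takes the final frame of the piece to the initial frame $R(F)$ of the rotated piece. Assume that $\tau$ is a bar gluing, i.e. $\tau$ fixes the final tangent $T$ and the first cube $R(q)$ of the rotated piece is the neighbour in direction $T$ of the last cube of the piece. The type of $\tau$ is $s=1,i,-1,-i$ if $\tau$ is the rotation about $T$ by $0^\circ$, $90^\circ$, $180^\circ$, $-90^\circ$ respectively, the positive quarter turn taking the final $N$ to the final $B$. \textbf{Translation.} Call a framed cube even if the vertex in direction $-T-N+B$ from its centre is coloured $A$, and odd if it is coloured $B$; the first cube is taken to be even. The parity in this sense changes at each letter $f$ and at no other letter, so that $c_j$ is read in an even cube if and only if the number of letters $f$ among $c_1,\dots,c_{j-1}$ is even. Put $$T(f)=ABCDC,\quad T(u)=ABCABCDC,\quad T(d)=DC,$$ $T(l)=ACDC$ and $T(r)=BCDC$ in an even cube, $T(l)=BCDC$ and $T(r)=ACDC$ in an odd cube, and $$T(1)=ABCDC,\quad T(i)=ACBCDC,\quad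 T(-1)=BACABDC,\quad T(-i)=BCACDC,$$ and let $T(g)=(T(c_1),\dots,T(c_k),T(s))$. \textbf{Theorem.} Let $\mathcal{C}$ be any pyramid of $\widetilde{B}_3$ for which the vectors from its vertex $D$ to its vertices $A,B,C$ form, in this order, a positively oriented basis. Then the gallery $(T(g),T(g),T(g))$ starting at $\mathcal{C}$ closes, its polygonal curve is simple, and it knots as $K$. In particular $T(g)$ has order $3$, as a product of the reflections in the faces of $\mathcal{C}$, and represents $K$. -/

import Mathlib

/-! ### Knots in space -/

namespace CoxeterKnot

/-- Euclidean three-space with its standard orientation. -/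
abbrev Space : Type := EuclideanSpace ℝ (Fin 3)

/-- The lattice `ℤ³`. -/
abbrev IntVec : Type := Fin 3 → ℤ

/-- The point of space with the given integer coordinates. -/
noncomputable def pt (v : IntVec) : Space := WithLp.toLp 2 (fun i => (v i : ℝ))

/-- `K` and `L` have the same knot type: an ambient isotopy of space carries `K` to `L`. -/
def AmbientIsotopic (K L : Set Space) : Prop :=
  ∃ H : unitInterval → Space ≃ₜ Space,
    Continuous (fun q : unitInterval × Space => H q.1 q.2) ∧
    H 0 = Homeomorph.refl Space ∧ H 1 '' K = L

/-- The polygonal curve through `p 0, p 1, …, p n`, as a subset of space. -/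
def polygon (n : ℕ) (p : ℕ → Space) : Set Space :=
  ⋃ i ∈ Finset.range n, segment ℝ (p i) (p (i + 1))

/-- The polygonal curve through `p 0, p 1, …, p n` is closed and does not meet itself: it closes up,
and its parametrization by the `n` half-open edges is injective. -/
def IsSimpleClosedPolygon (n : ℕ) (p : ℕ → Space) : Prop :=
  0 < n ∧ p n = p 0 ∧
    ∀ i < n, ∀ j < n, ∀ s ∈ Set.Ico (0 : ℝ) 1, ∀ t ∈ Set.Ico (0 : ℝ) 1,
      AffineMap.lineMap (p i) (p (i + 1)) s = AffineMap.lineMap (p j) (p (j + 1)) t →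
        i = j ∧ s = t

/-! ### The coloured tessellation of type `B̃₃`

The cubes have side `2`. The cube with index `c : ℤ³` has centre `2c`, so the vertices of
the cubes are the points with three odd coordinates. -/

/-- The colours of the vertices of the pyramids; also the letters of the words. -/
inductive Colour : Type
  | A | B | C | D
  deriving DecidableEq

/-- The centre of the cube with index `c`. -/
def cubeCentre (c : IntVec) : IntVec := fun i => 2 * c i

/-- Sum of the coordinates. -/
def coordSum (v : IntVec) : ℤ := v 0 + v 1 + v 2

/-- `vertex` lists the four coloured vertices of one of the `24` pyramids of the cube `c`: the vertex
`D` is the centre of the cube, `C` is the centre of a face (the one in direction `u`), and `A`, `B`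
are the ends `2c + a`, `2c + b` of an edge of that face. The vertices of the cubes are coloured
alternately: `A` if the sum of the (odd) coordinates is `3` modulo `4`, `B` if it is `1`. -/
def IsPyramidOf (c : IntVec) (vertex : Colour → IntVec) : Prop :=
  ∃ u a b : IntVec,
    u ⬝ᵥ u = 1 ∧
    (∀ i, a i = 1 ∨ a i = -1) ∧ (∀ i, b i = 1 ∨ b i = -1) ∧
    a ⬝ᵥ u = 1 ∧ b ⬝ᵥ u = 1 ∧ (a - b) ⬝ᵥ (a - b) = 4 ∧
    vertex Colour.D = cubeCentre c ∧
    vertex Colour.C = cubeCentre c + u ∧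
    vertex Colour.A = cubeCentre c + a ∧
    vertex Colour.B = cubeCentre c + b ∧
    coordSum (vertex Colour.A) % 4 = 3 ∧ coordSum (vertex Colour.B) % 4 = 1

/-- A (coloured) pyramid of the tessellation. -/
structure Pyramid : Type where
  vertex : Colour → IntVec
  isPyramid : ∃ c : IntVec, IsPyramidOf c vertex

/-- The centre of a pyramid, i.e. the barycentre of its four vertices. -/
noncomputable def Pyramid.centre (P : Pyramid) : Space :=
  (4 : ℝ)⁻¹ • (pt (P.vertex Colour.A) + pt (P.vertex Colour.B) +
    pt (P.vertex Colour.C) + pt (P.vertex Colour.D))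

/-- The vectors from the vertex `D` to `A`, `B`, `C`, in this order, form a positively oriented
basis. -/
def Pyramid.IsPositive (P : Pyramid) : Prop :=
  0 < (Matrix.of ![P.vertex Colour.A - P.vertex Colour.D,
    P.vertex Colour.B - P.vertex Colour.D, P.vertex Colour.C - P.vertex Colour.D]).det

/-- `Q` is the pyramid reached from `P` by crossing the face opposite to the vertex coloured `X`:
the two pyramids are different and share the three other vertices. -/
def Crosses (X : Colour) (P Q : Pyramid) : Prop :=
  Q ≠ P ∧ ∀ Y, Y ≠ X → Q.vertex Y = P.vertex Y

/-- The pyramids `P 0, P 1, …` form the gallery with word `w` that starts at `P 0`: the `i`-th letter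
of `w`, read from left to right, is the colour of the vertex behind the face crossed from `P i` to
`P (i + 1)`. -/
def IsGallery (w : List Colour) (P : ℕ → Pyramid) : Prop :=
  ∀ (i : ℕ) (h : i < w.length), Crosses w[i] (P i) (P (i + 1))

instance (X : Colour) : Nonempty {Y : Colour // Y ≠ X} := by
  cases X
  · exact ⟨⟨Colour.B, by simp⟩⟩
  all_goals exact ⟨⟨Colour.A, by simp⟩⟩

/-- The reflection in the plane of the face of `P` opposite to the vertex coloured `X`. -/
noncomputable def wallReflection (P : Pyramid) (X : Colour) : Space ≃ᵃⁱ[ℝ] Space :=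
  EuclideanGeometry.reflection
    (affineSpan ℝ (Set.range (fun Y : {Y : Colour // Y ≠ X} => pt (P.vertex Y))))

/-- The symmetry `s₁ ∘ s₂ ∘ ⋯ ∘ sₖ` given by a word `s₁ s₂ … sₖ`, its letters being the reflections
in the faces of the pyramid `P`. It is an element of the group generated by these four reflections,
which is the Coxeter group of type `B̃₃`. -/
noncomputable def wordSymmetry (P : Pyramid) (w : List Colour) : Space ≃ᵃⁱ[ℝ] Space :=
  (w.map (wallReflection P)).prod

/-! ### Cubic galleries in the moving frame -/

/-- A moving frame of lattice vectors, given by its tangent `T` and its normal `N`. -/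
structure Frame : Type where
  T : IntVec
  N : IntVec

/-- `T` and `N` are orthogonal unit vectors, so that `T`, `N`, `T × N` is a positively oriented
orthonormal frame. -/
def Frame.IsOrthonormal (F : Frame) : Prop :=
  F.T ⬝ᵥ F.T = 1 ∧ F.N ⬝ᵥ F.N = 1 ∧ F.T ⬝ᵥ F.N = 0

/-- The binormal `T × N`. -/
def Frame.B (F : Frame) : IntVec := crossProduct F.T F.N

/-- The letters front, up, down, right, left of the moving frame. -/
inductive Move : Type
  | f | u | d | r | l
  deriving DecidableEq

/-- The frame after a move: front is the direction `T`, up is `N`, right is `B`, and the frame makes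
the quarter turn that takes `T` to the direction of the move (no turn for `f`). -/
def Frame.turn (F : Frame) : Move → Frame
  | Move.f => ⟨F.T, F.N⟩
  | Move.u => ⟨F.N, -F.T⟩
  | Move.d => ⟨-F.N, F.T⟩
  | Move.r => ⟨F.B, F.N⟩
  | Move.l => ⟨-F.B, F.N⟩

/-- One move of a cube that carries a frame: turn the frame and go to the next cube in the direction
of the new tangent. -/
def move (q : IntVec × Frame) (m : Move) : IntVec × Frame :=
  (q.1 + (q.2.turn m).T, q.2.turn m)

/-- The cube and the frame reached from the cube `c` with frame `F` after the first `j` letters of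
`g`. -/
def follow (c : IntVec) (F : Frame) (g : List Move) (j : ℕ) : IntVec × Frame :=
  (g.take j).foldl move (c, F)

/-- A threefold rotation of the cubic lattice, `x ↦ linear x + trans` on the indices (equivalently,
up to scale, on the centres) of the cubes: a direct isometry of order `3`. -/
structure ThreefoldRotation : Type where
  linear : Matrix (Fin 3) (Fin 3) ℤ
  trans : IntVec
  orthogonal : linear.transpose * linear = 1
  det_eq_one : linear.det = 1
  linear_ne_one : linear ≠ 1
  order_three : ∀ x : IntVec, linear.mulVec (linear.mulVec (linear.mulVec x + trans) + trans) + trans = x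

/-- The action of the rotation on the cubes. -/
def ThreefoldRotation.act (R : ThreefoldRotation) (x : IntVec) : IntVec := R.linear.mulVec x + R.trans

/-- The four types `1, i, -1, -i` of bar gluings. -/
inductive GluingType : Type
  | one | i | negOne | negI
  deriving DecidableEq

/-- The normal of the frame after the rotation about its tangent `T` by the angle `0`, `90`, `180`,
`-90` degrees, respectively (the positive quarter turn about `T` takes `N` to `B`). -/
def Frame.correctedNormal (F : Frame) : GluingType → IntVec
  | GluingType.one => F.N
  | GluingType.i => F.B
  | GluingType.negOne => -F.N
  | GluingType.negI => -F.B

/-- The path of cubes that starts at the cube `c` with initial frame `F` and has moving frame code `g`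
is a piece which its image under `R` follows with a bar gluing of type `s`: the first cube `R c` of
the rotated piece lies in front of the last cube of the piece, the tangent of its initial frame
`R F` is the tangent of the final frame of the piece, and the rotation about this tangent that takes
the final frame to `R F` is the one of type `s`. -/
structure IsBarGluing (R : ThreefoldRotation) (c : IntVec) (F : Frame) (g : List Move)
    (s : GluingType) : Prop where
  frame : F.IsOrthonormal
  front : R.act c = (follow c F g g.length).1 + (follow c F g g.length).2.T
  tangent : R.linear.mulVec F.T = (follow c F g g.length).2.T
  normal : R.linear.mulVec F.N = (follow c F g g.length).2.correctedNormal s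

/-- The closed path of `3 (k + 1)` cubes formed by the piece of `k + 1` cubes with code `g` of length
`k` and its images under `R` and `R²`. -/
def cubePath (R : ThreefoldRotation) (c : IntVec) (F : Frame) (g : List Move) (i : ℕ) : IntVec :=
  R.act^[i / (g.length + 1)] (follow c F g (i % (g.length + 1))).1

/-! ### The translation -/

/-- The parity of a cube that carries a frame: even if the vertex behind, below and to the right of
its centre (i.e. in direction `-T - N + B`) is coloured `A`, odd if this vertex is coloured `B`. -/
inductive Parity : Type
  | even | odd
  deriving DecidableEq

/-- The word in the colours that replaces a letter read in a cube of the given parity. -/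
def letterWord : Move → Parity → List Colour
  | Move.f, _ => [.A, .B, .C, .D, .C]
  | Move.u, _ => [.A, .B, .C, .A, .B, .C, .D, .C]
  | Move.d, _ => [.D, .C]
  | Move.l, .even => [.A, .C, .D, .C]
  | Move.l, .odd => [.B, .C, .D, .C]
  | Move.r, .even => [.B, .C, .D, .C]
  | Move.r, .odd => [.A, .C, .D, .C]

/-- The parity after a move. Going to the adjacent cube exchanges the colours of the vertices as seen
from the frame, and so does a quarter turn of the frame. Hence the parity changes at the letter
`f`, and at a turn the two changes cancel. -/
def Parity.next : Parity → Move → Parity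
  | .even, Move.f => .odd
  | .odd, Move.f => .even
  | p, _ => p

/-- The concatenation of the words of the letters, the first one being read in a cube of parity `p`. -/
def lettersWord : Parity → List Move → List Colour
  | _, [] => []
  | p, m :: g => letterWord m p ++ lettersWord (p.next m) g

/-- The word of the gluing type. -/
def gluingWord : GluingType → List Colour
  | GluingType.one => [.A, .B, .C, .D, .C]
  | GluingType.i => [.A, .C, .B, .C, .D, .C]
  | GluingType.negOne => [.B, .A, .C, .A, .B, .D, .C]
  | GluingType.negI => [.B, .C, .A, .C, .D, .C]

/-- The word `T(g) = T(c₁) T(c₂) … T(cₖ) T(s)`, where the first cube is even. -/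
def pieceWord (g : List Move) (s : GluingType) : List Colour :=
  lettersWord .even g ++ gluingWord s

end CoxeterKnot

open CoxeterKnot

namespace CoxeterKnot

open Matrix

/-! Each letter of the code, and the gluing, contributes a block of colours ending in `DC`. With
these two letters moved to the front, a block describes one passage through one cube: `D` is crossed
into the cube, and the remaining letters lead through its pyramids to the one over the exit face. In
frame coordinates this is a finite check (`Block.run_rotatedWord`). Lattice motions commute with
crossing faces, so the gallery visits the cubes of the path one after the other.

The motion of the gluing block takes the final frame of the piece to its image frame under `R`
(`frameMotion_glue`). Three copies of the word therefore follow the piece and its images under `R`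
and `R²`, and the gallery closes because `R³ = 1`. The parity presupposed by the gluing word is
forced (`finalParity_eq`): galleries preserve the class modulo 4 that distinguishes the colours, and
so does an isometry of order three, since exchanging two colours is an effect of even order.

For the knot type, two arcs are compared in every cube: the straight one (face centre, cube centre,
face centre) and the one along the gallery, cut where it crosses the faces of the cube. The linear
homotopy between them satisfies a uniform chord bound relative to the displacement
(`Closes.chord_bound`). Within a cube, both arcs advance along common linear forms. In consecutive
cubes, both recede from the common face in proportion to the parameter. In other pairs of cubes,
both keep away from the faces that the path does not use. These are finitely many integer
inequalities at vertices (`Block.IsAdmissible`), and they survive convex combination. A homotopy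
with such a bound splits into small steps; each displacement is a contraction, which extends to all
of space and gives an ambient isotopy. The same separation at the end of the homotopy shows that the
gallery curve is simple.

A direct lattice motion moves the path to the prescribed first pyramid. It is isotopic to the
identity, as a product of two rotations without eigenvalue `-1`. Finally, the symmetry of a word
takes the first pyramid of its gallery to the last (`Flag.wordSymmetry_vertex`). Its cube is thus
the identity, while one copy of the word ends in a different cube; so the order is 3. -/

/-! ### Ambient isotopies from small displacements -/

theorem AmbientIsotopic.trans {K L M : Set Space} (h₁ : AmbientIsotopic K L)
    (h₂ : AmbientIsotopic L M) : AmbientIsotopic K M := by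
  obtain ⟨H, hH, hH0, hH1⟩ := h₁
  obtain ⟨G, hG, hG0, hG1⟩ := h₂
  refine ⟨fun t => (H t).trans (G t), ?_, ?_, ?_⟩
  · exact hG.comp (continuous_fst.prodMk hH)
  · simp only [hH0, hG0]; rfl
  · rw [← hG1, ← hH1, Set.image_image]
    rfl

theorem AmbientIsotopic.refl (K : Set Space) : AmbientIsotopic K K :=
  ⟨fun _ => Homeomorph.refl Space, continuous_snd, rfl, by simp⟩

/-- Displacing space by a contraction is an ambient isotopy. -/
theorem ambientIsotopic_of_lipschitzWith {g : Space → Space} (hg : LipschitzWith (1 / 2) g)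
    (S : Set Space) : AmbientIsotopic S ((fun x => x + g x) '' S) := by
  have key : ∀ t : unitInterval, ApproximatesLinearOn (fun x => x + (t : ℝ) • g x)
      ((ContinuousLinearEquiv.refl ℝ Space : Space ≃L[ℝ] Space) : Space →L[ℝ] Space)
      Set.univ (1 / 2) := by
    intro t x _ y _
    have h1 := hg.norm_sub_le x y
    have h2 : x + (t : ℝ) • g x - (y + (t : ℝ) • g y) - (x - y) = (t : ℝ) • (g x - g y) := by
      module
    simp only [ContinuousLinearEquiv.coe_refl, ContinuousLinearMap.coe_id', id_eq, h2]
    rw [norm_smul, Real.norm_of_nonneg t.2.1]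
    calc (t : ℝ) * ‖g x - g y‖ ≤ 1 * ‖g x - g y‖ := by
          gcongr
          exact t.2.2
      _ ≤ _ := by rw [one_mul]; exact h1
  have hc : Subsingleton Space ∨ (1 / 2 : NNReal) <
      ‖((ContinuousLinearEquiv.refl ℝ Space).symm : Space →L[ℝ] Space)‖₊⁻¹ := by
    right
    have : ‖((ContinuousLinearEquiv.refl ℝ Space).symm : Space →L[ℝ] Space)‖₊ = 1 := by
      ext
      simp
    rw [this, inv_one, ← NNReal.coe_lt_coe]
    norm_num
  refine ⟨fun t => (key t).toHomeomorph _ hc, ?_, ?_, ?_⟩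
  · change Continuous (fun q : unitInterval × Space => q.2 + (q.1 : ℝ) • g q.2)
    have := hg.continuous
    fun_prop
  · ext1 x
    change x + ((0 : unitInterval) : ℝ) • g x = x
    simp
  · apply Set.image_congr
    intro x _
    change x + ((1 : unitInterval) : ℝ) • g x = x + g x
    simp

/-- A displacement of a set by a contraction extends to an ambient isotopy. -/
theorem ambientIsotopic_of_lipschitzOnWith {d : Space → Space} {S : Set Space}
    (hd : LipschitzOnWith (1 / 4) d S) : AmbientIsotopic S ((fun x => x + d x) '' S) := by
  have h1 : LipschitzOnWith (1 / 4) (fun x => (d x).ofLp) S := by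
    have := (PiLp.lipschitzWith_ofLp 2 (fun _ : Fin 3 => ℝ)).comp_lipschitzOnWith hd
    rw [one_mul] at this
    exact this
  obtain ⟨g, hg, hgd⟩ := h1.extend_pi
  have h2 : LipschitzWith (1 / 2) (fun x => (WithLp.toLp 2 (g x) : Space)) := by
    apply LipschitzWith.of_dist_le_mul
    intro x y
    have h3 := hg.dist_le_mul x y
    rw [EuclideanSpace.dist_eq]
    apply Real.sqrt_le_iff.mpr
    refine ⟨by positivity, ?_⟩
    have h4 : ∀ i, dist (g x i) (g y i) ^ 2 ≤ ((1 / 4 : NNReal) * dist x y) ^ 2 := fun i => by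
      have := dist_le_pi_dist (g x) (g y) i
      gcongr
      exact this.trans h3
    -- The extension is made coordinatewise, for the maximum norm. Three coordinates of constant 1/4
    -- give at most √3/4 < 1/2 in the Euclidean norm.
    rw [Fin.sum_univ_three]
    have h5 := h4 0
    have h6 := h4 1
    have h7 := h4 2
    push_cast at *
    nlinarith [sq_nonneg (dist x y)]
  have h3 := ambientIsotopic_of_lipschitzWith h2 S
  have h4 : (fun x => x + (WithLp.toLp 2 (g x) : Space)) '' S = (fun x => x + d x) '' S := by
    apply Set.image_congr
    intro x hx
    have := hgd hx
    simp only at this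
    rw [← this]
  rwa [h4] at h3

/-- A linear homotopy of curves that is uniformly chord-arc, relative to the displacement, is
realised by an ambient isotopy. -/
theorem ambientIsotopic_range_of_chord_bound {ι : Type*} {a b : ι → Space} {C : ℝ}
    (h : ∀ t ∈ Set.Icc (0 : ℝ) 1, ∀ x y, ‖(b x - a x) - (b y - a y)‖ ≤
      C * ‖AffineMap.lineMap (a x) (b x) t - AffineMap.lineMap (a y) (b y) t‖) :
    AmbientIsotopic (Set.range a) (Set.range b) := by
  -- With `N > 4 * C` steps, each step displaces the current curve by a function with Lipschitz
  -- constant at most `C / N < 1 / 4`.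
  obtain ⟨N, hN⟩ := exists_nat_gt (max 1 (4 * C))
  have hN1 : (1 : ℝ) < N := (le_max_left _ _).trans_lt hN
  have hN2 : 4 * C < N := (le_max_right _ _).trans_lt hN
  have hN0 : (0 : ℝ) < N := by linarith
  let γ : ℝ → ι → Space := fun t x => AffineMap.lineMap (a x) (b x) t
  have step : ∀ k : ℕ, k < N →
      AmbientIsotopic (Set.range (γ (k / N))) (Set.range (γ ((k + 1 : ℕ) / N))) := by
    intro k hk
    have hk' : (k : ℝ) / N ∈ Set.Icc (0 : ℝ) 1 :=
      ⟨by positivity, (div_le_one hN0).2 (by exact_mod_cast hk.le)⟩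
    have hb : ∀ x y, ‖(N : ℝ)⁻¹ • (b x - a x) - (N : ℝ)⁻¹ • (b y - a y)‖ ≤
        (1 / 4) * ‖γ (k / N) x - γ (k / N) y‖ := by
      intro x y
      rw [← smul_sub, norm_smul, norm_inv, Real.norm_of_nonneg hN0.le]
      have h1 := h _ hk' x y
      change _ ≤ C * ‖γ (k / N) x - γ (k / N) y‖ at h1
      rw [inv_mul_le_iff₀ hN0]
      have := norm_nonneg (γ (k / N) x - γ (k / N) y)
      nlinarith
    rcases isEmpty_or_nonempty ι with hι | hι
    · simp only [Set.range_eq_empty]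
      exact AmbientIsotopic.refl _
    -- The displacement has to be a function of the point, not of the parameter. Where the curve
    -- meets itself, the chord bound forces equal displacements, so any choice of preimage will do.
    let d : Space → Space := fun p =>
      (N : ℝ)⁻¹ • (b (Function.invFun (γ (k / N)) p) - a (Function.invFun (γ (k / N)) p))
    have hd : ∀ x, d (γ (k / N) x) = (N : ℝ)⁻¹ • (b x - a x) := by
      intro x
      have h1 : γ (k / N) (Function.invFun (γ (k / N)) (γ (k / N) x)) = γ (k / N) x :=
        Function.invFun_eq ⟨x, rfl⟩
      have h2 := hb (Function.invFun (γ (k / N)) (γ (k / N) x)) x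
      rw [h1, sub_self, norm_zero, mul_zero] at h2
      exact sub_eq_zero.mp (norm_le_zero_iff.mp h2)
    have hL : LipschitzOnWith (1 / 4) d (Set.range (γ (k / N))) := by
      apply LipschitzOnWith.of_dist_le_mul
      rintro _ ⟨x, rfl⟩ _ ⟨y, rfl⟩
      rw [hd, hd, dist_eq_norm, dist_eq_norm]
      simpa using hb x y
    have h1 := ambientIsotopic_of_lipschitzOnWith hL
    rw [← Set.range_comp] at h1
    convert h1 using 2
    ext1 x
    simp only [Function.comp_apply, hd]
    simp only [γ, AffineMap.lineMap_apply_module']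
    push_cast
    rw [add_div, add_smul, one_div]
    abel
  have all : ∀ k : ℕ, k ≤ N → AmbientIsotopic (Set.range (γ 0)) (Set.range (γ (k / N))) := by
    intro k
    induction k with
    | zero => intro _; simpa using AmbientIsotopic.refl _
    | succ k ih => intro hk; exact (ih (by omega)).trans (step k (by omega))
  have h1 := all N le_rfl
  rw [div_self hN0.ne'] at h1
  simpa [γ] using h1

/-- A linear automorphism without real negative eigenvalue isotopes every set to its image. -/
theorem ambientIsotopic_of_injective_segment {A : Space →ₗ[ℝ] Space} (p : Space)
    (h : ∀ t ∈ Set.Icc (0 : ℝ) 1,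
      Function.Injective (LinearMap.id + t • (A - LinearMap.id) : Space →ₗ[ℝ] Space))
    (S : Set Space) : AmbientIsotopic S ((fun x => A x + p) '' S) := by
  let e : unitInterval → Space ≃ₗ[ℝ] Space := fun t =>
    LinearEquiv.ofInjectiveEndo _ (h t t.2)
  refine ⟨fun t => (e t).toContinuousLinearEquiv.toHomeomorph.trans
    (Homeomorph.addRight ((t : ℝ) • p)), ?_, ?_, ?_⟩
  · change Continuous (fun q : unitInterval × Space =>
      (q.2 + (q.1 : ℝ) • (A q.2 - q.2)) + (q.1 : ℝ) • p)
    have : Continuous A := A.continuous_of_finiteDimensional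
    fun_prop
  · ext1 x
    change (x + ((0 : unitInterval) : ℝ) • (A x - x)) + ((0 : unitInterval) : ℝ) • p = x
    simp
  · apply Set.image_congr
    intro x _
    change (x + ((1 : unitInterval) : ℝ) • (A x - x)) + ((1 : unitInterval) : ℝ) • p = A x + p
    simp

/-! ### Lattice vectors and lattice isometries -/

theorem pt_add (v w : IntVec) : pt (v + w) = pt v + pt w := by
  ext i; simp [pt]

theorem pt_sub (v w : IntVec) : pt (v - w) = pt v - pt w := by
  ext i; simp [pt]

theorem pt_neg (v : IntVec) : pt (-v) = -pt v := by
  ext i; simp [pt]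

theorem pt_zero : pt 0 = 0 := by
  ext i; simp [pt]

theorem pt_smul (n : ℤ) (v : IntVec) : pt (n • v) = (n : ℝ) • pt v := by
  ext i; simp [pt]

theorem pt_injective : Function.Injective pt := by
  intro v w h
  funext i
  have := congrArg (fun x : Space => x i) h
  simpa [pt] using this

theorem inner_pt (v w : IntVec) : inner ℝ (pt v) (pt w) = ((v ⬝ᵥ w : ℤ) : ℝ) := by
  simp [pt, EuclideanSpace.inner_eq_star_dotProduct, dotProduct, mul_comm]

theorem norm_pt_sq (v : IntVec) : ‖pt v‖ ^ 2 = ((v ⬝ᵥ v : ℤ) : ℝ) := by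
  rw [← inner_pt, real_inner_self_eq_norm_sq]

theorem cubeCentre_eq (c : IntVec) : cubeCentre c = (2 : ℤ) • c := by
  ext i; simp [cubeCentre]

theorem coordSum_add (v w : IntVec) : coordSum (v + w) = coordSum v + coordSum w := by
  simp only [coordSum, Pi.add_apply]; ring

theorem coordSum_sub (v w : IntVec) : coordSum (v - w) = coordSum v - coordSum w := by
  simp only [coordSum, Pi.sub_apply]; ring

theorem coordSum_smul (n : ℤ) (v : IntVec) : coordSum (n • v) = n * coordSum v := by
  simp only [coordSum, Pi.smul_apply, smul_eq_mul]; ring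

theorem dot_self (v : IntVec) : v ⬝ᵥ v = v 0 ^ 2 + v 1 ^ 2 + v 2 ^ 2 := by
  simp [dotProduct, Fin.sum_univ_three, sq]

/-- The unit vectors of the lattice. -/
def unitVectors : List IntVec :=
  [![1, 0, 0], ![0, 1, 0], ![0, 0, 1], ![-1, 0, 0], ![0, -1, 0], ![0, 0, -1]]

theorem mem_unitVectors {v : IntVec} (h : v ⬝ᵥ v = 1) : v ∈ unitVectors := by
  have hs := dot_self v
  rw [h] at hs
  have hb : ∀ i, v i ∈ Finset.Icc (-1 : ℤ) 1 := by
    intro i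
    have : v i ^ 2 ≤ 1 := by
      fin_cases i
      · change v 0 ^ 2 ≤ 1; linarith [sq_nonneg (v 1), sq_nonneg (v 2)]
      · change v 1 ^ 2 ≤ 1; linarith [sq_nonneg (v 0), sq_nonneg (v 2)]
      · change v 2 ^ 2 ≤ 1; linarith [sq_nonneg (v 0), sq_nonneg (v 1)]
    rw [Finset.mem_Icc, ← abs_le, ← sq_le_one_iff_abs_le_one]
    exact this
  have hv : v = ![v 0, v 1, v 2] := by ext i; fin_cases i <;> rfl
  have fin : ∀ a ∈ Finset.Icc (-1 : ℤ) 1, ∀ b ∈ Finset.Icc (-1 : ℤ) 1,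
      ∀ c ∈ Finset.Icc (-1 : ℤ) 1, 1 = a ^ 2 + b ^ 2 + c ^ 2 → ![a, b, c] ∈ unitVectors := by
    decide +kernel
  rw [hv]
  exact fin _ (hb 0) _ (hb 1) _ (hb 2) hs

theorem coordSum_unit {v : IntVec} (h : v ⬝ᵥ v = 1) : coordSum v = 1 ∨ coordSum v = -1 := by
  have : ∀ v ∈ unitVectors, coordSum v = 1 ∨ coordSum v = -1 := by decide
  exact this v (mem_unitVectors h)

abbrev IntMat : Type := Matrix (Fin 3) (Fin 3) ℤ

theorem dot_mulVec_mulVec {A : IntMat} (hA : Aᵀ * A = 1) (v w : IntVec) :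
    (A *ᵥ v) ⬝ᵥ (A *ᵥ w) = v ⬝ᵥ w := by
  rw [dotProduct_mulVec, ← mulVec_transpose, mulVec_mulVec, hA, one_mulVec]

theorem dot_transpose_mulVec {A : IntMat} (hA : Aᵀ * A = 1) (v w : IntVec) :
    (Aᵀ *ᵥ v) ⬝ᵥ (Aᵀ *ᵥ w) = v ⬝ᵥ w := by
  apply dot_mulVec_mulVec
  rw [transpose_transpose]
  exact mul_eq_one_comm.mp hA

/-- The columns of an orthogonal integer matrix have odd sums. -/
theorem coordSum_mulVec_mod_two {A : IntMat} (hA : Aᵀ * A = 1) (v : IntVec) :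
    coordSum (A *ᵥ v) % 2 = coordSum v % 2 := by
  have h1 : ∀ v : IntVec, coordSum v = ![1, 1, 1] ⬝ᵥ v := by
    intro v; simp [coordSum, dotProduct, Fin.sum_univ_three]
  have hcol : ∀ j, coordSum (fun i => A i j) % 2 = 1 := by
    intro j
    have h2 : (fun i => A i j) ⬝ᵥ (fun i => A i j) = 1 := by
      have := congrFun (congrFun hA j) j
      simpa [Matrix.mul_apply, dotProduct] using this
    rcases coordSum_unit h2 with h | h <;> rw [h] <;> rfl
  have h2 : coordSum (A *ᵥ v) = coordSum (fun i => A i 0) * v 0 +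
      coordSum (fun i => A i 1) * v 1 + coordSum (fun i => A i 2) * v 2 := by
    simp only [coordSum, mulVec, dotProduct, Fin.sum_univ_three]; ring
  rw [h2]
  have h0 := hcol 0
  have h1 := hcol 1
  have h3 := hcol 2
  generalize coordSum (fun i => A i 0) = a at *
  generalize coordSum (fun i => A i 1) = b at *
  generalize coordSum (fun i => A i 2) = c at *
  obtain ⟨a', rfl⟩ : ∃ k, a = 2 * k + 1 := ⟨a / 2, by omega⟩
  obtain ⟨b', rfl⟩ : ∃ k, b = 2 * k + 1 := ⟨b / 2, by omega⟩
  obtain ⟨c', rfl⟩ : ∃ k, c = 2 * k + 1 := ⟨c / 2, by omega⟩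
  have : (2 * a' + 1) * v 0 + (2 * b' + 1) * v 1 + (2 * c' + 1) * v 2 =
      coordSum v + 2 * (a' * v 0 + b' * v 1 + c' * v 2) := by
    simp only [coordSum]; ring
  rw [this]
  omega

/-- The action of an integer matrix on space. -/
noncomputable def latticeMap (A : IntMat) : Space →ₗ[ℝ] Space :=
  Matrix.toLpLin 2 2 (A.map (Int.cast : ℤ → ℝ))

theorem latticeMap_pt (A : IntMat) (v : IntVec) : latticeMap A (pt v) = pt (A *ᵥ v) := by
  ext i
  simp [latticeMap, Matrix.toLpLin_apply, pt, mulVec, dotProduct]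

theorem latticeMap_mul (A B : IntMat) (x : Space) :
    latticeMap (A * B) x = latticeMap A (latticeMap B x) := by
  simp only [latticeMap, Matrix.toLpLin_apply]
  rw [mulVec_mulVec]
  congr 2
  ext i j
  simp [Matrix.mul_apply]

theorem latticeMap_one (x : Space) : latticeMap 1 x = x := by
  simp [latticeMap]

theorem latticeMap_add (A B : IntMat) (x : Space) :
    latticeMap (A + B) x = latticeMap A x + latticeMap B x := by
  have : (A + B).map (Int.cast : ℤ → ℝ) = A.map Int.cast + B.map Int.cast := by
    ext i j; simp
  simp only [latticeMap, this, map_add, LinearMap.add_apply]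

theorem norm_latticeMap {A : IntMat} (hA : Aᵀ * A = 1) (x : Space) : ‖latticeMap A x‖ = ‖x‖ := by
  have h1 : (A.map (Int.cast : ℤ → ℝ))ᵀ * A.map (Int.cast : ℤ → ℝ) = 1 := by
    have := congrArg (fun M : IntMat => M.map (Int.cast : ℤ → ℝ)) hA
    rw [Matrix.map_one _ Int.cast_zero Int.cast_one] at this
    rw [← this]
    ext i j
    simp [Matrix.mul_apply]
  have h2 : ‖latticeMap A x‖ ^ 2 = ‖x‖ ^ 2 := by
    rw [← real_inner_self_eq_norm_sq, ← real_inner_self_eq_norm_sq]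
    simp only [EuclideanSpace.inner_eq_star_dotProduct, latticeMap, Matrix.toLpLin_apply,
      star_trivial]
    rw [dotProduct_mulVec, ← mulVec_transpose, mulVec_mulVec, h1, one_mulVec]
  exact (sq_eq_sq₀ (norm_nonneg _) (norm_nonneg _)).mp h2

theorem latticeMap_injective_of_det_ne_zero {A : IntMat} (h : A.det ≠ 0) :
    Function.Injective (latticeMap A) := by
  intro x y hxy
  have h1 : latticeMap (A.adjugate * A) x = latticeMap (A.adjugate * A) y := by
    rw [latticeMap_mul, latticeMap_mul, hxy]
  rw [adjugate_mul] at h1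
  have h2 : ∀ x, latticeMap (A.det • (1 : IntMat)) x = (A.det : ℝ) • x := by
    intro x
    have : (A.det • (1 : IntMat)).map (Int.cast : ℤ → ℝ) = (A.det : ℝ) • 1 := by
      ext i j
      rw [Matrix.map_apply, Matrix.smul_apply, Matrix.smul_apply, Matrix.one_apply,
        Matrix.one_apply]
      split_ifs <;> simp
    simp only [latticeMap, this, map_smul, LinearMap.smul_apply]
    simp
  rw [h2, h2] at h1
  exact smul_right_injective _ (by exact_mod_cast h) h1

/-- The segment from the identity to `A` stays invertible: since `A` preserves norms, a kernel
vector can occur only at the midpoint, and there it is an eigenvector for `-1`. -/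
theorem ambientIsotopic_latticeMap_of_det_ne_zero {A : IntMat} (hA : Aᵀ * A = 1)
    (h : (A + 1).det ≠ 0) (p : Space) (S : Set Space) :
    AmbientIsotopic S ((fun x => latticeMap A x + p) '' S) := by
  apply ambientIsotopic_of_injective_segment
  intro t ht
  rw [← LinearMap.ker_eq_bot, LinearMap.ker_eq_bot']
  intro x hx
  have h1 : (1 - t) • x = -(t • latticeMap A x) := by
    simp only [LinearMap.add_apply, LinearMap.id_apply, LinearMap.smul_apply,
      LinearMap.sub_apply] at hx
    rw [← sub_eq_zero, ← hx]
    module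
  have h2 := congrArg norm h1
  rw [norm_neg, norm_smul, norm_smul, norm_latticeMap hA, Real.norm_of_nonneg ht.1,
    Real.norm_of_nonneg (by linarith [ht.2])] at h2
  by_contra hx0
  -- Comparison of norms leaves only `t = 1/2`, where the equation reads `A x = -x`.
  have h3 : 1 - t = t := mul_right_cancel₀ (norm_ne_zero_iff.mpr hx0) h2
  have ht0 : t ≠ 0 := by intro h; rw [h] at h3; norm_num at h3
  rw [h3, ← smul_neg] at h1
  have h4 : x = -latticeMap A x := smul_right_injective _ ht0 h1
  have h5 : latticeMap (A + 1) x = latticeMap (A + 1) 0 := by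
    rw [latticeMap_add, latticeMap_one, map_zero]
    nth_rewrite 2 [h4]
    abel
  exact hx0 (latticeMap_injective_of_det_ne_zero h h5)

/-- Half-turns have the eigenvalue `-1`, so the straight segment is not available for them. Writing
`A` as `Qᵀ * (Q * A)`, with `Q` the identity, a third turn or a quarter turn, avoids this. The
lattice rotations are finite in number and are checked one by one. -/
theorem exists_factor_det_ne_zero {A : IntMat} (hA : Aᵀ * A = 1) (hdet : A.det = 1) :
    ∃ Q : IntMat, Qᵀ * Q = 1 ∧ (Qᵀ + 1).det ≠ 0 ∧ (Q * A + 1).det ≠ 0 := by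
  have fin : ∀ a ∈ unitVectors, ∀ b ∈ unitVectors, ∀ c ∈ unitVectors,
      (Matrix.of ![a, b, c] : IntMat).det = 1 →
      ∃ Q ∈ ([1, !![0, 1, 0; 0, 0, 1; 1, 0, 0], !![1, 0, 0; 0, 0, -1; 0, 1, 0],
        !![0, -1, 0; 1, 0, 0; 0, 0, 1]] : List IntMat),
        Qᵀ * Q = 1 ∧ (Qᵀ + 1).det ≠ 0 ∧ (Q * Matrix.of ![a, b, c] + 1).det ≠ 0 := by
    simp only [Matrix.det_fin_three]
    decide +kernel
  have hrow : ∀ i, A i ∈ unitVectors := by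
    intro i
    apply mem_unitVectors
    have h1 : A * Aᵀ = 1 := mul_eq_one_comm.mp hA
    have := congrFun (congrFun h1 i) i
    simpa [Matrix.mul_apply, dotProduct] using this
  have hA' : A = Matrix.of ![A 0, A 1, A 2] := by
    ext i j; fin_cases i <;> rfl
  obtain ⟨Q, -, hQ⟩ := fin _ (hrow 0) _ (hrow 1) _ (hrow 2) (by rw [← hA']; exact hdet)
  rw [← hA'] at hQ
  exact ⟨Q, hQ⟩

/-- A direct isometry of the lattice isotopes every set to its image. -/
theorem ambientIsotopic_latticeMap {A : IntMat} (hA : Aᵀ * A = 1) (hdet : A.det = 1)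
    (p : Space) (S : Set Space) : AmbientIsotopic S ((fun x => latticeMap A x + p) '' S) := by
  obtain ⟨Q, hQ, h1, h2⟩ := exists_factor_det_ne_zero hA hdet
  have hQ' : Qᵀᵀ * Qᵀ = 1 := by
    rw [transpose_transpose]; exact mul_eq_one_comm.mp hQ
  have hQA : (Q * A)ᵀ * (Q * A) = 1 := by
    rw [transpose_mul, Matrix.mul_assoc, ← Matrix.mul_assoc Qᵀ, hQ, Matrix.one_mul, hA]
  have h3 := (ambientIsotopic_latticeMap_of_det_ne_zero hQA h2 0 S).trans
    (ambientIsotopic_latticeMap_of_det_ne_zero hQ' h1 p _)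
  rw [Set.image_image] at h3
  convert h3 using 2
  ext1 x
  rw [add_zero, ← latticeMap_mul, ← Matrix.mul_assoc, hQ, Matrix.one_mul]

/-! ### Piecewise linear curves and estimates from their vertices -/

section PiecewiseLinear

variable {V W : Type*} [AddCommGroup V] [Module ℝ V] [AddCommGroup W] [Module ℝ W]

/-- The piecewise linear curve with the vertices `v 0, v 1, …`. -/
noncomputable def polyline (v : ℕ → V) (x : ℝ) : V :=
  AffineMap.lineMap (v ⌊x⌋₊) (v (⌊x⌋₊ + 1)) (x - ⌊x⌋₊)

theorem polyline_natCast (v : ℕ → V) (r : ℕ) : polyline v r = v r := by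
  simp [polyline]

theorem polyline_natCast_add (v : ℕ → V) (r : ℕ) {s : ℝ} (hs : s ∈ Set.Icc (0 : ℝ) 1) :
    polyline v (r + s) = AffineMap.lineMap (v r) (v (r + 1)) s := by
  rcases hs.2.lt_or_eq with h | rfl
  · have : ⌊(r : ℝ) + s⌋₊ = r := by
      rw [Nat.floor_eq_iff (by have := hs.1; positivity)]
      exact ⟨by linarith [hs.1], by linarith⟩
    simp [polyline, this]
  · have := polyline_natCast v (r + 1)
    push_cast at this
    simp [this]

theorem exists_natCast_add {n : ℕ} (hn : 0 < n) {x : ℝ} (hx : x ∈ Set.Icc (0 : ℝ) n) :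
    ∃ r < n, ∃ s ∈ Set.Icc (0 : ℝ) 1, x = r + s := by
  rcases hx.2.lt_or_eq with h | rfl
  · exact ⟨⌊x⌋₊, (Nat.floor_lt hx.1).2 h, x - ⌊x⌋₊, ⟨by linarith [Nat.floor_le hx.1],
      by linarith [Nat.lt_floor_add_one x]⟩, by ring⟩
  · exact ⟨n - 1, by omega, 1, by simp, by push_cast [Nat.cast_sub hn]; ring⟩

theorem map_polyline (f : V →ₗ[ℝ] W) (v : ℕ → V) (x : ℝ) :
    f (polyline v x) = polyline (fun r => f (v r)) x := by
  simp [polyline, AffineMap.lineMap_apply_module]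

theorem polyline_congr {v w : ℕ → V} {n : ℕ} (h : ∀ r ≤ n, v r = w r) {x : ℝ}
    (hx : x ∈ Set.Icc (0 : ℝ) n) : polyline v x = polyline w x := by
  rcases Nat.eq_zero_or_pos n with rfl | hn
  · have : x = (0 : ℕ) := by
      have h1 := hx.1
      have h2 := hx.2
      push_cast at *
      linarith
    rw [this, polyline_natCast, polyline_natCast, h 0 le_rfl]
  · obtain ⟨r, hr, s, hs, rfl⟩ := exists_natCast_add hn hx
    rw [polyline_natCast_add _ _ hs, polyline_natCast_add _ _ hs, h r hr.le, h (r + 1) hr]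

theorem polyline_shift (v : ℕ → V) (m : ℕ) {x : ℝ} (hx : 0 ≤ x) :
    polyline (fun r => v (m + r)) x = polyline v (m + x) := by
  have : ⌊(m : ℝ) + x⌋₊ = m + ⌊x⌋₊ := by
    rw [add_comm, Nat.floor_add_natCast hx, add_comm]
  simp only [polyline, this]
  congr 1
  push_cast
  ring

theorem polyline_add (v w : ℕ → V) (x : ℝ) :
    polyline (fun r => v r + w r) x = polyline v x + polyline w x := by
  simp only [polyline, AffineMap.lineMap_apply_module]
  module

theorem polyline_smul (c : ℝ) (v : ℕ → V) (x : ℝ) :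
    polyline (fun r => c • v r) x = c • polyline v x := by
  simp only [polyline, AffineMap.lineMap_apply_module]
  module

theorem polyline_sub (v w : ℕ → V) (x : ℝ) :
    polyline (fun r => v r - w r) x = polyline v x - polyline w x := by
  simp only [polyline, AffineMap.lineMap_apply_module]
  module

theorem polyline_const (c : V) (x : ℝ) : polyline (fun _ => c) x = c := by
  simp [polyline]

theorem polyline_affine (a c : ℝ) (x : ℝ) : polyline (fun r : ℕ => a + c * r) x = a + c * x := by
  simp only [polyline, AffineMap.lineMap_apply_module, smul_eq_mul]
  push_cast
  ring

theorem polyline_nonneg {a : ℕ → ℝ} {m n : ℕ} (h : ∀ r, m ≤ r → r ≤ n → 0 ≤ a r) {x : ℝ}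
    (hx : x ∈ Set.Icc (m : ℝ) n) : 0 ≤ polyline a x := by
  have hx0 : 0 ≤ x := (Nat.cast_nonneg m).trans hx.1
  have h1 : m ≤ ⌊x⌋₊ := Nat.le_floor hx.1
  have h2 : ⌊x⌋₊ ≤ n := by exact_mod_cast (Nat.floor_le hx0).trans hx.2
  rcases h2.lt_or_eq with h3 | h3
  · have ha := h _ h1 h2
    have hb := h (⌊x⌋₊ + 1) (by omega) h3
    have hs0 := Nat.floor_le hx0
    have hs1 := Nat.lt_floor_add_one x
    simp only [polyline, AffineMap.lineMap_apply_module, smul_eq_mul]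
    have : 0 ≤ (1 - (x - ⌊x⌋₊)) * a ⌊x⌋₊ := mul_nonneg (by linarith) ha
    have : 0 ≤ (x - ⌊x⌋₊) * a (⌊x⌋₊ + 1) := mul_nonneg (by linarith) hb
    linarith
  · have : x = n := le_antisymm hx.2 (by rw [← h3]; exact Nat.floor_le hx0)
    rw [this, polyline_natCast]
    exact h n (by omega) le_rfl

/-- Together with `polyline_sub_ge`, this turns integer inequalities at the vertices into
inequalities at all real parameters. -/
theorem polyline_le_affine {a : ℕ → ℝ} {m n : ℕ} {b c : ℝ}
    (h : ∀ r, m ≤ r → r ≤ n → a r ≤ b + c * r) {x : ℝ} (hx : x ∈ Set.Icc (m : ℝ) n) :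
    polyline a x ≤ b + c * x := by
  have h1 := polyline_nonneg (a := fun r : ℕ => (b + c * r) - a r)
    (fun r hr hr' => sub_nonneg.2 (h r hr hr')) hx
  rw [polyline_sub (fun r : ℕ => b + c * r) a, polyline_affine] at h1
  linarith

theorem polyline_mono {a : ℕ → ℝ} {m n : ℕ} (h : ∀ r, m ≤ r → r < n → a r ≤ a (r + 1))
    {x y : ℝ} (hx : (m : ℝ) ≤ x) (hy : y ≤ n) (hxy : x ≤ y) :
    polyline a x ≤ polyline a y := by
  have hx0 : 0 ≤ x := (Nat.cast_nonneg m).trans hx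
  have hm : ∀ r r', m ≤ r → r ≤ r' → r' ≤ n → a r ≤ a r' := by
    intro r r' h1 h2
    induction r', h2 using Nat.le_induction with
    | base => intro _; exact le_rfl
    | succ k hk ih => intro h3; exact (ih (by omega)).trans (h k (by omega) (by omega))
  have hfx : m ≤ ⌊x⌋₊ := Nat.le_floor hx
  have hs0 := Nat.floor_le hx0
  have hs1 := Nat.lt_floor_add_one x
  have ht0 := Nat.floor_le (hx0.trans hxy)
  have ht1 := Nat.lt_floor_add_one y
  rcases (Nat.floor_mono hxy).lt_or_eq with hlt | heq
  · have hyn : ⌊y⌋₊ ≤ n := by exact_mod_cast ht0.trans hy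
    have h1 : polyline a x ≤ a (⌊x⌋₊ + 1) := by
      have := hm ⌊x⌋₊ (⌊x⌋₊ + 1) hfx (by omega) (by omega)
      simp only [polyline, AffineMap.lineMap_apply_module, smul_eq_mul]
      nlinarith
    have h2 : a ⌊y⌋₊ ≤ polyline a y := by
      rcases hyn.lt_or_eq with h3 | h3
      · have := hm ⌊y⌋₊ (⌊y⌋₊ + 1) (by omega) (by omega) (by omega)
        simp only [polyline, AffineMap.lineMap_apply_module, smul_eq_mul]
        nlinarith
      · have h4 : y = ⌊y⌋₊ := le_antisymm (by rw [h3]; exact hy) ht0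
        rw [h4, polyline_natCast, Nat.floor_natCast]
    exact h1.trans ((hm _ _ (by omega) hlt hyn).trans h2)
  · rcases hxy.lt_or_eq with h4 | rfl
    · have hyn : ⌊x⌋₊ < n := by
        have : (⌊x⌋₊ : ℝ) < n := by linarith
        exact_mod_cast this
      have := h _ hfx hyn
      simp only [polyline, AffineMap.lineMap_apply_module, smul_eq_mul, ← heq]
      nlinarith
    · exact le_rfl

/-- Subtracting the affine function of slope `c` reduces this to monotonicity. -/
theorem polyline_sub_ge {a : ℕ → ℝ} {m n : ℕ} {c : ℝ}
    (h : ∀ r, m ≤ r → r < n → c ≤ a (r + 1) - a r)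
    {x y : ℝ} (hx : (m : ℝ) ≤ x) (hy : y ≤ n) (hxy : x ≤ y) :
    c * (y - x) ≤ polyline a y - polyline a x := by
  have h1 := polyline_mono (a := fun r : ℕ => a r - (0 + c * r)) (m := m) (n := n)
    (fun r hr hr' => by have := h r hr hr'; push_cast; linarith) hx hy hxy
  rw [polyline_sub a (fun r : ℕ => 0 + c * r), polyline_affine,
    polyline_sub a (fun r : ℕ => 0 + c * r), polyline_affine] at h1
  linarith

end PiecewiseLinear

/-- The difference `d` of the two values is tested against itself: along the linear form `inner ℝ
d`, every edge contributes at most `‖d‖ * c`, which bounds `‖d‖ ^ 2`. -/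
theorem norm_polyline_sub_le {V : Type*} [NormedAddCommGroup V] [InnerProductSpace ℝ V]
    {v : ℕ → V} {n : ℕ} {c : ℝ}
    (h : ∀ r < n, ‖v (r + 1) - v r‖ ≤ c) {x y : ℝ} (hx : 0 ≤ x) (hy : y ≤ n) (hxy : x ≤ y) :
    ‖polyline v y - polyline v x‖ ≤ c * (y - x) := by
  set d := polyline v y - polyline v x with hd
  have key : inner ℝ d d ≤ ‖d‖ * (c * (y - x)) := by
    have h1 := polyline_sub_ge (a := fun r => -inner ℝ d (v r)) (m := 0) (n := n)
      (c := -(‖d‖ * c)) (fun r _ hr => by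
        have h2 := real_inner_le_norm d (v (r + 1) - v r)
        have h3 := mul_le_mul_of_nonneg_left (h r hr) (norm_nonneg d)
        rw [inner_sub_right] at h2
        linarith) (by simpa using hx) hy hxy
    have h2 : ∀ z, polyline (fun r => -inner ℝ d (v r)) z = -inner ℝ d (polyline v z) := by
      intro z
      have := map_polyline (-(innerₛₗ ℝ d)) v z
      simpa using this.symm
    rw [h2, h2] at h1
    have h3 : inner ℝ d d = inner ℝ d (polyline v y) - inner ℝ d (polyline v x) := by
      rw [← inner_sub_right]
    rw [h3]
    linarith
  rw [real_inner_self_eq_norm_sq] at key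
  rcases (norm_nonneg d).lt_or_eq with h0 | h0
  · nlinarith
  · rw [← h0]
    rcases Nat.eq_zero_or_pos n with rfl | hn
    · have : y - x = 0 := by
        have : y ≤ 0 := by simpa using hy
        linarith
      rw [this, mul_zero]
    · have : 0 ≤ c := (norm_nonneg _).trans (h 0 hn)
      exact mul_nonneg this (by linarith)

theorem norm_polyline_le {V : Type*} [SeminormedAddCommGroup V] [NormedSpace ℝ V]
    {v : ℕ → V} {n : ℕ} {c : ℝ} (hn : 0 < n)
    (h : ∀ r ≤ n, ‖v r‖ ≤ c) {x : ℝ} (hx : x ∈ Set.Icc (0 : ℝ) n) : ‖polyline v x‖ ≤ c := by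
  obtain ⟨r, hr, s, hs, rfl⟩ := exists_natCast_add hn hx
  rw [polyline_natCast_add _ _ hs]
  have h1 := (convex_closedBall (0 : V) c).lineMap_mem (x := v r) (y := v (r + 1))
    (by simpa using h r hr.le) (by simpa using h (r + 1) hr) hs
  simpa using h1

/-! ### Flags -/

/-- A pyramid with centre of cube `o`, face direction `u` and face centre `o + u`, and edge with
midpoint `o + u + g` and direction `h`, pointing from the end coloured `B` to the one coloured `A`. -/
@[ext] structure Flag : Type where
  o : IntVec
  u : IntVec
  g : IntVec
  h : IntVec

namespace Flag

/-- The vertices of the pyramid. -/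
def vertex (φ : Flag) : Colour → IntVec
  | .A => φ.o + (φ.u + φ.g + φ.h)
  | .B => φ.o + (φ.u + φ.g - φ.h)
  | .C => φ.o + φ.u
  | .D => φ.o

/-- The pyramid on the other side of a face. -/
def step (φ : Flag) : Colour → Flag
  | .A => ⟨φ.o, φ.u, -φ.h, -φ.g⟩
  | .B => ⟨φ.o, φ.u, φ.h, φ.g⟩
  | .C => ⟨φ.o, φ.g, φ.u, φ.h⟩
  | .D => ⟨φ.o + (2 : ℤ) • φ.u, -φ.u, φ.g, φ.h⟩

/-- The end of the gallery with a given word. -/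
def run (φ : Flag) (w : List Colour) : Flag := w.foldl step φ

theorem run_append (φ : Flag) (v w : List Colour) : φ.run (v ++ w) = (φ.run v).run w :=
  List.foldl_append

theorem run_cons (φ : Flag) (X : Colour) (w : List Colour) : φ.run (X :: w) = (φ.step X).run w :=
  rfl

/-- Four times the barycentre. -/
def centre (φ : Flag) : IntVec := (4 : ℤ) • φ.o + ((3 : ℤ) • φ.u + (2 : ℤ) • φ.g)

end Flag

/-! ### Motions of the lattice of cubes -/

/-- The map `x ↦ lin x + cube` on the indices of cubes. -/
@[ext] structure Motion : Type where
  lin : IntMat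
  cube : IntVec

namespace Motion

instance : Monoid Motion where
  mul X Y := ⟨X.lin * Y.lin, X.lin *ᵥ Y.cube + X.cube⟩
  one := ⟨1, 0⟩
  mul_assoc X Y Z := by
    apply Motion.ext
    · exact Matrix.mul_assoc _ _ _
    · change (X.lin * Y.lin) *ᵥ Z.cube + (X.lin *ᵥ Y.cube + X.cube) =
        X.lin *ᵥ (Y.lin *ᵥ Z.cube + Y.cube) + X.cube
      rw [mulVec_add, mulVec_mulVec, add_assoc]
  one_mul X := by
    apply Motion.ext
    · exact Matrix.one_mul _
    · change (1 : IntMat) *ᵥ X.cube + 0 = X.cube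
      rw [one_mulVec, add_zero]
  mul_one X := by
    apply Motion.ext
    · exact Matrix.mul_one _
    · change X.lin *ᵥ 0 + X.cube = X.cube
      rw [mulVec_zero, zero_add]

theorem mul_lin (X Y : Motion) : (X * Y).lin = X.lin * Y.lin := rfl

theorem mul_cube (X Y : Motion) : (X * Y).cube = X.lin *ᵥ Y.cube + X.cube := rfl

theorem one_lin : (1 : Motion).lin = 1 := rfl

theorem one_cube : (1 : Motion).cube = 0 := rfl

/-- The motion is an isometry. -/
def IsOrthogonal (X : Motion) : Prop := X.linᵀ * X.lin = 1

theorem IsOrthogonal.mul {X Y : Motion} (hX : X.IsOrthogonal) (hY : Y.IsOrthogonal) :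
    (X * Y).IsOrthogonal := by
  unfold IsOrthogonal at *
  rw [mul_lin, transpose_mul, Matrix.mul_assoc, ← Matrix.mul_assoc X.linᵀ, hX, Matrix.one_mul, hY]

/-- The inverse of an orthogonal motion. -/
def inverse (X : Motion) : Motion := ⟨X.linᵀ, -(X.linᵀ *ᵥ X.cube)⟩

theorem IsOrthogonal.inverse_mul {X : Motion} (hX : X.IsOrthogonal) : X.inverse * X = 1 := by
  apply Motion.ext
  · exact hX
  · change X.linᵀ *ᵥ X.cube + -(X.linᵀ *ᵥ X.cube) = 0
    abel

theorem IsOrthogonal.inverse {X : Motion} (hX : X.IsOrthogonal) : X.inverse.IsOrthogonal := by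
  change X.linᵀᵀ * X.linᵀ = 1
  rw [transpose_transpose]
  exact mul_eq_one_comm.mp hX

/-- The action on pyramids. -/
def act (X : Motion) (φ : Flag) : Flag :=
  ⟨X.lin *ᵥ φ.o + (2 : ℤ) • X.cube, X.lin *ᵥ φ.u, X.lin *ᵥ φ.g, X.lin *ᵥ φ.h⟩

theorem act_mul (X Y : Motion) (φ : Flag) : (X * Y).act φ = X.act (Y.act φ) := by
  apply Flag.ext
  · simp only [act, mul_lin, mul_cube, mulVec_add, mulVec_smul, mulVec_mulVec, smul_add, add_assoc]
  all_goals simp only [act, mul_lin, mulVec_mulVec]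

theorem act_one (φ : Flag) : (1 : Motion).act φ = φ := by
  simp [act, one_lin, one_cube]

/-- Crossing a face is expressed in the directions `u`, `g`, `h` alone, hence commutes with every
motion. Galleries can therefore be computed in the coordinates of the moving frame. -/
theorem act_step (X : Motion) (φ : Flag) (c : Colour) : X.act (φ.step c) = (X.act φ).step c := by
  cases c <;> simp only [act, Flag.step, mulVec_add, mulVec_smul, mulVec_neg]
  congr 1
  abel

theorem act_run (X : Motion) (φ : Flag) (w : List Colour) :
    X.act (φ.run w) = (X.act φ).run w := by
  induction w generalizing φ with
  | nil => rfl
  | cons c w ih => rw [Flag.run_cons, Flag.run_cons, ih, act_step]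

theorem centre_act (X : Motion) (φ : Flag) :
    (X.act φ).centre = X.lin *ᵥ φ.centre + (8 : ℤ) • X.cube := by
  simp only [act, Flag.centre, mulVec_add, mulVec_smul, smul_add, smul_smul]
  norm_num
  abel

end Motion

/-! ### Blocks of the word -/

/-- A letter of the code read in a cube of given parity, or a gluing. -/
inductive Block : Type
  | letter (m : Move) (p : Parity)
  | glue (s : GluingType)

namespace Block

/-- The word of a block. -/
def word : Block → List Colour
  | letter m p => letterWord m p
  | glue s => gluingWord s

/-- The word with its last two letters moved to the front. -/
def rotatedWord (b : Block) : List Colour := .D :: .C :: b.word.dropLast.dropLast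

/-- The length of the word. -/
def size (b : Block) : ℕ := b.word.length

/-- The parity of the cube in which the block is read. -/
def parity : Block → Parity
  | letter _ p => p
  | glue .one => .odd
  | glue .negOne => .odd
  | glue .i => .even
  | glue .negI => .even

/-- The parity of the next cube. -/
def nextParity : Block → Parity
  | letter m p => p.next m
  | glue _ => .even

/-- The change of the moving frame, in the coordinates of the frame. -/
def turn : Block → IntMat
  | letter .f _ => 1
  | letter .u _ => !![0, -1, 0; 1, 0, 0; 0, 0, 1]
  | letter .d _ => !![0, 1, 0; -1, 0, 0; 0, 0, 1]
  | letter .r _ => !![0, 0, -1; 0, 1, 0; 1, 0, 0]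
  | letter .l _ => !![0, 0, 1; 0, 1, 0; -1, 0, 0]
  | glue .one => 1
  | glue .i => !![1, 0, 0; 0, 0, -1; 0, 1, 0]
  | glue .negOne => !![1, 0, 0; 0, -1, 0; 0, 0, -1]
  | glue .negI => !![1, 0, 0; 0, 0, 1; 0, -1, 0]

/-- The direction in which the cube is left, in the coordinates of the frame. -/
def exit (b : Block) : IntVec := fun i => b.turn i 0

/-- The motion to the next cube, in the coordinates of the frame. -/
def motion (b : Block) : Motion := ⟨b.turn, b.exit⟩

/-- Linear forms that are monotone on the way through the cube: across the midpoint, on the first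
half and on the second half. -/
def form : Block → Fin 3 → IntVec
  | letter .f _ => fun _ => ![1, 0, 0]
  | letter .u _ => ![![1, 1, 0], ![2, 1, 0], ![1, 2, 0]]
  | letter .d _ => fun _ => ![1, -1, 0]
  | letter .r _ => fun _ => ![1, 0, 1]
  | letter .l _ => fun _ => ![1, 0, -1]
  | glue _ => fun _ => ![2, 1, 0]

end Block

/-- The tangent vector in the coordinates of the frame. -/
def tangent : IntVec := ![1, 0, 0]

/-- The first pyramid of a cube in the coordinates of the frame. -/
def startFlag : Parity → Flag
  | .even => ⟨0, ![0, -1, 0], ![-1, 0, 0], ![0, 0, 1]⟩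
  | .odd => ⟨0, ![0, -1, 0], ![-1, 0, 0], ![0, 0, -1]⟩

/-- The last pyramid of the previous cube. -/
def preFlag (p : Parity) : Flag := ((startFlag p).step .C).step .D

/-- Crossing the same face twice leads back. This explains the shift by two between the rotated
gallery and the gallery of the theorem. -/
theorem run_preFlag (p : Parity) : (preFlag p).run [.D, .C] = startFlag p := by
  cases p <;> apply Flag.ext <;> decide +kernel

namespace Block

/-- The pyramids of the way through a cube. -/
def flag (b : Block) (r : ℕ) : Flag := (preFlag b.parity).run ((b.rotatedWord ++ [Colour.D]).take r)

/-- Vertices and midpoints of edges of the curve through the barycentres, multiplied by `8`. -/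
def midpoint (b : Block) (r : ℕ) : IntVec :=
  (b.flag ((r + 1) / 2)).centre + (b.flag ((r + 2) / 2)).centre

/-- The way through the cube along the barycentres of the pyramids, in the unit `1 / (8 * size)`. -/
def galleryArc (b : Block) (r : ℕ) : IntVec := (b.size : ℤ) • b.midpoint r

/-- The way through the cube by its centre, in the unit `1 / (8 * size)`. -/
def straightArc (b : Block) (r : ℕ) : IntVec :=
  (8 * ((r : ℤ) - b.size)) • (if r ≤ b.size then tangent else b.exit)

/-- The conditions on a way through a cube. -/
structure IsAdmissible (b : Block) (I : ℕ → IntVec) : Prop where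
  first : ∀ r < b.size, 1 ≤ b.form 1 ⬝ᵥ (I (r + 1) - I r)
  second : ∀ r < b.size, 1 ≤ b.form 2 ⬝ᵥ (I (b.size + r + 1) - I (b.size + r))
  before : ∀ r < b.size + 1, (b.size : ℤ) - r ≤ b.form 0 ⬝ᵥ (I b.size - I r)
  after : ∀ r < b.size + 1, (r : ℤ) ≤ b.form 0 ⬝ᵥ (I (b.size + r) - I b.size)
  enter : ∀ r < 2 * b.size + 1, -tangent ⬝ᵥ I r ≤ 8 * b.size - r
  leave : ∀ r < 2 * b.size + 1, b.exit ⬝ᵥ I r ≤ 8 * b.size - (2 * b.size - r)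
  avoid : ∀ φ ∈ unitVectors, φ ≠ -tangent → φ ≠ b.exit → ∀ r < 2 * b.size + 1,
    φ ⬝ᵥ I r ≤ 8 * b.size - 2 * b.size
  bound : ∀ r < 2 * b.size + 1, I r ⬝ᵥ I r ≤ 4 * (8 * b.size) ^ 2
  speed : ∀ r < 2 * b.size, (I (r + 1) - I r) ⬝ᵥ (I (r + 1) - I r) ≤ (8 * b.size) ^ 2

theorem isAdmissible_iff (b : Block) (I : ℕ → IntVec) : b.IsAdmissible I ↔
    (∀ r < b.size, 1 ≤ b.form 1 ⬝ᵥ (I (r + 1) - I r)) ∧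
    (∀ r < b.size, 1 ≤ b.form 2 ⬝ᵥ (I (b.size + r + 1) - I (b.size + r))) ∧
    (∀ r < b.size + 1, (b.size : ℤ) - r ≤ b.form 0 ⬝ᵥ (I b.size - I r)) ∧
    (∀ r < b.size + 1, (r : ℤ) ≤ b.form 0 ⬝ᵥ (I (b.size + r) - I b.size)) ∧
    (∀ r < 2 * b.size + 1, -tangent ⬝ᵥ I r ≤ 8 * b.size - r) ∧
    (∀ r < 2 * b.size + 1, b.exit ⬝ᵥ I r ≤ 8 * b.size - (2 * b.size - r)) ∧
    (∀ φ ∈ unitVectors, φ ≠ -tangent → φ ≠ b.exit → ∀ r < 2 * b.size + 1,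
      φ ⬝ᵥ I r ≤ 8 * b.size - 2 * b.size) ∧
    (∀ r < 2 * b.size + 1, I r ⬝ᵥ I r ≤ 4 * (8 * b.size) ^ 2) ∧
    (∀ r < 2 * b.size, (I (r + 1) - I r) ⬝ᵥ (I (r + 1) - I r) ≤ (8 * b.size) ^ 2) :=
  ⟨fun ⟨a, b, c, d, e, f, g, h, i⟩ => ⟨a, b, c, d, e, f, g, h, i⟩,
    fun ⟨a, b, c, d, e, f, g, h, i⟩ => ⟨a, b, c, d, e, f, g, h, i⟩⟩

instance (b : Block) (I : ℕ → IntVec) : Decidable (b.IsAdmissible I) :=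
  decidable_of_iff' _ (isAdmissible_iff b I)

/-- The common unit makes both arcs integral, so all conditions are decidable. The two arcs satisfy
them with the same forms and the same margins, and this is what carries over to their convex
combinations. -/
theorem isAdmissible_straightArc (b : Block) : b.IsAdmissible b.straightArc := by
  rcases b with ⟨m, p⟩ | s
  · cases m <;> cases p <;> decide +kernel
  · cases s <;> decide +kernel

theorem isAdmissible_galleryArc (b : Block) : b.IsAdmissible b.galleryArc := by
  rcases b with ⟨m, p⟩ | s
  · cases m <;> cases p <;> decide +kernel
  · cases s <;> decide +kernel

theorem form_dot_self_le (b : Block) (i : Fin 3) : b.form i ⬝ᵥ b.form i ≤ 9 := by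
  revert i
  rcases b with ⟨m, p⟩ | s
  · cases m <;> cases p <;> decide +kernel
  · cases s <;> decide +kernel

theorem size_bounds (b : Block) : 2 ≤ b.size ∧ b.size ≤ 8 := by
  rcases b with ⟨m, p⟩ | s
  · cases m <;> cases p <;> decide +kernel
  · cases s <;> decide +kernel

theorem turn_orthogonal (b : Block) : b.turnᵀ * b.turn = 1 := by
  rcases b with ⟨m, p⟩ | s
  · cases m <;> cases p <;> decide +kernel
  · cases s <;> decide +kernel

theorem turn_tangent (b : Block) : b.turn *ᵥ tangent = b.exit := by
  rcases b with ⟨m, p⟩ | s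
  · cases m <;> cases p <;> decide +kernel
  · cases s <;> decide +kernel

theorem exit_unit (b : Block) : b.exit ⬝ᵥ b.exit = 1 := by
  rcases b with ⟨m, p⟩ | s
  · cases m <;> cases p <;> decide +kernel
  · cases s <;> decide +kernel

theorem exit_ne (b : Block) : b.exit ≠ -tangent := by
  rcases b with ⟨m, p⟩ | s
  · cases m <;> cases p <;> decide +kernel
  · cases s <;> decide +kernel

theorem word_rotate (b : Block) : [.D, .C] ++ b.word = b.rotatedWord ++ [.D, .C] := by
  rcases b with ⟨m, p⟩ | s
  · cases m <;> cases p <;> rfl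
  · cases s <;> rfl

theorem length_rotatedWord (b : Block) : b.rotatedWord.length = b.size := by
  have := congrArg List.length b.word_rotate
  simpa [size] using this.symm

/-- The correctness of the translation for one block: the passage ends over the exit face, in the
position from which the next block, read in its own frame and parity, starts. -/
theorem run_rotatedWord (b : Block) :
    (preFlag b.parity).run b.rotatedWord = b.motion.act (preFlag b.nextParity) := by
  rcases b with ⟨m, p⟩ | s
  · cases m <;> cases p <;> apply Flag.ext <;> decide +kernel
  · cases s <;> apply Flag.ext <;> decide +kernel

/-- Lower bound for the distance from the faces of the cube on the way through it. -/
def margin (b : Block) (ψ : IntVec) (x : ℝ) : ℝ :=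
  if ψ = -tangent then x else if ψ = b.exit then 2 * b.size - x else 2 * b.size

end Block

/-- A path of cubes with moving frames. -/
structure Chain : Type where
  block : ℕ → Block
  place : ℕ → Motion
  orthogonal : ∀ j, (place j).IsOrthogonal
  place_succ : ∀ j, place (j + 1) = place j * (block j).motion

/-! ### Separation of points on the homotopy -/

namespace Chain

variable (c : Chain)

/-- The index of the `j`-th cube. -/
def cube (j : ℕ) : IntVec := (c.place j).cube

/-- The number of letters of the `j`-th block. -/
def size (j : ℕ) : ℕ := (c.block j).size

theorem size_pos (j : ℕ) : 0 < c.size j := by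
  have := (c.block j).size_bounds
  unfold size
  omega

theorem cube_succ (j : ℕ) : c.cube (j + 1) = c.cube j + (c.place j).lin *ᵥ (c.block j).exit := by
  unfold cube
  rw [c.place_succ, Motion.mul_cube, add_comm]
  rfl

theorem lin_succ_tangent (j : ℕ) :
    (c.place (j + 1)).lin *ᵥ tangent = (c.place j).lin *ᵥ (c.block j).exit := by
  rw [c.place_succ, Motion.mul_lin, ← mulVec_mulVec]
  congr 1
  exact (c.block j).turn_tangent

/-- The vertices of a way through the `j`-th cube, given in the coordinates of the frame. -/
noncomputable def arcVertex (I : Block → ℕ → IntVec) (j r : ℕ) : Space :=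
  pt ((2 : ℤ) • c.cube j) + (8 * (c.size j : ℝ))⁻¹ • pt ((c.place j).lin *ᵥ I (c.block j) r)

/-- A way through the `j`-th cube. -/
noncomputable def arc (I : Block → ℕ → IntVec) (j : ℕ) (x : ℝ) : Space :=
  polyline (c.arcVertex I j) x

/-- The linear homotopy from the way by the centre of the cube to the gallery. -/
noncomputable def homotopy (t : ℝ) (j : ℕ) (x : ℝ) : Space :=
  AffineMap.lineMap (c.arc Block.straightArc j x) (c.arc Block.galleryArc j x) t

variable {c}

theorem inner_arc (I : Block → ℕ → IntVec) (j : ℕ) (ψ : IntVec) (x : ℝ) :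
    inner ℝ (pt ((c.place j).lin *ᵥ ψ)) (c.arc I j x - pt ((2 : ℤ) • c.cube j)) =
      (8 * (c.size j : ℝ))⁻¹ * polyline (fun r => ((ψ ⬝ᵥ I (c.block j) r : ℤ) : ℝ)) x := by
  have h1 : c.arc I j x - pt ((2 : ℤ) • c.cube j) =
      polyline (fun r => (8 * (c.size j : ℝ))⁻¹ • pt ((c.place j).lin *ᵥ I (c.block j) r)) x := by
    have := polyline_sub (c.arcVertex I j) (fun _ => pt ((2 : ℤ) • c.cube j)) x
    rw [polyline_const] at this
    rw [arc, ← this]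
    congr 1
    funext r
    rw [arcVertex, add_sub_cancel_left]
  rw [h1, polyline_smul, real_inner_smul_right]
  congr 1
  have h2 := map_polyline (innerₛₗ ℝ (pt ((c.place j).lin *ᵥ ψ)))
    (fun r => pt ((c.place j).lin *ᵥ I (c.block j) r)) x
  simp only [innerₛₗ_apply_apply, inner_pt, dot_mulVec_mulVec (c.orthogonal j)] at h2
  exact h2

theorem norm_pt_lin_sq (j : ℕ) (ψ : IntVec) :
    ‖pt ((c.place j).lin *ᵥ ψ)‖ ^ 2 = ((ψ ⬝ᵥ ψ : ℤ) : ℝ) := by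
  rw [norm_pt_sq, dot_mulVec_mulVec (c.orthogonal j)]

theorem eight_size_pos (j : ℕ) : (0 : ℝ) < 8 * c.size j := by
  have := c.size_pos j
  positivity

theorem size_le (j : ℕ) : (c.size j : ℝ) ≤ 8 := by
  exact_mod_cast (c.block j).size_bounds.2

/-- A linear form separates two points of the way through a cube. -/
theorem exists_form_le (j : ℕ) {x y : ℝ} (hx : 0 ≤ x) (hxy : x ≤ y) (hy : y ≤ 2 * c.size j) :
    ∃ i : Fin 3, ∀ I : Block → ℕ → IntVec, (c.block j).IsAdmissible (I (c.block j)) →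
      (8 * (c.size j : ℝ))⁻¹ * (y - x) ≤ inner ℝ (pt ((c.place j).lin *ᵥ (c.block j).form i))
        (c.arc I j y - c.arc I j x) := by
  have key : ∀ (i : Fin 3) (I : Block → ℕ → IntVec), (y - x ≤
      polyline (fun r => (((c.block j).form i ⬝ᵥ I (c.block j) r : ℤ) : ℝ)) y -
      polyline (fun r => (((c.block j).form i ⬝ᵥ I (c.block j) r : ℤ) : ℝ)) x) →
      (8 * (c.size j : ℝ))⁻¹ * (y - x) ≤ inner ℝ (pt ((c.place j).lin *ᵥ (c.block j).form i))
        (c.arc I j y - c.arc I j x) := by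
    intro i I h
    rw [← sub_sub_sub_cancel_right _ _ (pt ((2 : ℤ) • c.cube j)), inner_sub_right, inner_arc,
      inner_arc, ← mul_sub]
    have := eight_size_pos (c := c) j
    gcongr
  -- The form depends only on the halves of the passage in which the two parameters lie, and not on
  -- the arc; so it serves the straight arc and the gallery at once.
  rcases le_total y (c.size j) with h1 | h1
  · refine ⟨1, fun I hI => key _ _ ?_⟩
    have := polyline_sub_ge (a := fun r => (((c.block j).form 1 ⬝ᵥ I (c.block j) r : ℤ) : ℝ))
      (m := 0) (n := c.size j) (c := 1) (fun r _ hr => by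
        have := hI.first r hr
        rw [dotProduct_sub] at this
        exact_mod_cast this) (by simpa using hx) h1 hxy
    linarith
  · rcases le_total x (c.size j) with h2 | h2
    · refine ⟨0, fun I hI => key _ _ ?_⟩
      have h3 := polyline_le_affine
        (a := fun r => (((c.block j).form 0 ⬝ᵥ I (c.block j) r : ℤ) : ℝ))
        (m := 0) (n := c.size j) (c := 1)
        (b := (((c.block j).form 0 ⬝ᵥ I (c.block j) (c.size j) : ℤ) : ℝ) - c.size j)
        (fun r _ hr => by
          have h := hI.before r (Nat.lt_succ_of_le hr)
          rw [dotProduct_sub] at h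
          have h' := (Int.cast_le (R := ℝ)).2 h
          rw [Int.cast_sub, Int.cast_sub, Int.cast_natCast, Int.cast_natCast] at h'
          change (c.size j : ℝ) - r ≤ (((c.block j).form 0 ⬝ᵥ I (c.block j) (c.size j) : ℤ) : ℝ) -
            (((c.block j).form 0 ⬝ᵥ I (c.block j) r : ℤ) : ℝ) at h'
          linarith) (x := x) ⟨by simpa using hx, h2⟩
      have h4 := polyline_le_affine
        (a := fun r => -(((c.block j).form 0 ⬝ᵥ I (c.block j) r : ℤ) : ℝ))
        (m := c.size j) (n := 2 * c.size j) (c := -1)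
        (b := -(((c.block j).form 0 ⬝ᵥ I (c.block j) (c.size j) : ℤ) : ℝ) + c.size j)
        (fun r hr hr' => by
          obtain ⟨k, rfl⟩ := Nat.exists_eq_add_of_le hr
          have h := hI.after k (by unfold size at hr'; omega)
          rw [dotProduct_sub] at h
          have h' : ((k : ℤ) : ℝ) ≤
              (((c.block j).form 0 ⬝ᵥ I (c.block j) (c.size j + k) : ℤ) : ℝ) -
              (((c.block j).form 0 ⬝ᵥ I (c.block j) (c.size j) : ℤ) : ℝ) := by exact_mod_cast h
          push_cast at h' ⊢
          linarith) (x := y) ⟨h1, by push_cast; exact hy⟩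
      have h5 := map_polyline (-(LinearMap.id : ℝ →ₗ[ℝ] ℝ))
        (fun r => (((c.block j).form 0 ⬝ᵥ I (c.block j) r : ℤ) : ℝ)) y
      simp only [LinearMap.neg_apply, LinearMap.id_apply] at h5
      linarith
    · refine ⟨2, fun I hI => key _ _ ?_⟩
      have := polyline_sub_ge (a := fun r => (((c.block j).form 2 ⬝ᵥ I (c.block j) r : ℤ) : ℝ))
        (m := c.size j) (n := 2 * c.size j) (c := 1) (fun r hr hr' => by
          obtain ⟨k, rfl⟩ := Nat.exists_eq_add_of_le hr
          have := hI.second k (by unfold size at hr'; omega)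
          rw [dotProduct_sub] at this
          exact_mod_cast this) h2 (by push_cast; exact hy) hxy
      linarith

theorem norm_form_le (j : ℕ) (i : Fin 3) :
    ‖pt ((c.place j).lin *ᵥ (c.block j).form i)‖ ≤ 3 := by
  have h1 := norm_pt_lin_sq (c := c) j ((c.block j).form i)
  have h2 : (((c.block j).form i ⬝ᵥ (c.block j).form i : ℤ) : ℝ) ≤ 9 := by
    exact_mod_cast (c.block j).form_dot_self_le i
  nlinarith [norm_nonneg (pt ((c.place j).lin *ᵥ (c.block j).form i))]

/-- Both arcs advance along the same form, hence so does each intermediate one. The constant is `192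
= 3 * 64`: forms have norm at most 3, and `8 * size` is at most 64. -/
theorem le_norm_homotopy_sub (j : ℕ) {t x y : ℝ} (ht : t ∈ Set.Icc (0 : ℝ) 1) (hx : 0 ≤ x)
    (hxy : x ≤ y) (hy : y ≤ 2 * c.size j) :
    y - x ≤ 192 * ‖c.homotopy t j y - c.homotopy t j x‖ := by
  obtain ⟨i, hi⟩ := exists_form_le j hx hxy hy
  have h0 := hi _ (Block.isAdmissible_straightArc _)
  have h1 := hi _ (Block.isAdmissible_galleryArc _)
  set e := pt ((c.place j).lin *ᵥ (c.block j).form i) with he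
  have h2 : inner ℝ e (c.homotopy t j y - c.homotopy t j x) =
      (1 - t) * inner ℝ e (c.arc Block.straightArc j y - c.arc Block.straightArc j x) +
      t * inner ℝ e (c.arc Block.galleryArc j y - c.arc Block.galleryArc j x) := by
    rw [← real_inner_smul_right, ← real_inner_smul_right, ← inner_add_right]
    congr 1
    simp only [homotopy, AffineMap.lineMap_apply_module]
    module
  have h3 := real_inner_le_norm e (c.homotopy t j y - c.homotopy t j x)
  have h4 := norm_form_le (c := c) j i
  have h5 : (8 * (c.size j : ℝ))⁻¹ * (y - x) ≤ 3 * ‖c.homotopy t j y - c.homotopy t j x‖ := by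
    have a1 := mul_le_mul_of_nonneg_left h0 (sub_nonneg.2 ht.2)
    have a2 := mul_le_mul_of_nonneg_left h1 ht.1
    have a3 := mul_le_mul_of_nonneg_right h4 (norm_nonneg (c.homotopy t j y - c.homotopy t j x))
    linarith
  have h6 := eight_size_pos (c := c) j
  rw [inv_mul_le_iff₀ h6] at h5
  have h7 := size_le (c := c) j
  nlinarith [norm_nonneg (c.homotopy t j y - c.homotopy t j x)]

theorem margin_nonneg (b : Block) (ψ : IntVec) {x : ℝ} (hx : x ∈ Set.Icc (0 : ℝ) (2 * b.size)) :
    0 ≤ b.margin ψ x := by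
  unfold Block.margin
  split_ifs
  · exact hx.1
  · linarith [hx.2]
  · positivity

theorem polyline_dot_le {j : ℕ} {I : ℕ → IntVec} (hI : (c.block j).IsAdmissible I) {ψ : IntVec}
    (hψ : ψ ⬝ᵥ ψ = 1) {x : ℝ} (hx : x ∈ Set.Icc (0 : ℝ) (2 * c.size j)) :
    polyline (fun r => ((ψ ⬝ᵥ I r : ℤ) : ℝ)) x ≤ 8 * c.size j - (c.block j).margin ψ x := by
  have hx' : x ∈ Set.Icc ((0 : ℕ) : ℝ) ((2 * c.size j : ℕ) : ℝ) := by
    push_cast; exact hx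
  unfold Block.margin
  split_ifs with h1 h2
  · have := polyline_le_affine (a := fun r => ((ψ ⬝ᵥ I r : ℤ) : ℝ)) (b := 8 * c.size j) (c := -1)
      (fun r _ hr => by
        have := hI.enter r (Nat.lt_succ_of_le hr)
        rw [← h1] at this
        have : ((ψ ⬝ᵥ I r : ℤ) : ℝ) ≤ 8 * c.size j - r := by exact_mod_cast this
        linarith) hx'
    linarith
  · have := polyline_le_affine (a := fun r => ((ψ ⬝ᵥ I r : ℤ) : ℝ))
      (b := 8 * c.size j - 2 * c.size j) (c := 1)
      (fun r _ hr => by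
        have := hI.leave r (Nat.lt_succ_of_le hr)
        rw [← h2] at this
        have h := (Int.cast_le (R := ℝ)).2 this
        rw [Int.cast_sub, Int.cast_sub, Int.cast_mul, Int.cast_mul, Int.cast_natCast,
          Int.cast_natCast] at h
        change ((ψ ⬝ᵥ I r : ℤ) : ℝ) ≤ (8 : ℤ) * c.size j - ((2 : ℤ) * c.size j - r) at h
        rw [Int.cast_ofNat, Int.cast_ofNat] at h
        linarith) hx'
    change _ ≤ 8 * (c.size j : ℝ) - (2 * c.size j - x)
    linarith
  · have := polyline_le_affine (a := fun r => ((ψ ⬝ᵥ I r : ℤ) : ℝ))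
      (b := 8 * c.size j - 2 * c.size j) (c := 0)
      (fun r _ hr => by
        have := hI.avoid ψ (mem_unitVectors hψ) h1 h2 r (Nat.lt_succ_of_le hr)
        have : ((ψ ⬝ᵥ I r : ℤ) : ℝ) ≤ 8 * c.size j - 2 * c.size j := by exact_mod_cast this
        linarith) hx'
    change _ ≤ 8 * (c.size j : ℝ) - 2 * c.size j
    linarith

/-- The cube has half-width 1, and the margin, in the unit `1 / (8 * size)`, bounds the distance
from its face in direction `φ`. The bound holds for both arcs and is affine in the point. -/
theorem inner_homotopy_le {j : ℕ} {t x : ℝ} (ht : t ∈ Set.Icc (0 : ℝ) 1)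
    (hx : x ∈ Set.Icc (0 : ℝ) (2 * c.size j)) {φ : IntVec} (hφ : φ ⬝ᵥ φ = 1) :
    inner ℝ (pt φ) (c.homotopy t j x - pt ((2 : ℤ) • c.cube j)) ≤
      1 - (8 * (c.size j : ℝ))⁻¹ * (c.block j).margin ((c.place j).linᵀ *ᵥ φ) x := by
  set ψ := (c.place j).linᵀ *ᵥ φ with hψ
  have hψ1 : ψ ⬝ᵥ ψ = 1 := by rw [hψ, dot_transpose_mulVec (c.orthogonal j), hφ]
  have hφψ : φ = (c.place j).lin *ᵥ ψ := by
    have : (c.place j).lin * (c.place j).linᵀ = 1 := mul_eq_one_comm.mp (c.orthogonal j)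
    rw [hψ, mulVec_mulVec, this, one_mulVec]
  have h0 := polyline_dot_le (Block.isAdmissible_straightArc (c.block j)) hψ1 hx
  have h1 := polyline_dot_le (Block.isAdmissible_galleryArc (c.block j)) hψ1 hx
  have e0 := inner_arc (c := c) Block.straightArc j ψ x
  have e1 := inner_arc (c := c) Block.galleryArc j ψ x
  rw [← hφψ] at e0 e1
  have h2 : inner ℝ (pt φ) (c.homotopy t j x - pt ((2 : ℤ) • c.cube j)) =
      (1 - t) * inner ℝ (pt φ) (c.arc Block.straightArc j x - pt ((2 : ℤ) • c.cube j)) +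
      t * inner ℝ (pt φ) (c.arc Block.galleryArc j x - pt ((2 : ℤ) • c.cube j)) := by
    rw [← real_inner_smul_right, ← real_inner_smul_right, ← inner_add_right]
    congr 1
    simp only [homotopy, AffineMap.lineMap_apply_module]
    module
  have h6 := eight_size_pos (c := c) j
  have h7 : 1 - (8 * (c.size j : ℝ))⁻¹ * (c.block j).margin ψ x =
      (8 * (c.size j : ℝ))⁻¹ * (8 * c.size j - (c.block j).margin ψ x) := by
    rw [mul_sub, inv_mul_cancel₀ h6.ne']
  rw [h2, e0, e1, h7]
  have a0 := mul_le_mul_of_nonneg_left h0 (inv_pos.2 h6).le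
  have a1 := mul_le_mul_of_nonneg_left h1 (inv_pos.2 h6).le
  have b0 := mul_le_mul_of_nonneg_left a0 (sub_nonneg.2 ht.2)
  have b1 := mul_le_mul_of_nonneg_left a1 ht.1
  linarith

/-- Two points in different cubes are separated by a unit vector. -/
theorem norm_homotopy_sub_ge {i j : ℕ} {t x y : ℝ} (ht : t ∈ Set.Icc (0 : ℝ) 1)
    (hx : x ∈ Set.Icc (0 : ℝ) (2 * c.size i)) (hy : y ∈ Set.Icc (0 : ℝ) (2 * c.size j))
    {φ : IntVec} (hφ : φ ⬝ᵥ φ = 1) :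
    (8 * (c.size i : ℝ))⁻¹ * (c.block i).margin ((c.place i).linᵀ *ᵥ φ) x +
      (8 * (c.size j : ℝ))⁻¹ * (c.block j).margin (-((c.place j).linᵀ *ᵥ φ)) y +
      2 * (((φ ⬝ᵥ (c.cube j - c.cube i) : ℤ) : ℝ) - 1) ≤
    ‖c.homotopy t j y - c.homotopy t i x‖ := by
  have h1 := inner_homotopy_le ht hx hφ
  have h2 := inner_homotopy_le (φ := -φ) ht hy (by simpa using hφ)
  rw [mulVec_neg, pt_neg, inner_neg_left] at h2
  have h3 := real_inner_le_norm (pt φ) (c.homotopy t j y - c.homotopy t i x)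
  have h4 : ‖pt φ‖ = 1 := by
    have := norm_pt_sq φ
    rw [hφ] at this
    have h0 := norm_nonneg (pt φ)
    push_cast at this
    nlinarith
  rw [h4, one_mul] at h3
  have h5 : inner ℝ (pt φ) (c.homotopy t j y - c.homotopy t i x) =
      inner ℝ (pt φ) (c.homotopy t j y - pt ((2 : ℤ) • c.cube j)) -
      inner ℝ (pt φ) (c.homotopy t i x - pt ((2 : ℤ) • c.cube i)) +
      2 * ((φ ⬝ᵥ (c.cube j - c.cube i) : ℤ) : ℝ) := by
    have : (2 : ℝ) * ((φ ⬝ᵥ (c.cube j - c.cube i) : ℤ) : ℝ) =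
        inner ℝ (pt φ) (pt ((2 : ℤ) • c.cube j) - pt ((2 : ℤ) • c.cube i)) := by
      rw [← pt_sub, ← smul_sub, inner_pt, dotProduct_smul]
      simp
    rw [this, ← inner_sub_right, ← inner_add_right]
    congr 1
    abel
  linarith

/-- The relative positions of two different cubes: they share a face, or some coordinate differs by
at least 2, or they touch only along an edge or at a vertex, and then two coordinate directions
separate them. -/
theorem exists_unit_separating {d : IntVec} (hd : d ≠ 0) : d ⬝ᵥ d = 1 ∨
    (∃ φ : IntVec, φ ⬝ᵥ φ = 1 ∧ 2 ≤ φ ⬝ᵥ d) ∨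
    ∃ φ φ' : IntVec, φ ⬝ᵥ φ = 1 ∧ φ' ⬝ᵥ φ' = 1 ∧ φ ≠ φ' ∧ 1 ≤ φ ⬝ᵥ d ∧ 1 ≤ φ' ⬝ᵥ d := by
  have hu : ∀ φ ∈ unitVectors, φ ⬝ᵥ φ = 1 := by decide
  by_cases h : ∃ φ ∈ unitVectors, 2 ≤ φ ⬝ᵥ d
  · obtain ⟨φ, h1, h2⟩ := h
    exact Or.inr (Or.inl ⟨φ, hu φ h1, h2⟩)
  · push Not at h
    simp only [unitVectors, List.forall_mem_cons, dotProduct, Fin.sum_univ_three] at h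
    simp at h
    have fin : ∀ a ∈ Finset.Icc (-1 : ℤ) 1, ∀ b ∈ Finset.Icc (-1 : ℤ) 1,
        ∀ c ∈ Finset.Icc (-1 : ℤ) 1, ![a, b, c] ≠ 0 → ![a, b, c] ⬝ᵥ ![a, b, c] = 1 ∨
        ∃ φ ∈ unitVectors, ∃ φ' ∈ unitVectors, φ ≠ φ' ∧ 1 ≤ φ ⬝ᵥ ![a, b, c] ∧
          1 ≤ φ' ⬝ᵥ ![a, b, c] := by
      decide +kernel
    have hv : d = ![d 0, d 1, d 2] := by ext i; fin_cases i <;> rfl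
    rw [hv] at hd ⊢
    rcases fin (d 0) (by rw [Finset.mem_Icc]; omega) (d 1) (by rw [Finset.mem_Icc]; omega)
      (d 2) (by rw [Finset.mem_Icc]; omega) hd with h1 | ⟨φ, h1, φ', h2, h3⟩
    · exact Or.inl h1
    · exact Or.inr (Or.inr ⟨φ, φ', hu φ h1, hu φ' h2, h3⟩)

/-- A point cannot be close to two faces of its cube at once. The critical pair is the entry and the
exit face, where the margins `x` and `2 * size - x` add up exactly. -/
theorem margin_add_margin_ge (b : Block) {ψ ψ' : IntVec} (h : ψ ≠ ψ') {x : ℝ}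
    (hx : x ∈ Set.Icc (0 : ℝ) (2 * b.size)) : 2 * b.size ≤ b.margin ψ x + b.margin ψ' x := by
  unfold Block.margin
  have h0 := hx.1
  have h1 := hx.2
  split_ifs with h2 h3 h4 h5 h6 h7 h8
  · exact absurd (h2.trans h3.symm) h
  all_goals first | linarith | skip
  exact absurd (h5.trans h7.symm) h

/-- The hypotheses exclude only the neighbours behind the exit and the entry face of the first cube.
Other cubes may share a face with it, since the curve keeps a distance of 1/4 from the faces that it
does not use. -/
theorem norm_homotopy_sub_ge_of_far {i j : ℕ} {t x y : ℝ} (ht : t ∈ Set.Icc (0 : ℝ) 1)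
    (hx : x ∈ Set.Icc (0 : ℝ) (2 * c.size i)) (hy : y ∈ Set.Icc (0 : ℝ) (2 * c.size j))
    (h0 : c.cube j ≠ c.cube i) (h1 : c.cube j ≠ c.cube i + (c.place i).lin *ᵥ (c.block i).exit)
    (h2 : c.cube i ≠ c.cube j + (c.place i).lin *ᵥ tangent) :
    1 / 8 ≤ ‖c.homotopy t j y - c.homotopy t i x‖ := by
  have hpos := eight_size_pos (c := c) i
  have hquarter : (8 * (c.size i : ℝ))⁻¹ * (2 * c.size i) = 1 / 4 := by
    have := c.size_pos i
    field_simp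
    norm_num
  have hlower : ∀ φ : IntVec, φ ⬝ᵥ φ = 1 →
      (8 * (c.size i : ℝ))⁻¹ * (c.block i).margin ((c.place i).linᵀ *ᵥ φ) x +
      2 * (((φ ⬝ᵥ (c.cube j - c.cube i) : ℤ) : ℝ) - 1) ≤
        ‖c.homotopy t j y - c.homotopy t i x‖ := by
    intro φ hφ
    have h3 := norm_homotopy_sub_ge ht hx hy hφ
    have h4 := margin_nonneg (c.block j) (-((c.place j).linᵀ *ᵥ φ)) hy
    have h5 := eight_size_pos (c := c) j
    have h6 := mul_nonneg (inv_pos.2 h5).le h4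
    linarith
  rcases exists_unit_separating (sub_ne_zero.2 h0) with hu | ⟨φ, hφ, hd⟩ |
    ⟨φ, φ', hφ, hφ', hne, hd, hd'⟩
  -- The cubes share a face, which is neither the entry nor the exit face of cube `i`; so the full
  -- margin 1/4 is available.
  · have h3 := hlower _ hu
    rw [hu] at h3
    have hinv : (c.place i).lin *ᵥ ((c.place i).linᵀ *ᵥ (c.cube j - c.cube i)) =
        c.cube j - c.cube i := by
      have : (c.place i).lin * (c.place i).linᵀ = 1 := mul_eq_one_comm.mp (c.orthogonal i)
      rw [mulVec_mulVec, this, one_mulVec]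
    have h4 : (c.block i).margin ((c.place i).linᵀ *ᵥ (c.cube j - c.cube i)) x =
        2 * c.size i := by
      unfold Block.margin
      rw [if_neg, if_neg]
      · rfl
      · intro h
        rw [h] at hinv
        apply h1
        rw [hinv]
        abel
      · intro h
        rw [h, mulVec_neg] at hinv
        apply h2
        have : (c.place i).lin *ᵥ tangent = -(c.cube j - c.cube i) := by rw [← hinv, neg_neg]
        rw [this]
        abel
    rw [h4, hquarter] at h3
    push_cast at h3
    linarith
  · have h3 := hlower φ hφ
    have h4 := mul_nonneg (inv_pos.2 hpos).le
      (margin_nonneg (c.block i) ((c.place i).linᵀ *ᵥ φ) hx)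
    have h5 : (2 : ℝ) ≤ ((φ ⬝ᵥ (c.cube j - c.cube i) : ℤ) : ℝ) := by exact_mod_cast hd
    linarith
  -- For two different faces of cube `i` the margins amount to 1/4 together, so one of the two
  -- directions separates by at least 1/8.
  · have h3 := hlower φ hφ
    have h4 := hlower φ' hφ'
    have h5 : (1 : ℝ) ≤ ((φ ⬝ᵥ (c.cube j - c.cube i) : ℤ) : ℝ) := by exact_mod_cast hd
    have h6 : (1 : ℝ) ≤ ((φ' ⬝ᵥ (c.cube j - c.cube i) : ℤ) : ℝ) := by exact_mod_cast hd'
    have hψ : (c.place i).linᵀ *ᵥ φ ≠ (c.place i).linᵀ *ᵥ φ' := by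
      intro h
      have := congrArg ((c.place i).lin *ᵥ ·) h
      have h1 : (c.place i).lin * (c.place i).linᵀ = 1 := mul_eq_one_comm.mp (c.orthogonal i)
      simp only [mulVec_mulVec, h1, one_mulVec] at this
      exact hne this
    have h7 := mul_le_mul_of_nonneg_left (margin_add_margin_ge (c.block i) hψ hx)
      (inv_pos.2 hpos).le
    change (8 * (c.size i : ℝ))⁻¹ * (2 * c.size i) ≤ _ at h7
    rw [hquarter] at h7
    linarith

/-- Here the margins at the common face degenerate linearly in the parameters, so the chord controls
the parameter distance across the face. The constant 64 bounds `8 * size`. -/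
theorem norm_homotopy_sub_ge_of_next {i : ℕ} {t x y : ℝ} (ht : t ∈ Set.Icc (0 : ℝ) 1)
    (hx : x ∈ Set.Icc (0 : ℝ) (2 * c.size i)) (hy : y ∈ Set.Icc (0 : ℝ) (2 * c.size (i + 1))) :
    (2 * c.size i - x) + y ≤ 64 * ‖c.homotopy t (i + 1) y - c.homotopy t i x‖ := by
  set φ := (c.place i).lin *ᵥ (c.block i).exit with hφd
  have hφ : φ ⬝ᵥ φ = 1 := by
    rw [hφd, dot_mulVec_mulVec (c.orthogonal i), Block.exit_unit]
  have h1 := norm_homotopy_sub_ge ht hx hy hφ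
  have h2 : (c.place i).linᵀ *ᵥ φ = (c.block i).exit := by
    have : (c.place i).linᵀ * (c.place i).lin = 1 := c.orthogonal i
    rw [hφd, mulVec_mulVec, this, one_mulVec]
  have h3 : (c.place (i + 1)).linᵀ *ᵥ φ = tangent := by
    have : (c.place (i + 1)).linᵀ * (c.place (i + 1)).lin = 1 := c.orthogonal (i + 1)
    rw [hφd, ← c.lin_succ_tangent, mulVec_mulVec, this, one_mulVec]
  have h4 : c.cube (i + 1) - c.cube i = φ := by rw [c.cube_succ]; abel
  rw [h2, h3, h4, hφ] at h1
  have h5 : (c.block i).margin (c.block i).exit x = 2 * c.size i - x := by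
    unfold Block.margin
    rw [if_neg (Block.exit_ne _), if_pos rfl]
    rfl
  have h6 : (c.block (i + 1)).margin (-tangent) y = y := by
    unfold Block.margin
    rw [if_pos rfl]
  rw [h5, h6] at h1
  have key : ∀ (k : ℕ) {z : ℝ}, 0 ≤ z → z / 64 ≤ (8 * (c.size k : ℝ))⁻¹ * z := by
    intro k z hz
    have h7 := eight_size_pos (c := c) k
    have h8 := size_le (c := c) k
    rw [div_eq_inv_mul]
    gcongr
    linarith
  have h7 := key i (z := 2 * c.size i - x) (by linarith [hx.2])
  have h8 := key (i + 1) hy.1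
  push_cast at h1
  linarith

theorem norm_arc_sub_le {I : Block → ℕ → IntVec} {j : ℕ}
    (hI : (c.block j).IsAdmissible (I (c.block j))) {x y : ℝ} (hx : 0 ≤ x) (hxy : x ≤ y)
    (hy : y ≤ 2 * c.size j) : ‖c.arc I j y - c.arc I j x‖ ≤ y - x := by
  have h6 := eight_size_pos (c := c) j
  have h1 := norm_polyline_sub_le (v := c.arcVertex I j) (n := 2 * c.size j) (c := 1)
    (fun r hr => by
      rw [arcVertex, arcVertex, add_sub_add_left_eq_sub, ← smul_sub, ← pt_sub, ← mulVec_sub,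
        norm_smul, Real.norm_of_nonneg (inv_pos.2 h6).le, inv_mul_le_iff₀ h6, mul_one]
      have h2 := norm_pt_lin_sq (c := c) j (I (c.block j) (r + 1) - I (c.block j) r)
      have h3 := hI.speed r hr
      have h4 : ‖pt ((c.place j).lin *ᵥ (I (c.block j) (r + 1) - I (c.block j) r))‖ ^ 2 ≤
          (8 * (c.size j : ℝ)) ^ 2 := by
        rw [h2]
        exact_mod_cast h3
      exact (sq_le_sq₀ (norm_nonneg _) h6.le).1 h4) hx (by push_cast; exact hy) hxy
  rw [one_mul] at h1
  exact h1

theorem norm_arc_sub_centre_le {I : Block → ℕ → IntVec} {j : ℕ}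
    (hI : (c.block j).IsAdmissible (I (c.block j))) {x : ℝ}
    (hx : x ∈ Set.Icc (0 : ℝ) (2 * c.size j)) :
    ‖c.arc I j x - pt ((2 : ℤ) • c.cube j)‖ ≤ 2 := by
  have h6 := eight_size_pos (c := c) j
  have h1 := norm_polyline_le (v := fun r => c.arcVertex I j r - pt ((2 : ℤ) • c.cube j))
    (n := 2 * c.size j) (c := 2) (by have := c.size_pos j; omega)
    (fun r hr => by
      rw [arcVertex, add_sub_cancel_left,
        norm_smul, Real.norm_of_nonneg (inv_pos.2 h6).le, inv_mul_le_iff₀ h6]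
      have h2 := norm_pt_lin_sq (c := c) j (I (c.block j) r)
      have h3 := hI.bound r (Nat.lt_succ_of_le hr)
      have h4 : ‖pt ((c.place j).lin *ᵥ (I (c.block j) r))‖ ^ 2 ≤
          (8 * (c.size j : ℝ) * 2) ^ 2 := by
        rw [h2]
        have : ((I (c.block j) r ⬝ᵥ I (c.block j) r : ℤ) : ℝ) ≤ 4 * (8 * (c.size j : ℝ)) ^ 2 := by
          exact_mod_cast h3
        linarith
      exact (sq_le_sq₀ (norm_nonneg _) (by positivity)).1 h4) (x := x) (by push_cast; exact hx)
  rw [polyline_sub (c.arcVertex I j) (fun _ => pt ((2 : ℤ) • c.cube j)), polyline_const] at h1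
  exact h1

/-- The displacement of the homotopy. -/
noncomputable def displacement (c : Chain) (j : ℕ) (x : ℝ) : Space :=
  c.arc Block.galleryArc j x - c.arc Block.straightArc j x

theorem norm_displacement_sub_le {j : ℕ} {x y : ℝ} (hx : 0 ≤ x) (hxy : x ≤ y)
    (hy : y ≤ 2 * c.size j) : ‖c.displacement j y - c.displacement j x‖ ≤ 2 * (y - x) := by
  have h0 := norm_arc_sub_le (Block.isAdmissible_straightArc (c.block j)) hx hxy hy
  have h1 := norm_arc_sub_le (Block.isAdmissible_galleryArc (c.block j)) hx hxy hy
  have h2 : c.displacement j y - c.displacement j x =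
      (c.arc Block.galleryArc j y - c.arc Block.galleryArc j x) -
      (c.arc Block.straightArc j y - c.arc Block.straightArc j x) := by
    unfold displacement; abel
  rw [h2]
  linarith [norm_sub_le (c.arc Block.galleryArc j y - c.arc Block.galleryArc j x)
    (c.arc Block.straightArc j y - c.arc Block.straightArc j x)]

theorem norm_displacement_le {j : ℕ} {x : ℝ} (hx : x ∈ Set.Icc (0 : ℝ) (2 * c.size j)) :
    ‖c.displacement j x‖ ≤ 4 := by
  have h0 := norm_arc_sub_centre_le (Block.isAdmissible_straightArc (c.block j)) hx
  have h1 := norm_arc_sub_centre_le (Block.isAdmissible_galleryArc (c.block j)) hx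
  have h2 : c.displacement j x =
      (c.arc Block.galleryArc j x - pt ((2 : ℤ) • c.cube j)) -
      (c.arc Block.straightArc j x - pt ((2 : ℤ) • c.cube j)) := by
    unfold displacement; abel
  rw [h2]
  linarith [norm_sub_le (c.arc Block.galleryArc j x - pt ((2 : ℤ) • c.cube j))
    (c.arc Block.straightArc j x - pt ((2 : ℤ) • c.cube j))]

end Chain

/-! ### Closed chains of cubes -/

namespace Chain

variable {c : Chain} {M : ℕ}

/-- The chain closes up after `M` cubes, which are different from each other. -/
structure Closes (c : Chain) (M : ℕ) : Prop where
  pos : 0 < M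
  block_add : ∀ j, c.block (j + M) = c.block j
  place_add : ∀ j, c.place (j + M) = c.place j
  cube_injective : ∀ i < M, ∀ j < M, c.cube i = c.cube j → i = j
  parity_succ : ∀ j, (c.block (j + 1)).parity = (c.block j).nextParity

theorem Closes.block_mod (hc : c.Closes M) (j : ℕ) : c.block (j % M) = c.block j :=
  Function.Periodic.map_mod_nat hc.block_add j

theorem Closes.place_mod (hc : c.Closes M) (j : ℕ) : c.place (j % M) = c.place j :=
  Function.Periodic.map_mod_nat hc.place_add j

theorem Closes.block_eq (hc : c.Closes M) {i j : ℕ} (h : i % M = j % M) :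
    c.block i = c.block j := by
  rw [← hc.block_mod i, h, hc.block_mod]

theorem Closes.place_eq (hc : c.Closes M) {i j : ℕ} (h : i % M = j % M) :
    c.place i = c.place j := by
  rw [← hc.place_mod i, h, hc.place_mod]

theorem Closes.cube_eq_iff (hc : c.Closes M) {i j : ℕ} : c.cube i = c.cube j ↔ i % M = j % M := by
  constructor
  · intro h
    apply hc.cube_injective _ (Nat.mod_lt _ hc.pos) _ (Nat.mod_lt _ hc.pos)
    unfold cube at *
    rw [hc.place_mod, hc.place_mod, h]
  · intro h
    unfold cube
    rw [hc.place_eq h]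

theorem arc_congr (I : Block → ℕ → IntVec) {i j : ℕ} (hb : c.block i = c.block j)
    (hp : c.place i = c.place j) : c.arc I i = c.arc I j := by
  funext x
  unfold arc
  congr 1
  funext r
  simp only [arcVertex, cube, size, hb, hp]

theorem Closes.arc_eq (hc : c.Closes M) (I : Block → ℕ → IntVec) {i j : ℕ}
    (h : i % M = j % M) : c.arc I i = c.arc I j :=
  arc_congr I (hc.block_eq h) (hc.place_eq h)

theorem Closes.homotopy_eq (hc : c.Closes M) (t : ℝ) {i j : ℕ}
    (h : i % M = j % M) : c.homotopy t i = c.homotopy t j := by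
  funext x
  simp only [homotopy, hc.arc_eq _ h]

theorem Closes.displacement_eq (hc : c.Closes M) {i j : ℕ}
    (h : i % M = j % M) : c.displacement i = c.displacement j := by
  funext x
  simp only [displacement, hc.arc_eq _ h]

theorem Closes.size_eq (hc : c.Closes M) {i j : ℕ} (h : i % M = j % M) : c.size i = c.size j := by
  unfold size
  rw [hc.block_eq h]

/-! ### The gallery -/

/-- The rotated words of the first blocks. -/
def prefixWord (c : Chain) (J : ℕ) : List Colour :=
  (List.range J).flatMap fun j => (c.block j).rotatedWord

/-- The number of letters of the first blocks. -/
def offset (c : Chain) (J : ℕ) : ℕ := ∑ j ∈ Finset.range J, c.size j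

theorem offset_zero : c.offset 0 = 0 := rfl

theorem offset_succ (J : ℕ) : c.offset (J + 1) = c.offset J + c.size J :=
  Finset.sum_range_succ _ _

theorem prefixWord_succ (J : ℕ) :
    c.prefixWord (J + 1) = c.prefixWord J ++ (c.block J).rotatedWord := by
  simp [prefixWord, List.range_succ]

theorem length_prefixWord (J : ℕ) : (c.prefixWord J).length = c.offset J := by
  induction J with
  | zero => rfl
  | succ J ih => rw [prefixWord_succ, List.length_append, ih, Block.length_rotatedWord, offset_succ]; rfl

/-- No block is empty, so the first `i` blocks have enough letters for the first `i` steps. This is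
what makes the definition of `gallery` meaningful. -/
theorem le_offset (J : ℕ) : J ≤ c.offset J := by
  induction J with
  | zero => exact Nat.zero_le _
  | succ J ih => have := c.size_pos J; rw [offset_succ]; omega

theorem prefixWord_prefix {J J' : ℕ} (h : J ≤ J') : c.prefixWord J <+: c.prefixWord J' := by
  induction J', h using Nat.le_induction with
  | base => exact List.prefix_rfl
  | succ k _ ih => rw [prefixWord_succ]; exact ih.trans (List.prefix_append _ _)

theorem take_prefixWord {i J J' : ℕ} (h : i ≤ c.offset J) (h' : i ≤ c.offset J') :
    (c.prefixWord J).take i = (c.prefixWord J').take i := by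
  have key : ∀ {J J' : ℕ}, J ≤ J' → i ≤ c.offset J →
      (c.prefixWord J).take i = (c.prefixWord J').take i := by
    intro J J' hJ hi
    obtain ⟨t, ht⟩ := c.prefixWord_prefix hJ
    rw [← ht, List.take_append_of_le_length (by rw [length_prefixWord]; exact hi)]
  rcases le_total J J' with hJ | hJ
  · exact key hJ h
  · exact (key hJ h').symm

/-- The pyramids of the gallery, beginning with the last pyramid of the cube before the first. -/
def gallery (c : Chain) (i : ℕ) : Flag :=
  ((c.place 0).act (preFlag (c.block 0).parity)).run ((c.prefixWord i).take i)

/-- Blocks can be composed because the parity left by one is the parity in which the next is read.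
-/
theorem Closes.run_prefixWord (hc : c.Closes M) (J : ℕ) :
    ((c.place 0).act (preFlag (c.block 0).parity)).run (c.prefixWord J) =
      (c.place J).act (preFlag (c.block J).parity) := by
  induction J with
  | zero => rfl
  | succ J ih =>
    rw [prefixWord_succ, Flag.run_append, ih, ← Motion.act_run, Block.run_rotatedWord,
      ← Motion.act_mul, ← c.place_succ, hc.parity_succ]

theorem gallery_eq {i J : ℕ} (h : i ≤ c.offset J) : c.gallery i =
    ((c.place 0).act (preFlag (c.block 0).parity)).run ((c.prefixWord J).take i) := by
  rw [gallery, take_prefixWord (le_offset i) h]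

theorem Closes.gallery_offset_add (hc : c.Closes M) (j : ℕ) {r : ℕ} (hr : r ≤ c.size j) :
    c.gallery (c.offset j + r) =
      (c.place j).act ((preFlag (c.block j).parity).run ((c.block j).rotatedWord.take r)) := by
  rw [gallery_eq (J := j + 1) (by rw [offset_succ]; omega), prefixWord_succ,
    ← length_prefixWord, List.take_length_add_append, Flag.run_append, hc.run_prefixWord,
    Motion.act_run]

/-- The range includes one pyramid beyond the block: the midpoint of the edge leaving the cube
depends on the first pyramid of the next cube. -/
theorem Closes.gallery_offset_add_eq_flag (hc : c.Closes M) (j : ℕ) {r : ℕ}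
    (hr : r ≤ c.size j + 1) :
    c.gallery (c.offset j + r) = (c.place j).act ((c.block j).flag r) := by
  have hl : (c.block j).rotatedWord.length = c.size j := Block.length_rotatedWord _
  rcases Nat.lt_or_ge (c.size j) r with h | h
  · obtain rfl : r = c.size j + 1 := by omega
    rw [← add_assoc, ← offset_succ, hc.gallery_offset_add (j + 1) (c.size_pos (j + 1)),
      hc.parity_succ, c.place_succ, Motion.act_mul]
    congr 1
    have h1 : (c.block (j + 1)).rotatedWord.take 1 = [Colour.D] := rfl
    have h2 : (c.block j).rotatedWord ++ [Colour.D] = ((c.block j).rotatedWord ++ [Colour.D]).take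
        (c.size j + 1) := by
      rw [List.take_of_length_le]
      rw [List.length_append, hl]
      rfl
    rw [h1, Block.flag, ← h2, Flag.run_append, Block.run_rotatedWord, Motion.act_run]
  · rw [hc.gallery_offset_add j h, Block.flag, List.take_append_of_le_length (by rw [hl]; exact h)]

theorem exists_offset_add (i : ℕ) : ∃ j r, r < c.size j ∧ i = c.offset j + r := by
  induction i with
  | zero => exact ⟨0, 0, c.size_pos 0, rfl⟩
  | succ i ih =>
    obtain ⟨j, r, hr, rfl⟩ := ih
    rcases Nat.lt_or_ge (r + 1) (c.size j) with h | h
    · exact ⟨j, r + 1, h, rfl⟩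
    · exact ⟨j + 1, 0, c.size_pos _, by rw [offset_succ]; omega⟩

theorem Closes.offset_add (hc : c.Closes M) (j : ℕ) :
    c.offset (j + M) = c.offset j + c.offset M := by
  induction j with
  | zero => rw [offset_zero, zero_add, zero_add]
  | succ j ih =>
    rw [add_right_comm, offset_succ, ih, offset_succ, hc.size_eq (Nat.add_mod_right j M)]
    omega

theorem Closes.offset_eq (hc : c.Closes M) (j : ℕ) :
    c.offset j = c.offset (j % M) + j / M * c.offset M := by
  have h : ∀ k i, c.offset (i + k * M) = c.offset i + k * c.offset M := by
    intro k i
    induction k with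
    | zero => simp
    | succ k ih => rw [Nat.succ_mul, ← add_assoc, hc.offset_add, ih]; ring
  conv_lhs => rw [← Nat.mod_add_div' j M]
  exact h _ _

theorem Closes.gallery_add (hc : c.Closes M) (i : ℕ) :
    c.gallery (i + c.offset M) = c.gallery i := by
  obtain ⟨j, r, hr, rfl⟩ := c.exists_offset_add i
  have h : (j + M) % M = j % M := Nat.add_mod_right j M
  rw [add_right_comm, ← hc.offset_add, hc.gallery_offset_add _ (by rw [hc.size_eq h]; exact hr.le),
    hc.gallery_offset_add _ hr.le, hc.block_eq h, hc.place_eq h]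

/-- The barycentres of the pyramids of the gallery. -/
noncomputable def barycentre (c : Chain) (i : ℕ) : Space := (4 : ℝ)⁻¹ • pt (c.gallery i).centre

/-- The barycentres of the pyramids and the midpoints of the edges between them. -/
noncomputable def halfVertex (c : Chain) (i : ℕ) : Space :=
  (8 : ℝ)⁻¹ • pt ((c.gallery (i / 2)).centre + (c.gallery ((i + 1) / 2)).centre)

/-- The `j`-th arc begins at the midpoint of the edge that crosses `D` into the cube, whence the
shift by 1. This midpoint lies on the common face, because the two pyramids are mirror images in it.
-/
theorem Closes.arcVertex_galleryArc (hc : c.Closes M) (j : ℕ) {r : ℕ} (hr : r ≤ 2 * c.size j) :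
    c.arcVertex Block.galleryArc j r = c.halfVertex (2 * c.offset j + 1 + r) := by
  have h1 : (2 * c.offset j + 1 + r) / 2 = c.offset j + (r + 1) / 2 := by omega
  have h2 : (2 * c.offset j + 1 + r + 1) / 2 = c.offset j + (r + 2) / 2 := by omega
  rw [halfVertex, h1, h2, hc.gallery_offset_add_eq_flag j (by omega),
    hc.gallery_offset_add_eq_flag j (by omega), Motion.centre_act, Motion.centre_act]
  have h3 : (c.place j).lin *ᵥ ((c.block j).flag ((r + 1) / 2)).centre + (8 : ℤ) • (c.place j).cube +
      ((c.place j).lin *ᵥ ((c.block j).flag ((r + 2) / 2)).centre + (8 : ℤ) • (c.place j).cube) =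
      (c.place j).lin *ᵥ (c.block j).midpoint r + (8 : ℤ) • (2 : ℤ) • c.cube j := by
    rw [Block.midpoint, mulVec_add, cube]
    module
  have h4 : (8 * (c.size j : ℝ)) ≠ 0 := (eight_size_pos j).ne'
  have h5 : (c.size j : ℝ) ≠ 0 := by have := c.size_pos j; positivity
  rw [h3, arcVertex, Block.galleryArc, mulVec_smul, pt_smul _ (_ *ᵥ _), pt_add, pt_smul 8, smul_add,
    smul_smul, smul_smul, add_comm]
  congr 1
  · congr 1
    change _ * ((c.size j : ℤ) : ℝ) = _
    push_cast
    field_simp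
  · norm_num

theorem Closes.arc_galleryArc (hc : c.Closes M) {j : ℕ} {x : ℝ}
    (hx : x ∈ Set.Icc (0 : ℝ) (2 * c.size j)) :
    c.arc Block.galleryArc j x = polyline c.halfVertex (2 * c.offset j + 1 + x) := by
  rw [arc, polyline_congr (fun r hr => hc.arcVertex_galleryArc j hr) (by push_cast; exact hx)]
  have := polyline_shift c.halfVertex (2 * c.offset j + 1) hx.1
  rw [this]
  push_cast
  rfl

theorem lineMap_barycentre (i : ℕ) {s : ℝ} (hs : s ∈ Set.Icc (0 : ℝ) 1) :
    AffineMap.lineMap (c.barycentre i) (c.barycentre (i + 1)) s =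
      polyline c.halfVertex (2 * (i + s)) := by
  have h0 : c.halfVertex (2 * i) = c.barycentre i := by
    rw [halfVertex, barycentre, show 2 * i / 2 = i by omega, show (2 * i + 1) / 2 = i by omega,
      pt_add, ← two_smul ℝ, smul_smul]
    norm_num
  have h2 : c.halfVertex (2 * i + 1 + 1) = c.barycentre (i + 1) := by
    rw [halfVertex, barycentre, show (2 * i + 1 + 1) / 2 = i + 1 by omega,
      show (2 * i + 1 + 1 + 1) / 2 = i + 1 by omega, pt_add, ← two_smul ℝ, smul_smul]
    norm_num
  have h1 : c.halfVertex (2 * i + 1) =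
      (2 : ℝ)⁻¹ • c.barycentre i + (2 : ℝ)⁻¹ • c.barycentre (i + 1) := by
    rw [halfVertex, barycentre, barycentre, show (2 * i + 1) / 2 = i by omega,
      show (2 * i + 1 + 1) / 2 = i + 1 by omega, pt_add, smul_add, smul_smul, smul_smul]
    norm_num
  rcases le_total s (1 / 2) with h | h
  · have := polyline_natCast_add c.halfVertex (2 * i) (s := 2 * s)
      ⟨by linarith [hs.1], by linarith⟩
    rw [h0, h1] at this
    rw [mul_add]
    push_cast at this
    rw [this]
    simp only [AffineMap.lineMap_apply_module]
    module
  · have := polyline_natCast_add c.halfVertex (2 * i + 1) (s := 2 * s - 1)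
      ⟨by linarith, by linarith [hs.2]⟩
    rw [h1, h2] at this
    rw [show 2 * ((i : ℝ) + s) = ((2 * i + 1 : ℕ) : ℝ) + (2 * s - 1) by push_cast; ring, this]
    simp only [AffineMap.lineMap_apply_module]
    module

theorem exists_two_mul_offset_add {x : ℝ} (hx : 0 ≤ x) :
    ∃ j, ∃ y ∈ Set.Ico (0 : ℝ) (2 * c.size j), x = 2 * c.offset j + y := by
  obtain ⟨j, r, hr, h⟩ := c.exists_offset_add ⌊x / 2⌋₊
  have h1 := Nat.floor_le (a := x / 2) (by positivity)
  have h2 := Nat.lt_floor_add_one (x / 2)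
  rw [h] at h1 h2
  have h3 : (r : ℝ) + 1 ≤ c.size j := by exact_mod_cast hr
  push_cast at h1 h2
  refine ⟨j, x - 2 * c.offset j, ⟨?_, ?_⟩, by ring⟩
  · have : (0 : ℝ) ≤ r := Nat.cast_nonneg r
    linarith
  · linarith

/-! ### The homotopy is an isotopy -/

theorem arcVertex_straightArc_zero (j : ℕ) : c.arcVertex Block.straightArc j 0 =
    pt ((2 : ℤ) • c.cube j) - pt ((c.place j).lin *ᵥ tangent) := by
  have h4 : (8 * (c.size j : ℝ)) ≠ 0 := (eight_size_pos j).ne'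
  rw [arcVertex, Block.straightArc, if_pos (Nat.zero_le _), mulVec_smul, pt_smul _ (_ *ᵥ _),
    smul_smul]
  have h5 : (8 * (c.size j : ℝ))⁻¹ * ((8 * ((0 : ℕ) - ((c.block j).size : ℤ)) : ℤ) : ℝ) = -1 := by
    change _ * ((8 * ((0 : ℕ) - (c.size j : ℤ)) : ℤ) : ℝ) = _
    push_cast
    rw [zero_sub, mul_neg, mul_neg, inv_mul_cancel₀ h4]
  rw [h5, neg_one_smul, sub_eq_add_neg]

theorem arcVertex_straightArc_last (j : ℕ) : c.arcVertex Block.straightArc j (2 * c.size j) =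
    pt ((2 : ℤ) • c.cube j) + pt ((c.place j).lin *ᵥ (c.block j).exit) := by
  have h4 : (8 * (c.size j : ℝ)) ≠ 0 := (eight_size_pos j).ne'
  have h5 := c.size_pos j
  rw [arcVertex, Block.straightArc, if_neg (by change ¬ 2 * c.size j ≤ c.size j; omega),
    mulVec_smul, pt_smul _ (_ *ᵥ _), smul_smul]
  congr 1
  rw [← one_smul ℝ (pt ((c.place j).lin *ᵥ (c.block j).exit)), smul_smul]
  congr 1
  change _ * ((8 * ((2 * c.size j : ℕ) - (c.size j : ℤ)) : ℤ) : ℝ) * 1 = _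
  push_cast
  field_simp
  ring

theorem arc_straightArc_last (j : ℕ) :
    c.arc Block.straightArc j (2 * c.size j) = c.arc Block.straightArc (j + 1) 0 := by
  have h1 := polyline_natCast (c.arcVertex Block.straightArc j) (2 * c.size j)
  have h2 := polyline_natCast (c.arcVertex Block.straightArc (j + 1)) 0
  push_cast at h1 h2
  rw [arc, arc, h1, h2, arcVertex_straightArc_last, arcVertex_straightArc_zero, c.lin_succ_tangent,
    c.cube_succ, smul_add, pt_add, pt_smul 2 ((c.place j).lin *ᵥ _)]
  push_cast
  module

theorem Closes.arc_galleryArc_last (hc : c.Closes M) (j : ℕ) :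
    c.arc Block.galleryArc j (2 * c.size j) = c.arc Block.galleryArc (j + 1) 0 := by
  rw [hc.arc_galleryArc ⟨by positivity, le_rfl⟩, hc.arc_galleryArc ⟨le_rfl, by positivity⟩,
    offset_succ]
  push_cast
  congr 1
  ring

theorem Closes.displacement_last (hc : c.Closes M) (j : ℕ) :
    c.displacement j (2 * c.size j) = c.displacement (j + 1) 0 := by
  rw [displacement, displacement, hc.arc_galleryArc_last, arc_straightArc_last]

/-- Two cubes of the chain are equal, consecutive, or far from each other. -/
theorem Closes.trichotomy (hc : c.Closes M) (i j : ℕ) : i % M = j % M ∨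
    (i + 1) % M = j % M ∨ i % M = (j + 1) % M ∨
    (c.cube j ≠ c.cube i ∧ c.cube j ≠ c.cube i + (c.place i).lin *ᵥ (c.block i).exit ∧
      c.cube i ≠ c.cube j + (c.place i).lin *ᵥ tangent) := by
  by_cases h1 : i % M = j % M
  · exact Or.inl h1
  by_cases h2 : (i + 1) % M = j % M
  · exact Or.inr (Or.inl h2)
  by_cases h3 : i % M = (j + 1) % M
  · exact Or.inr (Or.inr (Or.inl h3))
  refine Or.inr (Or.inr (Or.inr ⟨?_, ?_, ?_⟩))
  · intro h
    exact h1 (hc.cube_eq_iff.1 h.symm)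
  · intro h
    rw [← c.cube_succ] at h
    exact h2 (hc.cube_eq_iff.1 h.symm)
  · intro h
    -- The predecessor of `i` is written `i + M - 1`, so that it exists also for `i = 0`. The cube
    -- behind the entry face of cube `i` is this predecessor.
    have hM := hc.pos
    have h4 : (i + M - 1 + 1) % M = i % M := by
      rw [show i + M - 1 + 1 = i + M by omega, Nat.add_mod_right]
    have h5 : c.cube (i + M - 1) = c.cube j := by
      have h6 := c.cube_succ (i + M - 1)
      rw [hc.cube_eq_iff.2 h4, ← c.lin_succ_tangent, hc.place_eq h4, h] at h6
      exact (add_right_cancel h6).symm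
    have h6 := hc.cube_eq_iff.1 h5
    apply h3
    rw [← h4, Nat.add_mod, h6, ← Nat.add_mod]

/-- The displacement varies with speed at most 2 and has norm at most 4. Hence the constants needed
are `2 * 192` within a cube, `2 * 64` across a common face and `8 * 8` for distant cubes; 400
exceeds all of them. -/
theorem Closes.chord_bound (hc : c.Closes M) {i j : ℕ} {t x y : ℝ} (ht : t ∈ Set.Icc (0 : ℝ) 1)
    (hx : x ∈ Set.Icc (0 : ℝ) (2 * c.size i)) (hy : y ∈ Set.Icc (0 : ℝ) (2 * c.size j)) :
    ‖c.displacement i x - c.displacement j y‖ ≤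
      400 * ‖c.homotopy t i x - c.homotopy t j y‖ := by
  have next : ∀ {i : ℕ} {x y : ℝ}, x ∈ Set.Icc (0 : ℝ) (2 * c.size i) →
      y ∈ Set.Icc (0 : ℝ) (2 * c.size (i + 1)) →
      ‖c.displacement (i + 1) y - c.displacement i x‖ ≤
      400 * ‖c.homotopy t (i + 1) y - c.homotopy t i x‖ := by
    intro i x y hx hy
    have h1 := norm_homotopy_sub_ge_of_next ht hx hy
    have h2 := norm_displacement_sub_le hx.1 hx.2 le_rfl
    have h3 := norm_displacement_sub_le le_rfl hy.1 hy.2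
    rw [hc.displacement_last] at h2
    have h4 : c.displacement (i + 1) y - c.displacement i x =
        (c.displacement (i + 1) y - c.displacement (i + 1) 0) +
        (c.displacement (i + 1) 0 - c.displacement i x) := by abel
    rw [h4]
    have h5 := norm_add_le (c.displacement (i + 1) y - c.displacement (i + 1) 0)
      (c.displacement (i + 1) 0 - c.displacement i x)
    have h6 := norm_nonneg (c.homotopy t (i + 1) y - c.homotopy t i x)
    linarith
  have same : ∀ {x y : ℝ}, 0 ≤ x → x ≤ y → y ≤ 2 * c.size i →
      ‖c.displacement i y - c.displacement i x‖ ≤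
      400 * ‖c.homotopy t i y - c.homotopy t i x‖ := by
    intro x y h0 h1 h2
    have h3 := le_norm_homotopy_sub i ht h0 h1 h2
    have h4 := norm_displacement_sub_le h0 h1 h2
    have h6 := norm_nonneg (c.homotopy t i y - c.homotopy t i x)
    linarith
  rcases hc.trichotomy i j with h | h | h | ⟨h1, h2, h3⟩
  · rw [← hc.displacement_eq h, ← hc.homotopy_eq t h]
    rw [← hc.size_eq h] at hy
    rcases le_total x y with hxy | hxy
    · rw [norm_sub_rev, norm_sub_rev (c.homotopy t i x)]
      exact same hx.1 hxy hy.2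
    · exact same hy.1 hxy hx.2
  · rw [← hc.displacement_eq h, ← hc.homotopy_eq t h, norm_sub_rev,
      norm_sub_rev (c.homotopy t i x)]
    rw [← hc.size_eq h] at hy
    exact next hx hy
  · rw [hc.displacement_eq h, hc.homotopy_eq t h]
    rw [hc.size_eq h] at hx
    exact next hy hx
  · have h4 := norm_homotopy_sub_ge_of_far ht hx hy h1 h2 h3
    rw [norm_sub_rev] at h4
    have h5 := norm_sub_le (c.displacement i x) (c.displacement j y)
    have h6 := norm_displacement_le hx
    have h7 := norm_displacement_le hy
    linarith

/-- Half-open intervals are essential: the end of a passage coincides with the beginning of the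
next. -/
theorem Closes.homotopy_injective (hc : c.Closes M) {i j : ℕ} {t x y : ℝ}
    (ht : t ∈ Set.Icc (0 : ℝ) 1) (hx : x ∈ Set.Ico (0 : ℝ) (2 * c.size i))
    (hy : y ∈ Set.Ico (0 : ℝ) (2 * c.size j)) (h : c.homotopy t i x = c.homotopy t j y) :
    i % M = j % M ∧ x = y := by
  have hx' : x ∈ Set.Icc (0 : ℝ) (2 * c.size i) := ⟨hx.1, hx.2.le⟩
  have hy' : y ∈ Set.Icc (0 : ℝ) (2 * c.size j) := ⟨hy.1, hy.2.le⟩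
  rcases hc.trichotomy i j with h1 | h1 | h1 | ⟨h1, h2, h3⟩
  · refine ⟨h1, ?_⟩
    rw [← hc.homotopy_eq t h1] at h
    rw [← hc.size_eq h1] at hy'
    rcases le_total x y with hxy | hxy
    · have := le_norm_homotopy_sub i ht hx'.1 hxy hy'.2
      rw [h, sub_self, norm_zero] at this
      linarith
    · have := le_norm_homotopy_sub i ht hy'.1 hxy hx'.2
      rw [h, sub_self, norm_zero] at this
      linarith
  · rw [← hc.homotopy_eq t h1] at h
    rw [← hc.size_eq h1] at hy'
    have := norm_homotopy_sub_ge_of_next ht hx' hy'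
    rw [h, sub_self, norm_zero] at this
    linarith [hx.2, hy.1]
  · rw [hc.homotopy_eq t h1] at h
    rw [hc.size_eq h1] at hx'
    have := norm_homotopy_sub_ge_of_next ht hy' hx'
    rw [h, sub_self, norm_zero] at this
    linarith [hx.1, hy.2]
  · have h4 := norm_homotopy_sub_ge_of_far ht hx' hy' h1 h2 h3
    rw [h, sub_self, norm_zero] at h4
    norm_num at h4

/-- The closed curve formed by the ways through the cubes. -/
def curve (c : Chain) (I : Block → ℕ → IntVec) : Set Space :=
  {z | ∃ j, ∃ x ∈ Set.Icc (0 : ℝ) (2 * c.size j), c.arc I j x = z}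

theorem Closes.ambientIsotopic_curve (hc : c.Closes M) :
    AmbientIsotopic (c.curve Block.straightArc) (c.curve Block.galleryArc) := by
  have h := ambientIsotopic_range_of_chord_bound (C := 400)
    (a := fun p : {p : ℕ × ℝ // p.2 ∈ Set.Icc (0 : ℝ) (2 * c.size p.1)} =>
      c.arc Block.straightArc p.1.1 p.1.2)
    (b := fun p => c.arc Block.galleryArc p.1.1 p.1.2)
    (fun t ht p q => hc.chord_bound ht p.2 q.2)
  have key : ∀ I : Block → ℕ → IntVec,
      Set.range (fun p : {p : ℕ × ℝ // p.2 ∈ Set.Icc (0 : ℝ) (2 * c.size p.1)} =>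
        c.arc I p.1.1 p.1.2) = c.curve I := by
    intro I
    ext z
    constructor
    · rintro ⟨⟨⟨j, x⟩, hx⟩, rfl⟩
      exact ⟨j, x, hx, rfl⟩
    · rintro ⟨j, x, hx, rfl⟩
      exact ⟨⟨⟨j, x⟩, hx⟩, rfl⟩
  rwa [key, key] at h

end Chain

/-! ### The straight arcs and the gallery arcs as closed polygons -/

theorem polygon_eq_of_periodic {n : ℕ} (hn : 0 < n) {p : ℕ → Space} (hp : ∀ i, p (i + n) = p i) :
    polygon n p = {z | ∃ i, ∃ s ∈ Set.Icc (0 : ℝ) 1, AffineMap.lineMap (p i) (p (i + 1)) s = z} := by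
  ext z
  simp only [polygon, Set.mem_iUnion, Finset.mem_range, exists_prop, segment_eq_image_lineMap,
    Set.mem_image, Set.mem_ofPred_eq]
  constructor
  · rintro ⟨i, -, h⟩
    exact ⟨i, h⟩
  · rintro ⟨i, h⟩
    refine ⟨i % n, Nat.mod_lt _ hn, ?_⟩
    have h1 : p (i % n) = p i := Function.Periodic.map_mod_nat hp i
    have h2 : p (i % n + 1) = p (i + 1) := by
      rw [← Function.Periodic.map_mod_nat hp (i % n + 1), Nat.mod_add_mod,
        Function.Periodic.map_mod_nat hp]
    rwa [h1, h2]

namespace Chain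

variable {c : Chain} {M : ℕ}

/-- The straight arcs run between face centres, so an edge of the polygon consists of the second
half of one arc and the first half of the next. -/
theorem Closes.curve_straightArc (hc : c.Closes M) :
    c.curve Block.straightArc = polygon M (fun j => pt ((2 : ℤ) • c.cube j)) := by
  rw [polygon_eq_of_periodic hc.pos (fun i => by simp only [cube, hc.place_add])]
  have first : ∀ j, ∀ x ∈ Set.Icc (0 : ℝ) (c.size j), c.arc Block.straightArc j x =
      pt ((2 : ℤ) • c.cube j) + (x / c.size j - 1) • pt ((c.place j).lin *ᵥ tangent) := by
    intro j x hx
    have h5 : (c.size j : ℝ) ≠ 0 := by have := c.size_pos j; positivity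
    rw [arc, polyline_congr (w := fun r : ℕ => pt ((2 : ℤ) • c.cube j) +
      (-1 + (c.size j : ℝ)⁻¹ * r) • pt ((c.place j).lin *ᵥ tangent)) (n := c.size j) ?_ hx]
    · rw [polyline_add (fun _ => pt ((2 : ℤ) • c.cube j)) (fun r : ℕ =>
        (-1 + (c.size j : ℝ)⁻¹ * r) • pt ((c.place j).lin *ᵥ tangent)), polyline_const]
      have h6 := map_polyline (LinearMap.toSpanSingleton ℝ Space (pt ((c.place j).lin *ᵥ tangent)))
        (fun r : ℕ => -1 + (c.size j : ℝ)⁻¹ * r) x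
      simp only [LinearMap.toSpanSingleton_apply] at h6
      rw [← h6, polyline_affine]
      congr 2
      ring
    · intro r hr
      rw [arcVertex, Block.straightArc, if_pos (by exact hr), mulVec_smul, pt_smul _ (_ *ᵥ _), smul_smul]
      congr 2
      change _ * ((8 * ((r : ℕ) - (c.size j : ℤ)) : ℤ) : ℝ) = _
      push_cast
      field_simp
      ring
  have second : ∀ j, ∀ x ∈ Set.Icc (0 : ℝ) (c.size j), c.arc Block.straightArc j (c.size j + x) =
      pt ((2 : ℤ) • c.cube j) + (x / c.size j) • pt ((c.place j).lin *ᵥ (c.block j).exit) := by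
    intro j x hx
    have h5 : (c.size j : ℝ) ≠ 0 := by have := c.size_pos j; positivity
    rw [arc, ← polyline_shift _ _ hx.1, polyline_congr (w := fun r : ℕ => pt ((2 : ℤ) • c.cube j) +
      (0 + (c.size j : ℝ)⁻¹ * r) • pt ((c.place j).lin *ᵥ (c.block j).exit)) (n := c.size j) ?_ hx]
    · rw [polyline_add (fun _ => pt ((2 : ℤ) • c.cube j)) (fun r : ℕ =>
        (0 + (c.size j : ℝ)⁻¹ * r) • pt ((c.place j).lin *ᵥ (c.block j).exit)), polyline_const]
      have h6 := map_polyline (LinearMap.toSpanSingleton ℝ Space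
        (pt ((c.place j).lin *ᵥ (c.block j).exit)))
        (fun r : ℕ => 0 + (c.size j : ℝ)⁻¹ * r) x
      simp only [LinearMap.toSpanSingleton_apply] at h6
      rw [← h6, polyline_affine]
      congr 2
      ring
    · intro r hr
      rw [arcVertex, Block.straightArc]
      rcases Nat.eq_zero_or_pos r with rfl | hr0
      · rw [if_pos (by exact le_rfl)]
        have : 8 * (((c.size j + 0 : ℕ) : ℤ) - ((c.block j).size : ℤ)) = 0 := by
          change 8 * (((c.size j + 0 : ℕ) : ℤ) - (c.size j : ℤ)) = 0
          push_cast; ring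
        rw [this]
        simp [pt_zero]
      rw [if_neg (by change ¬ c.size j + r ≤ c.size j; omega), mulVec_smul, pt_smul _ (_ *ᵥ _), smul_smul]
      congr 2
      change _ * ((8 * ((c.size j + r : ℕ) - (c.size j : ℤ)) : ℤ) : ℝ) = _
      push_cast
      field_simp
      ring
  ext z
  constructor
  · rintro ⟨j, x, hx, rfl⟩
    have h5 : (0 : ℝ) < c.size j := by have := c.size_pos j; positivity
    rcases le_total x (c.size j) with h | h
    -- The first half of the arc lies on the edge coming from the preceding cube, whose index is
    -- again raised by `M`.
    · have hM := hc.pos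
      have h4 : (j + M - 1 + 1) % M = j % M := by
        rw [show j + M - 1 + 1 = j + M by omega, Nat.add_mod_right]
      have h6 := c.cube_succ (j + M - 1)
      have h7 := hc.cube_eq_iff.2 h4
      rw [h7, ← c.lin_succ_tangent, hc.place_eq h4] at h6
      refine ⟨j + M - 1, 2⁻¹ * (1 + x / c.size j), ⟨?_, ?_⟩, ?_⟩
      · have := div_nonneg hx.1 h5.le
        linarith
      · have := (div_le_one h5).2 h
        linarith
      · rw [first j x ⟨hx.1, h⟩, h7, h6, smul_add, pt_add, pt_smul 2 (_ *ᵥ _),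
          AffineMap.lineMap_apply_module]
        push_cast
        module
    · obtain ⟨y, rfl⟩ : ∃ y, x = c.size j + y := ⟨x - c.size j, by ring⟩
      have hy : y ∈ Set.Icc (0 : ℝ) (c.size j) := ⟨by linarith, by linarith [hx.2]⟩
      refine ⟨j, 2⁻¹ * (y / c.size j), ⟨?_, ?_⟩, ?_⟩
      · have := div_nonneg hy.1 h5.le
        linarith
      · have := (div_le_one h5).2 hy.2
        linarith
      · rw [second j y hy, c.cube_succ, smul_add, pt_add, pt_smul 2 (_ *ᵥ _),
          AffineMap.lineMap_apply_module]
        push_cast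
        module
  · rintro ⟨j, s, hs, rfl⟩
    have h5 : ∀ j, (0 : ℝ) < c.size j := fun j => by have := c.size_pos j; positivity
    rcases le_total s (1 / 2) with h | h
    · have hy : 2 * s * c.size j ∈ Set.Icc (0 : ℝ) (c.size j) :=
        ⟨by have := h5 j; have := hs.1; positivity, by have := h5 j; nlinarith⟩
      refine ⟨j, c.size j + 2 * s * c.size j, ⟨?_, ?_⟩, ?_⟩
      · have := h5 j; linarith [hy.1]
      · linarith [hy.2]
      · rw [second j _ hy, c.cube_succ, smul_add, pt_add, pt_smul 2 (_ *ᵥ _),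
          AffineMap.lineMap_apply_module, mul_div_assoc, div_self (h5 j).ne']
        push_cast
        module
    · have hy : (2 * s - 1) * c.size (j + 1) ∈ Set.Icc (0 : ℝ) (c.size (j + 1)) :=
        ⟨mul_nonneg (by linarith) (h5 _).le, by have := h5 (j + 1); nlinarith [hs.2]⟩
      refine ⟨j + 1, (2 * s - 1) * c.size (j + 1), ⟨hy.1, by linarith [hy.2, h5 (j + 1)]⟩, ?_⟩
      rw [first (j + 1) _ hy, c.lin_succ_tangent, c.cube_succ, smul_add, pt_add,
        pt_smul 2 (_ *ᵥ _), AffineMap.lineMap_apply_module, mul_div_assoc, div_self (h5 _).ne']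
      push_cast
      module

theorem Closes.offset_pos (hc : c.Closes M) : 0 < c.offset M :=
  hc.pos.trans_le (le_offset M)

theorem Closes.barycentre_add (hc : c.Closes M) (i : ℕ) :
    c.barycentre (i + c.offset M) = c.barycentre i := by
  rw [barycentre, hc.gallery_add, barycentre]

theorem Closes.curve_galleryArc (hc : c.Closes M) :
    c.curve Block.galleryArc = polygon (c.offset M) (fun i => c.barycentre (i + 2)) := by
  rw [polygon_eq_of_periodic hc.offset_pos
    (fun i => by simp only [add_right_comm i, hc.barycentre_add])]
  ext z
  constructor
  · rintro ⟨j, x, hx, rfl⟩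
    -- Going round twice more makes the index of the pyramid at least 2, as the shift by two in the
    -- polygon requires.
    have hM : (j + 2 * M) % M = j % M := Nat.add_mul_mod_self_right j 2 M
    rw [← hc.arc_eq _ hM, hc.arc_galleryArc (by rw [hc.size_eq hM]; exact hx)]
    have h1 : 2 ≤ c.offset (j + 2 * M) := by
      have := c.le_offset (j + 2 * M)
      have := hc.pos
      omega
    have h1' : (2 : ℝ) ≤ c.offset (j + 2 * M) := by exact_mod_cast h1
    set X : ℝ := 2 * c.offset (j + 2 * M) + 1 + x with hX
    have hX4 : 2 ≤ X / 2 := by linarith [hx.1]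
    have h2 : 2 ≤ ⌊X / 2⌋₊ := Nat.le_floor (by push_cast; exact hX4)
    obtain ⟨i, hi⟩ := Nat.exists_eq_add_of_le' h2
    have h3 := Nat.floor_le (a := X / 2) (by linarith)
    have h4 := Nat.lt_floor_add_one (X / 2)
    have hs : X / 2 - ⌊X / 2⌋₊ ∈ Set.Icc (0 : ℝ) 1 := ⟨by linarith, by linarith⟩
    refine ⟨i, X / 2 - ⌊X / 2⌋₊, hs, ?_⟩
    rw [add_right_comm, lineMap_barycentre _ hs, ← hi]
    congr 1
    ring
  · rintro ⟨i, s, hs, rfl⟩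
    rw [add_right_comm, lineMap_barycentre _ hs]
    have h0 : (0 : ℝ) ≤ 2 * (((i + 2 : ℕ) : ℝ) + s) - 1 := by
      have : (0 : ℝ) ≤ i := Nat.cast_nonneg i
      push_cast
      linarith [hs.1]
    obtain ⟨j, y, hy, h⟩ := c.exists_two_mul_offset_add h0
    refine ⟨j, y, ⟨hy.1, hy.2.le⟩, ?_⟩
    rw [hc.arc_galleryArc ⟨hy.1, hy.2.le⟩]
    congr 1
    linarith

theorem Closes.isSimpleClosedPolygon (hc : c.Closes M) :
    IsSimpleClosedPolygon (c.offset M) (fun i => c.barycentre (i + 2)) := by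
  refine ⟨hc.offset_pos, ?_, ?_⟩
  · simp only [add_comm (c.offset M), hc.barycentre_add, zero_add]
  · intro i hi j hj s hs t ht h
    simp only at h
    rw [add_right_comm, add_right_comm j, lineMap_barycentre _ ⟨hs.1, hs.2.le⟩,
      lineMap_barycentre _ ⟨ht.1, ht.2.le⟩] at h
    have nonneg : ∀ (i : ℕ) {s : ℝ}, 0 ≤ s → (0 : ℝ) ≤ 2 * (((i + 2 : ℕ) : ℝ) + s) - 1 := by
      intro i s hs
      have : (0 : ℝ) ≤ i := Nat.cast_nonneg i
      push_cast
      linarith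
    obtain ⟨a, x, hx, hax⟩ := c.exists_two_mul_offset_add (nonneg i hs.1)
    obtain ⟨b, y, hy, hby⟩ := c.exists_two_mul_offset_add (nonneg j ht.1)
    have e1 : 2 * (((i + 2 : ℕ) : ℝ) + s) = 2 * c.offset a + 1 + x := by linarith
    have e2 : 2 * (((j + 2 : ℕ) : ℝ) + t) = 2 * c.offset b + 1 + y := by linarith
    rw [e1, e2, ← hc.arc_galleryArc ⟨hx.1, hx.2.le⟩, ← hc.arc_galleryArc ⟨hy.1, hy.2.le⟩] at h
    obtain ⟨hab, rfl⟩ := hc.homotopy_injective (t := 1) ⟨zero_le_one, le_rfl⟩ hx hy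
      (by simpa [homotopy] using h)
    have oa := hc.offset_eq a
    have ob := hc.offset_eq b
    rw [hab] at oa
    have hi' : (i : ℝ) + 1 ≤ c.offset M := by exact_mod_cast hi
    have hj' : (j : ℝ) + 1 ≤ c.offset M := by exact_mod_cast hj
    have hi0 : (0 : ℝ) ≤ i := Nat.cast_nonneg i
    have hj0 : (0 : ℝ) ≤ j := Nat.cast_nonneg j
    have hs0 := hs.1
    have hs1 := hs.2
    have ht0 := ht.1
    have ht1 := ht.2
    have oa' : (c.offset a : ℝ) = c.offset (b % M) + (a / M : ℕ) * c.offset M := by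
      exact_mod_cast oa
    have ob' : (c.offset b : ℝ) = c.offset (b % M) + (b / M : ℕ) * c.offset M := by
      exact_mod_cast ob
    have hn : (0 : ℝ) < c.offset M := by exact_mod_cast hc.offset_pos
    push_cast at e1 e2
    -- Injectivity determines the blocks only modulo `M`. Both parameters lie in one window of a
    -- full period, which begins at pyramid 2, so their numbers of turns agree.
    have hdiv : a / M = b / M := by
      rcases lt_trichotomy (a / M) (b / M) with hlt | heq | hgt
      · have : ((a / M : ℕ) : ℝ) + 1 ≤ (b / M : ℕ) := by exact_mod_cast hlt
        nlinarith
      · exact heq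
      · have : ((b / M : ℕ) : ℝ) + 1 ≤ (a / M : ℕ) := by exact_mod_cast hgt
        nlinarith
    have hoff : (c.offset a : ℝ) = c.offset b := by rw [oa', ob', hdiv]
    have hist : (i : ℝ) + s = j + t := by linarith
    have hij : i = j := by
      rcases lt_trichotomy i j with hlt | heq | hgt
      · have : (i : ℝ) + 1 ≤ j := by exact_mod_cast hlt
        linarith
      · exact heq
      · have : (j : ℝ) + 1 ≤ i := by exact_mod_cast hgt
        linarith
    refine ⟨hij, ?_⟩
    rw [hij] at hist
    linarith

end Chain

/-! ### Flags and pyramids -/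

namespace Flag

/-- The directions of a flag are orthonormal and its cube belongs to the tessellation. -/
structure IsProper (φ : Flag) : Prop where
  uu : φ.u ⬝ᵥ φ.u = 1
  gg : φ.g ⬝ᵥ φ.g = 1
  hh : φ.h ⬝ᵥ φ.h = 1
  ug : φ.u ⬝ᵥ φ.g = 0
  uh : φ.u ⬝ᵥ φ.h = 0
  gh : φ.g ⬝ᵥ φ.h = 0
  even : ∃ c, φ.o = cubeCentre c

theorem IsProper.step {φ : Flag} (h : φ.IsProper) (X : Colour) : (φ.step X).IsProper := by
  obtain ⟨c, hc⟩ := h.even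
  have hug := h.ug
  have huh := h.uh
  have hgh := h.gh
  have hgu := hug
  have hhg := hgh
  rw [dotProduct_comm] at hgu hhg
  cases X
  case D =>
    refine ⟨?_, h.gg, h.hh, ?_, ?_, h.gh, ⟨c + φ.u, ?_⟩⟩
    · simp [Flag.step, h.uu]
    · simp [Flag.step, h.ug]
    · simp [Flag.step, h.uh]
    · simp only [Flag.step]
      rw [hc, cubeCentre_eq, cubeCentre_eq, smul_add]
  all_goals
    constructor <;> simp only [Flag.step, dotProduct_neg, neg_dotProduct, neg_neg, h.uu, h.gg, h.hh,
      hug, huh, hgh, hgu, hhg, neg_zero]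
    exact ⟨c, hc⟩

theorem IsProper.run {φ : Flag} (h : φ.IsProper) (w : List Colour) : (φ.run w).IsProper := by
  induction w generalizing φ with
  | nil => exact h
  | cons X w ih => exact ih (h.step X)

theorem IsProper.act {φ : Flag} (h : φ.IsProper) {X : Motion} (hX : X.IsOrthogonal) :
    (X.act φ).IsProper := by
  obtain ⟨c, hc⟩ := h.even
  constructor <;> simp only [Motion.act, dot_mulVec_mulVec hX, h.uu, h.gg, h.hh, h.ug, h.uh, h.gh]
  refine ⟨X.lin *ᵥ c + X.cube, ?_⟩
  rw [hc, cubeCentre_eq, cubeCentre_eq, mulVec_smul, smul_add]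

theorem isProper_startFlag (p : Parity) : (startFlag p).IsProper := by
  cases p <;> exact ⟨by decide, by decide, by decide, by decide, by decide, by decide, ⟨0, by decide⟩⟩

/-- The matrix with the directions of the flag as columns. -/
def matrix (φ : Flag) : IntMat := (Matrix.of ![φ.u, φ.g, φ.h])ᵀ

theorem IsProper.matrix_orthogonal {φ : Flag} (h : φ.IsProper) : φ.matrixᵀ * φ.matrix = 1 := by
  have hgu := h.ug
  have hhu := h.uh
  have hhg := h.gh
  rw [dotProduct_comm] at hgu hhu hhg
  have key : ∀ i j, (φ.matrixᵀ * φ.matrix) i j = ![φ.u, φ.g, φ.h] i ⬝ᵥ ![φ.u, φ.g, φ.h] j :=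
    fun i j => rfl
  ext i j
  rw [key]
  fin_cases i <;> fin_cases j
  · exact h.uu
  · exact h.ug
  · exact h.uh
  · exact hgu
  · exact h.gg
  · exact h.gh
  · exact hhu
  · exact hhg
  · exact h.hh

theorem IsProper.sq_add_sq_add_sq {φ : Flag} (h : φ.IsProper) (i : Fin 3) :
    φ.u i ^ 2 + φ.g i ^ 2 + φ.h i ^ 2 = 1 := by
  have h1 : φ.matrix * φ.matrixᵀ = 1 := mul_eq_one_comm.mp h.matrix_orthogonal
  have h2 := congrFun (congrFun h1 i) i
  rw [Matrix.mul_apply, Fin.sum_univ_three, one_apply_eq] at h2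
  rw [← h2]
  simp only [sq]
  rfl

theorem IsProper.sum_eq {φ : Flag} (h : φ.IsProper) (i : Fin 3) :
    (φ.u + φ.g + φ.h) i = 1 ∨ (φ.u + φ.g + φ.h) i = -1 := by
  have h1 : (![φ.u i, φ.g i, φ.h i] : IntVec) ⬝ᵥ ![φ.u i, φ.g i, φ.h i] = 1 := by
    rw [dot_self]
    exact h.sq_add_sq_add_sq i
  exact coordSum_unit h1

theorem IsProper.reverse {φ : Flag} (h : φ.IsProper) : IsProper ⟨φ.o, φ.u, φ.g, -φ.h⟩ := by
  refine ⟨h.uu, h.gg, ?_, h.ug, ?_, ?_, h.even⟩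
  · simp [h.hh]
  · simp [h.uh]
  · simp [h.gh]

theorem IsProper.coordSum_h {φ : Flag} (h : φ.IsProper) : coordSum φ.h % 2 = 1 := by
  rcases coordSum_unit h.hh with h | h <;> rw [h] <;> rfl

/-- Only crossing the face opposite to `A` moves this vertex, namely by `-2 • (g + h)`; the
coordinate sums of `g` and `h` are odd, so the sum changes by a multiple of 4. -/
theorem IsProper.coordSum_step_A {φ : Flag} (h : φ.IsProper) (X : Colour) :
    coordSum ((φ.step X).vertex .A) % 4 = coordSum (φ.vertex .A) % 4 := by
  have h1 := coordSum_unit h.gg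
  have h2 := coordSum_unit h.hh
  have hneg : ∀ v : IntVec, coordSum (-v) = -coordSum v := by
    intro v; simp only [coordSum, Pi.neg_apply]; ring
  cases X <;> simp only [vertex, Flag.step, coordSum_add, coordSum_smul, hneg] <;> omega

theorem IsProper.coordSum_run_A {φ : Flag} (h : φ.IsProper) (w : List Colour) :
    coordSum ((φ.run w).vertex .A) % 4 = coordSum (φ.vertex .A) % 4 := by
  induction w generalizing φ with
  | nil => rfl
  | cons X w ih => rw [run_cons, ih (h.step X), h.coordSum_step_A]

/-- The colours of the vertices are those of the tessellation. -/
structure IsColoured (φ : Flag) : Prop extends φ.IsProper where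
  coordSum_A : coordSum (φ.vertex .A) % 4 = 3

theorem IsColoured.run {φ : Flag} (h : φ.IsColoured) (w : List Colour) : (φ.run w).IsColoured :=
  ⟨h.toIsProper.run w, by rw [h.toIsProper.coordSum_run_A, h.coordSum_A]⟩

theorem IsColoured.isPyramid {φ : Flag} (h : φ.IsColoured) : ∃ c, IsPyramidOf c φ.vertex := by
  obtain ⟨c, hc⟩ := h.even
  have hug := h.ug
  have huh := h.uh
  rw [dotProduct_comm] at hug huh
  refine ⟨c, φ.u, φ.u + φ.g + φ.h, φ.u + φ.g - φ.h, h.uu, h.sum_eq, ?_, ?_, ?_, ?_, hc, ?_, ?_, ?_,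
    h.coordSum_A, ?_⟩
  · intro i
    have := h.toIsProper.reverse.sum_eq i
    simpa [sub_eq_add_neg] using this
  · simp [add_dotProduct, h.uu, hug, huh]
  · simp [add_dotProduct, sub_dotProduct, h.uu, hug, huh]
  · have : φ.u + φ.g + φ.h - (φ.u + φ.g - φ.h) = (2 : ℤ) • φ.h := by module
    rw [this, smul_dotProduct, dotProduct_smul, h.hh]
    rfl
  · rw [← hc]; rfl
  · rw [← hc]; rfl
  · rw [← hc]; rfl
  · have h1 := h.coordSum_A
    have h2 := h.toIsProper.coordSum_h
    simp only [vertex, coordSum_add, coordSum_sub] at h1 ⊢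
    omega

/-- The pyramid of a flag. -/
def toPyramid (φ : Flag) (h : φ.IsColoured) : Pyramid := ⟨φ.vertex, h.isPyramid⟩

theorem vertex_step_of_ne (φ : Flag) {X Y : Colour} (h : Y ≠ X) :
    (φ.step X).vertex Y = φ.vertex Y := by
  cases X <;> cases Y <;> first | exact absurd rfl h | skip
  all_goals
    simp only [step, vertex]
    try module

theorem IsProper.vertex_step_ne {φ : Flag} (h : φ.IsProper) (X : Colour) :
    (φ.step X).vertex X ≠ φ.vertex X := by
  have hgu := h.ug
  have hhg := h.gh
  rw [dotProduct_comm] at hgu hhg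
  intro heq
  cases X <;> simp only [Flag.step, vertex] at heq
  · have h1 := congrArg (fun v => φ.g ⬝ᵥ v) heq
    simp [dotProduct_add, h.gg, h.gh, hgu] at h1
  · have h1 := congrArg (fun v => φ.g ⬝ᵥ v) heq
    simp [dotProduct_add, dotProduct_sub, h.gg, h.gh, hgu] at h1
  · have h1 := congrArg (fun v => φ.g ⬝ᵥ v) heq
    simp [dotProduct_add, h.gg, hgu] at h1
  · have h1 := congrArg (fun v => φ.u ⬝ᵥ v) heq
    rw [dotProduct_add, dotProduct_smul, h.uu] at h1
    simp at h1

theorem crosses_step {φ : Flag} (h : φ.IsColoured) {X : Colour} (h' : (φ.step X).IsColoured) :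
    Crosses X (φ.toPyramid h) ((φ.step X).toPyramid h') := by
  refine ⟨fun heq => ?_, fun Y hY => φ.vertex_step_of_ne hY⟩
  exact h.toIsProper.vertex_step_ne X (congrFun (congrArg Pyramid.vertex heq) X)

theorem centre_toPyramid {φ : Flag} (h : φ.IsColoured) :
    (φ.toPyramid h).centre = (4 : ℝ)⁻¹ • pt φ.centre := by
  rw [Pyramid.centre, ← pt_add, ← pt_add, ← pt_add]
  congr 2
  simp only [toPyramid, vertex, centre]
  module

/-! ### The reflections in the faces -/

/-- The vertex behind a face is reflected in an affine combination of the other vertices. -/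
noncomputable def mirror (v : Colour → Space) : Colour → Space
  | .C => midpoint ℝ (midpoint ℝ (v .A) (v .B)) (v .D)
  | _ => v .C

theorem pt_vertex_step (φ : Flag) (X : Colour) : pt ((φ.step X).vertex X) =
    AffineMap.lineMap (pt (φ.vertex X)) (mirror (fun Y => pt (φ.vertex Y)) X) (2 : ℝ) := by
  cases X <;> simp only [step, vertex, mirror, pt_add, pt_sub, pt_neg, pt_smul,
    AffineMap.lineMap_apply_module, midpoint_eq_smul_add] <;> push_cast
  all_goals
    try simp only [invOf_eq_inv]
    module

/-- The new vertex is a fixed affine combination of the old ones, the same for all flags; so it is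
respected by every affine map. -/
theorem map_vertex_step {φ ψ : Flag} (f : Space →ᵃ[ℝ] Space)
    (h : ∀ Y, f (pt (φ.vertex Y)) = pt (ψ.vertex Y)) (X Y : Colour) :
    f (pt ((φ.step X).vertex Y)) = pt ((ψ.step X).vertex Y) := by
  by_cases hY : Y = X
  · subst hY
    rw [pt_vertex_step, pt_vertex_step, AffineMap.apply_lineMap, h]
    congr 1
    cases Y <;> simp only [mirror, AffineMap.map_midpoint, h]
  · rw [vertex_step_of_ne _ hY, vertex_step_of_ne _ hY, h]

theorem map_vertex_run {φ ψ : Flag} (f : Space →ᵃ[ℝ] Space)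
    (h : ∀ Y, f (pt (φ.vertex Y)) = pt (ψ.vertex Y)) (w : List Colour) (Y : Colour) :
    f (pt ((φ.run w).vertex Y)) = pt ((ψ.run w).vertex Y) := by
  induction w generalizing φ ψ with
  | nil => exact h Y
  | cons X w ih => exact ih (map_vertex_step f h X)

/-- A normal vector of the face opposite to a vertex. -/
def normal (φ : Flag) : Colour → IntVec
  | .A => φ.g + φ.h
  | .B => φ.g - φ.h
  | .C => φ.u - φ.g
  | .D => φ.u

theorem IsProper.normal_dot {φ : Flag} (h : φ.IsProper) {X Y Z : Colour} (hY : Y ≠ X)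
    (hZ : Z ≠ X) : φ.normal X ⬝ᵥ (φ.vertex Y - φ.vertex Z) = 0 := by
  have hug := h.ug
  have huh := h.uh
  have hgh := h.gh
  have hgu := hug
  have hhu := huh
  have hhg := hgh
  rw [dotProduct_comm] at hgu hhu hhg
  cases X <;> cases Y <;> first | exact absurd rfl hY | skip
  all_goals cases Z <;> first | exact absurd rfl hZ | skip
  all_goals
    simp [normal, vertex, dotProduct_add, dotProduct_sub, add_dotProduct, sub_dotProduct, h.uu,
      h.gg, h.hh, hug, huh, hgh, hgu, hhu, hhg]

theorem exists_smul_normal (φ : Flag) (X : Colour) : ∃ r : ℝ,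
    pt (φ.vertex X) = r • pt (φ.normal X) + mirror (fun Y => pt (φ.vertex Y)) X := by
  cases X
  · exact ⟨1, by simp only [vertex, normal, mirror, pt_add]; module⟩
  · exact ⟨1, by simp only [vertex, normal, mirror, pt_add, pt_sub]; module⟩
  · refine ⟨1 / 2, ?_⟩
    simp only [vertex, normal, mirror, pt_add, pt_sub, midpoint_eq_smul_add, invOf_eq_inv]
    module
  · exact ⟨-1, by simp only [vertex, normal, mirror, pt_add]; module⟩

theorem wallReflection_vertex {φ : Flag} (h : φ.IsProper) {P : Pyramid} (hP : P.vertex = φ.vertex)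
    (X Y : Colour) :
    wallReflection P X (pt (φ.vertex Y)) = pt ((φ.step X).vertex Y) := by
  obtain ⟨v, hv⟩ := P
  obtain rfl : v = φ.vertex := hP
  unfold wallReflection
  dsimp only
  set s := affineSpan ℝ (Set.range (fun Y : {Y : Colour // Y ≠ X} => pt (φ.vertex Y))) with hs
  have mem : ∀ Y, Y ≠ X → pt (φ.vertex Y) ∈ s := fun Y hY =>
    subset_affineSpan ℝ _ ⟨⟨Y, hY⟩, rfl⟩
  by_cases hY : Y = X
  · subst hY
    have hm : mirror (fun Y => pt (φ.vertex Y)) Y ∈ s := by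
      cases Y <;> simp only [mirror]
      · exact mem _ (by decide)
      · exact mem _ (by decide)
      · exact AffineMap.lineMap_mem _ (AffineMap.lineMap_mem _ (mem _ (by decide))
          (mem _ (by decide))) (mem _ (by decide))
      · exact mem _ (by decide)
    have hn : pt (φ.normal Y) ∈ s.directionᗮ := by
      rw [hs, direction_affineSpan, vectorSpan_def, Submodule.mem_orthogonal]
      intro x hx
      induction hx using Submodule.span_induction with
      | mem x hx =>
        obtain ⟨_, ⟨⟨a, ha⟩, rfl⟩, _, ⟨⟨b, hb⟩, rfl⟩, rfl⟩ := hx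
        change inner ℝ (pt (φ.vertex a) - pt (φ.vertex b)) (pt (φ.normal Y)) = 0
        rw [← pt_sub, inner_pt, dotProduct_comm, h.normal_dot ha hb, Int.cast_zero]
      | zero => exact inner_zero_left _
      | add x y _ _ hx hy => rw [inner_add_left, hx, hy, add_zero]
      | smul r x _ hx => rw [real_inner_smul_left, hx, mul_zero]
    obtain ⟨r, hr⟩ := φ.exists_smul_normal Y
    rw [pt_vertex_step, hr]
    have := EuclideanGeometry.reflection_orthogonal_vadd hm (Submodule.smul_mem _ r hn)
    rw [vadd_eq_add] at this
    rw [this, vadd_eq_add, AffineMap.lineMap_apply_module]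
    module
  · rw [vertex_step_of_ne _ hY, EuclideanGeometry.reflection_eq_self_iff]
    exact mem Y hY

/-- The usual passage from fixed reflections to a gallery: the first reflection takes the gallery of
the remaining word from `φ` to the gallery of the same word from the adjacent pyramid. -/
theorem wordSymmetry_vertex {φ : Flag} (h : φ.IsProper) {P : Pyramid} (hP : P.vertex = φ.vertex)
    (w : List Colour) (Y : Colour) :
    wordSymmetry P w (pt (φ.vertex Y)) = pt ((φ.run w).vertex Y) := by
  induction w with
  | nil => rfl
  | cons X w ih =>
    have h1 : wordSymmetry P (X :: w) (pt (φ.vertex Y)) =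
        wallReflection P X (wordSymmetry P w (pt (φ.vertex Y))) := by
      simp [wordSymmetry]
    rw [h1, ih, run_cons]
    exact map_vertex_run (wallReflection P X).toAffineEquiv.toAffineMap
      (fun Y => wallReflection_vertex h hP X Y) w Y

theorem latticeMap_matrix (φ : Flag) (y : Space) :
    latticeMap φ.matrix y = y 0 • pt φ.u + y 1 • pt φ.g + y 2 • pt φ.h := by
  ext i
  simp [latticeMap, Matrix.toLpLin_apply, matrix, mulVec, dotProduct, Fin.sum_univ_three, pt,
    Matrix.map_apply, Matrix.transpose_apply]
  ring

/-- An isometry that fixes the vertices of a pyramid is the identity. -/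
theorem IsProper.eq_one {φ : Flag} (h : φ.IsProper) {f : Space ≃ᵃⁱ[ℝ] Space}
    (hf : ∀ Y, f (pt (φ.vertex Y)) = pt (φ.vertex Y)) : f = 1 := by
  ext1 x
  have lin : ∀ Y Z, f.linearIsometryEquiv (pt (φ.vertex Y) - pt (φ.vertex Z)) =
      pt (φ.vertex Y) - pt (φ.vertex Z) := by
    intro Y Z
    have := f.map_vsub (pt (φ.vertex Y)) (pt (φ.vertex Z))
    rw [hf, hf] at this
    exact this
  have hu : f.linearIsometryEquiv (pt φ.u) = pt φ.u := by
    have : pt φ.u = pt (φ.vertex .C) - pt (φ.vertex .D) := by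
      simp only [vertex, pt_add]; abel
    rw [this, lin]
  have hh : f.linearIsometryEquiv (pt φ.h) = pt φ.h := by
    have : pt φ.h = (2 : ℝ)⁻¹ • (pt (φ.vertex .A) - pt (φ.vertex .B)) := by
      simp only [vertex, pt_add, pt_sub]; module
    rw [this, map_smul, lin]
  have hg : f.linearIsometryEquiv (pt φ.g) = pt φ.g := by
    have : pt φ.g = (pt (φ.vertex .A) - pt (φ.vertex .C)) - pt φ.h := by
      simp only [vertex, pt_add]; abel
    rw [this, map_sub, lin, hh]
  have h1 : φ.matrix * φ.matrixᵀ = 1 := mul_eq_one_comm.mp h.matrix_orthogonal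
  have hx : x = latticeMap φ.matrix (latticeMap φ.matrixᵀ (x - pt φ.o)) + pt φ.o := by
    rw [← latticeMap_mul, h1, latticeMap_one, sub_add_cancel]
  rw [latticeMap_matrix] at hx
  set y := latticeMap φ.matrixᵀ (x - pt φ.o)
  have h2 := f.map_vadd (pt φ.o) (y 0 • pt φ.u + y 1 • pt φ.g + y 2 • pt φ.h)
  rw [vadd_eq_add, vadd_eq_add, ← hx, map_add, map_add, map_smul, map_smul, map_smul, hu, hg, hh,
    show f (pt φ.o) = pt φ.o from hf .D, ← hx] at h2
  exact h2

end Flag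

/-! ### Moving frames as motions -/

/-- The motion that takes the standard frame at the origin to a given frame. -/
def frameMotion (x : IntVec × Frame) : Motion := ⟨(Matrix.of ![x.2.T, x.2.N, x.2.B])ᵀ, x.1⟩

/-- A direct isometry. -/
structure Motion.IsDirect (X : Motion) : Prop where
  orthogonal : X.IsOrthogonal
  det_eq_one : X.lin.det = 1

theorem Motion.IsDirect.mul {X Y : Motion} (hX : X.IsDirect) (hY : Y.IsDirect) :
    (X * Y).IsDirect :=
  ⟨hX.1.mul hY.1, by rw [Motion.mul_lin, det_mul, hX.2, hY.2, one_mul]⟩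

theorem Motion.IsDirect.inverse {X : Motion} (hX : X.IsDirect) : X.inverse.IsDirect :=
  ⟨hX.1.inverse, by rw [Motion.inverse, det_transpose, hX.2]⟩

theorem Block.isDirect_motion (b : Block) : b.motion.IsDirect := by
  refine ⟨b.turn_orthogonal, ?_⟩
  change b.turn.det = 1
  rw [det_fin_three]
  rcases b with ⟨m, p⟩ | s
  · cases m <;> cases p <;> decide +kernel
  · cases s <;> decide +kernel

theorem isDirect_frameMotion (q : IntVec) {F : Frame} (h : F.IsOrthonormal) :
    (frameMotion (q, F)).IsDirect := by
  obtain ⟨h1, h2, h3⟩ := h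
  have b1 : F.T ⬝ᵥ F.B = 0 := dot_self_cross _ _
  have b2 : F.N ⬝ᵥ F.B = 0 := dot_cross_self _ _
  have b3 : F.B ⬝ᵥ F.B = 1 := by
    rw [Frame.B, cross_dot_cross, h1, h2, h3]
    ring
  have b4 := h3
  have b5 := b1
  have b6 := b2
  rw [dotProduct_comm] at b4 b5 b6
  have key : ∀ i j, ((frameMotion (q, F)).linᵀ * (frameMotion (q, F)).lin) i j =
    ![F.T, F.N, F.B] i ⬝ᵥ ![F.T, F.N, F.B] j := fun i j => rfl
  refine ⟨?_, ?_⟩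
  · ext i j
    rw [key]
    fin_cases i <;> fin_cases j
    · exact h1
    · exact h3
    · exact b1
    · exact b4
    · exact h2
    · exact b2
    · exact b5
    · exact b6
    · exact b3
  · change ((Matrix.of ![F.T, F.N, F.B])ᵀ).det = 1
    rw [det_transpose]
    have := triple_product_eq_det F.T F.N F.B
    change F.T ⬝ᵥ _ = Matrix.det ![F.T, F.N, F.B] at this
    change Matrix.det ![F.T, F.N, F.B] = 1
    rw [← this, triple_product_permutation, triple_product_permutation]
    exact b3

theorem cross_cross_self {T N : IntVec} (h2 : N ⬝ᵥ N = 1) (h3 : T ⬝ᵥ N = 0) :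
    crossProduct (crossProduct T N) N = -T := by
  simp only [dotProduct, Fin.sum_univ_three] at h2 h3
  ext i
  fin_cases i <;> simp [cross_apply]
  · linear_combination (-T 0) * h2 + N 0 * h3
  · linear_combination (-T 1) * h2 + N 1 * h3
  · linear_combination (-T 2) * h2 + N 2 * h3

theorem isOrthonormal_turn {F : Frame} (h : F.IsOrthonormal) (m : Move) :
    (F.turn m).IsOrthonormal := by
  have hX := (isDirect_frameMotion 0 h).orthogonal
  obtain ⟨h1, h2, h3⟩ := h
  have b2 : F.N ⬝ᵥ F.B = 0 := dot_cross_self _ _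
  have b3 : F.B ⬝ᵥ F.B = 1 := by
    rw [Frame.B, cross_dot_cross, h1, h2, h3]
    ring
  rw [dotProduct_comm] at b2
  have b4 := h3
  rw [dotProduct_comm] at b4
  cases m <;> simp [Frame.IsOrthonormal, Frame.turn, h1, h2, h3, b2, b3, b4]

/-- A move is described in the moving frame, so it multiplies from the right by a motion independent
of the frame. The parity affects only the word. -/
theorem frameMotion_move {q : IntVec} {F : Frame} (h : F.IsOrthonormal) (m : Move) (p : Parity) :
    frameMotion (move (q, F) m) = frameMotion (q, F) * (Block.letter m p).motion := by
  have col : ∀ v : IntVec, (frameMotion (q, F)).lin *ᵥ v = v 0 • F.T + v 1 • F.N + v 2 • F.B := by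
    intro v
    ext i
    simp [frameMotion, mulVec, dotProduct, Fin.sum_univ_three]
    ring
  have hB := cross_cross_self h.2.1 h.2.2
  have hB' : crossProduct (crossProduct F.N F.T) F.N = F.T := by
    rw [← cross_anticomm F.T F.N, map_neg, LinearMap.neg_apply, hB, neg_neg]
  have cols : ∀ j, (frameMotion (q, F) * (Block.letter m p).motion).linᵀ j =
      (frameMotion (q, F)).lin *ᵥ ((Block.letter m p).turnᵀ j) := fun j => rfl
  have hlin : (frameMotion (move (q, F) m)).linᵀ =
      (frameMotion (q, F) * (Block.letter m p).motion).linᵀ := by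
    funext j
    rw [cols, col]
    fin_cases j
    · change (F.turn m).T = _
      cases m <;> simp [Frame.turn, Block.turn]
    · change (F.turn m).N = _
      cases m <;> simp [Frame.turn, Block.turn]
    · change (F.turn m).B = _
      cases m <;> simp [Frame.turn, Block.turn, Frame.B, hB, hB']
  apply Motion.ext
  · exact transpose_injective hlin
  · change q + (F.turn m).T = (frameMotion (q, F)).lin *ᵥ (Block.letter m p).turnᵀ 0 + q
    rw [add_comm, ← cols, ← hlin]
    rfl

/-- Direct lattice isometries that agree on two orthogonal axes are equal. -/
theorem eq_of_columns {A B : IntMat} (hA : Aᵀ * A = 1) (hB : Bᵀ * B = 1) (dA : A.det = 1)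
    (dB : B.det = 1) (h0 : Aᵀ 0 = Bᵀ 0) (h1 : Aᵀ 1 = Bᵀ 1) : A = B := by
  have hA' : A * Aᵀ = 1 := mul_eq_one_comm.mp hA
  set C := Aᵀ * B with hC
  have hCC : Cᵀ * C = 1 := by
    rw [hC, transpose_mul, transpose_transpose, Matrix.mul_assoc, ← Matrix.mul_assoc A, hA',
      Matrix.one_mul, hB]
  have c0 : ∀ i, C i 0 = (1 : IntMat) i 0 := by
    intro i
    have : C i 0 = Aᵀ i ⬝ᵥ Bᵀ 0 := rfl
    rw [this, ← h0, ← hA]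
    rfl
  have c1 : ∀ i, C i 1 = (1 : IntMat) i 1 := by
    intro i
    have : C i 1 = Aᵀ i ⬝ᵥ Bᵀ 1 := rfl
    rw [this, ← h1, ← hA]
    rfl
  have e02 := congrFun (congrFun hCC 0) 2
  have e12 := congrFun (congrFun hCC 1) 2
  rw [Matrix.mul_apply, Fin.sum_univ_three] at e02 e12
  simp only [transpose_apply, c0, c1] at e02 e12
  simp at e02 e12
  have dC : C.det = 1 := by rw [hC, det_mul, det_transpose, dA, dB, one_mul]
  rw [det_fin_three] at dC
  simp only [c0, c1] at dC
  simp [e02, e12] at dC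
  have hC1 : C = 1 := by
    ext i j
    fin_cases j
    · exact c0 i
    · exact c1 i
    · fin_cases i
      · exact e02
      · exact e12
      · exact dC
  have : A * C = B := by rw [hC, ← Matrix.mul_assoc, hA', Matrix.one_mul]
  rw [← this, hC1, Matrix.mul_one]

/-! ### The blocks of a piece -/

/-- The blocks of a piece that is followed with a gluing. -/
def pieceBlocks (s : GluingType) : Parity → List Move → List Block
  | _, [] => [.glue s]
  | p, m :: g => .letter m p :: pieceBlocks s (p.next m) g

/-- The parity of the last cube of a piece. -/
def finalParity (p : Parity) (g : List Move) : Parity := g.foldl Parity.next p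

theorem length_pieceBlocks (s : GluingType) (p : Parity) (g : List Move) :
    (pieceBlocks s p g).length = g.length + 1 := by
  induction g generalizing p with
  | nil => rfl
  | cons m g ih => simp [pieceBlocks, ih]

theorem flatMap_word_pieceBlocks (s : GluingType) (p : Parity) (g : List Move) :
    (pieceBlocks s p g).flatMap Block.word = lettersWord p g ++ gluingWord s := by
  induction g generalizing p with
  | nil => simp [pieceBlocks, lettersWord, Block.word]
  | cons m g ih => simp [pieceBlocks, lettersWord, ih, Block.word]

theorem parity_head_pieceBlocks {s : GluingType} {p : Parity} {g : List Move}
    (h : finalParity p g = (Block.glue s).parity) (h0 : 0 < (pieceBlocks s p g).length) :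
    (pieceBlocks s p g)[0].parity = p := by
  cases g with
  | nil => exact h.symm
  | cons m g => rfl

theorem parity_pieceBlocks {s : GluingType} {p : Parity} {g : List Move}
    (h : finalParity p g = (Block.glue s).parity) (i : ℕ)
    (hi : i + 1 < (pieceBlocks s p g).length) :
    (pieceBlocks s p g)[i + 1].parity = (pieceBlocks s p g)[i].nextParity := by
  induction g generalizing p i with
  | nil => simp [pieceBlocks] at hi
  | cons m g ih =>
    have h' : finalParity (p.next m) g = (Block.glue s).parity := h
    cases i with
    | zero => exact parity_head_pieceBlocks h' _
    | succ i => exact ih h' i (by simpa [pieceBlocks] using hi)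

theorem last_pieceBlocks {s : GluingType} (p : Parity) (g : List Move)
    (hi : g.length < (pieceBlocks s p g).length) :
    (pieceBlocks s p g)[g.length] = .glue s := by
  induction g generalizing p with
  | nil => rfl
  | cons m g ih => exact ih (p.next m) _

theorem getElem_pieceBlocks {s : GluingType} (p : Parity) (g : List Move) (i : ℕ)
    (hi : i < g.length) (hi' : i < (pieceBlocks s p g).length) :
    ∃ p', (pieceBlocks s p g)[i] = .letter g[i] p' := by
  induction g generalizing p i with
  | nil => simp at hi
  | cons m g ih =>
    cases i with
    | zero => exact ⟨p, rfl⟩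
    | succ i => exact ih (p.next m) i (by simpa using hi) _

theorem Block.run_word (b : Block) :
    (startFlag b.parity).run b.word = b.motion.act (startFlag b.nextParity) := by
  rw [← run_preFlag, ← Flag.run_append, b.word_rotate, Flag.run_append, b.run_rotatedWord,
    ← Motion.act_run, run_preFlag]

/-- The sequence of blocks of the closed path. -/
def blockSeq (g : List Move) (s : GluingType) (j : ℕ) : Block :=
  (pieceBlocks s .even g)[j % (g.length + 1)]'(by
    rw [length_pieceBlocks]; exact Nat.mod_lt _ (Nat.succ_pos _))

/-- The frames of a sequence of blocks, in the coordinates of the first one. -/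
def blockMotion (bl : ℕ → Block) : ℕ → Motion
  | 0 => 1
  | j + 1 => blockMotion bl j * (bl j).motion

theorem isDirect_blockMotion (bl : ℕ → Block) (j : ℕ) : (blockMotion bl j).IsDirect := by
  induction j with
  | zero => exact ⟨by change (1 : IntMat)ᵀ * 1 = 1; simp, det_one⟩
  | succ j ih => exact ih.mul (Block.isDirect_motion _)

theorem blockMotion_add {bl : ℕ → Block} {k : ℕ} (h : ∀ j, bl (j + k) = bl j) (j : ℕ) :
    blockMotion bl (j + k) = blockMotion bl k * blockMotion bl j := by
  induction j with
  | zero => rw [zero_add, blockMotion, mul_one]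
  | succ j ih => rw [add_right_comm, blockMotion, ih, h, blockMotion, mul_assoc]

theorem blockSeq_add (g : List Move) (s : GluingType) (j : ℕ) :
    blockSeq g s (j + (g.length + 1)) = blockSeq g s j := by
  simp only [blockSeq, Nat.add_mod_right]

/-- The chain of cubes with a given sequence of blocks. -/
def chainOf (bl : ℕ → Block) (X : Motion) (hX : X.IsOrthogonal) : Chain where
  block := bl
  place j := X * blockMotion bl j
  orthogonal j := hX.mul (isDirect_blockMotion bl j).orthogonal
  place_succ j := by rw [blockMotion, mul_assoc]

theorem isOrthonormal_follow (c : IntVec) {F : Frame} (h : F.IsOrthonormal) (g : List Move) (j : ℕ) :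
    (follow c F g j).2.IsOrthonormal := by
  unfold follow
  generalize g.take j = l
  induction l generalizing c F with
  | nil => exact h
  | cons m l ih => exact ih _ (isOrthonormal_turn h m)

theorem follow_succ (c : IntVec) (F : Frame) (g : List Move) (j : ℕ) (hj : j < g.length) :
    follow c F g (j + 1) = move (follow c F g j) g[j] := by
  unfold follow
  rw [← List.take_append_getElem hj, List.foldl_append]
  rfl

theorem frameMotion_follow (c : IntVec) {F : Frame} (h : F.IsOrthonormal) (g : List Move)
    (s : GluingType) (j : ℕ) (hj : j ≤ g.length) :
    frameMotion (follow c F g j) = frameMotion (c, F) * blockMotion (blockSeq g s) j := by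
  induction j with
  | zero => rw [blockMotion, mul_one]; rfl
  | succ j ih =>
    obtain ⟨p', hp⟩ := getElem_pieceBlocks (s := s) .even g j hj
      (by rw [length_pieceBlocks]; omega)
    have hb : blockSeq g s j = .letter g[j] p' := by
      rw [← hp]
      simp only [blockSeq]
      congr 1
      exact Nat.mod_eq_of_lt (by omega)
    rw [follow_succ c F g j hj, frameMotion_move (isOrthonormal_follow c h g j) _ p',
      ih (by omega), blockMotion, hb, mul_assoc]

/-! ### The threefold rotation -/

/-- The rotation as a motion. -/
def ThreefoldRotation.motion (R : ThreefoldRotation) : Motion := ⟨R.linear, R.trans⟩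

theorem ThreefoldRotation.isDirect_motion (R : ThreefoldRotation) : R.motion.IsDirect :=
  ⟨R.orthogonal, R.det_eq_one⟩

theorem ThreefoldRotation.motion_pow_three (R : ThreefoldRotation) : R.motion ^ 3 = 1 := by
  -- The value at the origin gives the translation part of the cube; the basis vectors then give the
  -- linear part.
  have h0 := R.order_three 0
  rw [mulVec_zero, zero_add] at h0
  rw [pow_succ, sq]
  apply Motion.ext
  · change R.linear * R.linear * R.linear = 1
    apply Matrix.ext_of_mulVec_single
    intro j
    have h1 := R.order_three (Pi.single j 1)
    simp only [mulVec_add, mulVec_mulVec] at h0 h1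
    rw [one_mulVec]
    rw [add_assoc, add_assoc] at h1
    rw [add_assoc] at h0
    rwa [h0, add_zero, ← Matrix.mul_assoc] at h1
  · change (R.linear * R.linear) *ᵥ R.trans + (R.linear *ᵥ R.trans + R.trans) = 0
    rw [← h0, mulVec_add, mulVec_mulVec, add_assoc]

/-- Both sides are direct isometries that agree on the tangent, the normal and the first cube; the
binormal is then determined. -/
theorem frameMotion_glue {R : ThreefoldRotation} {c : IntVec} {F : Frame} {g : List Move}
    {s : GluingType} (h : IsBarGluing R c F g s) :
    frameMotion (follow c F g g.length) * (Block.glue s).motion =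
      R.motion * frameMotion (c, F) := by
  obtain ⟨hF, hfront, htangent, hnormal⟩ := h
  set x := follow c F g g.length with hx
  have hx1 : x.2.IsOrthonormal := isOrthonormal_follow c hF g _
  have d1 := (isDirect_frameMotion x.1 hx1).mul (Block.isDirect_motion (.glue s))
  have d2 := R.isDirect_motion.mul (isDirect_frameMotion c hF)
  have col : ∀ v : IntVec, (frameMotion x).lin *ᵥ v = v 0 • x.2.T + v 1 • x.2.N + v 2 • x.2.B := by
    intro v
    ext i
    simp [frameMotion, mulVec, dotProduct, Fin.sum_univ_three]
    ring
  have cols : ∀ j, (frameMotion x * (Block.glue s).motion).linᵀ j =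
      (frameMotion x).lin *ᵥ ((Block.glue s).turnᵀ j) := fun j => rfl
  have h0 : (frameMotion x * (Block.glue s).motion).linᵀ 0 = x.2.T := by
    rw [cols, col]
    cases s <;> simp [Block.turn]
  apply Motion.ext
  · apply eq_of_columns d1.1 d2.1 d1.2 d2.2
    · rw [h0]
      exact htangent.symm
    · have : (R.motion * frameMotion (c, F)).linᵀ 1 = R.linear *ᵥ F.N := rfl
      rw [this, hnormal, cols, col]
      cases s <;> simp [Block.turn, Frame.correctedNormal]
  · have h1 : (frameMotion x * (Block.glue s).motion).cube =
        (frameMotion x * (Block.glue s).motion).linᵀ 0 + x.1 := rfl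
    rw [h1, h0, add_comm, ← hfront]
    rfl

/-- The motion of one whole piece, seen from its first frame, is `R` in the coordinates of this
frame. The periodicity of the path and its order three rest on this. -/
theorem blockMotion_piece {R : ThreefoldRotation} {c : IntVec} {F : Frame} {g : List Move}
    {s : GluingType} (h : IsBarGluing R c F g s) :
    frameMotion (c, F) * blockMotion (blockSeq g s) (g.length + 1) =
      R.motion * frameMotion (c, F) := by
  have hb : blockSeq g s g.length = .glue s := by
    rw [← last_pieceBlocks .even g (by rw [length_pieceBlocks]; omega)]
    simp only [blockSeq]
    congr 1
    exact Nat.mod_eq_of_lt (by omega)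
  rw [← frameMotion_glue h, blockMotion, ← mul_assoc, ← frameMotion_follow c h.frame g s _ le_rfl,
    hb]

theorem cubePath_eq {R : ThreefoldRotation} {c : IntVec} {F : Frame} {g : List Move}
    {s : GluingType} (h : IsBarGluing R c F g s) (i : ℕ) :
    cubePath R c F g i = (frameMotion (c, F) * blockMotion (blockSeq g s) i).cube := by
  have key : ∀ k r, frameMotion (c, F) * blockMotion (blockSeq g s) (r + k * (g.length + 1)) =
      R.motion ^ k * (frameMotion (c, F) * blockMotion (blockSeq g s) r) := by
    intro k r
    induction k with
    | zero => simp
    | succ k ih =>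
      rw [Nat.succ_mul, ← add_assoc, blockMotion_add (blockSeq_add g s), ← mul_assoc,
        blockMotion_piece h, mul_assoc, ih, pow_succ', mul_assoc]
  have hpow : ∀ k (Y : Motion), (R.motion ^ k * Y).cube = R.act^[k] Y.cube := by
    intro k Y
    induction k with
    | zero => simp
    | succ k ih =>
      rw [pow_succ', mul_assoc, Function.iterate_succ_apply', ← ih]
      rfl
  have hm : i % (g.length + 1) ≤ g.length := Nat.lt_succ_iff.1 (Nat.mod_lt _ (Nat.succ_pos _))
  conv_rhs => rw [← Nat.mod_add_div' i (g.length + 1)]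
  rw [key, hpow, cubePath, ← frameMotion_follow c h.frame g s _ hm]
  rfl

/-- Stated without the gluing, because it is needed to determine the parity in which the gluing word
is read. -/
theorem run_lettersWord (g : List Move) (p : Parity) (x : IntVec × Frame) (hx : x.2.IsOrthonormal) :
    ((frameMotion x).act (startFlag p)).run (lettersWord p g) =
      (frameMotion (g.foldl move x)).act (startFlag (finalParity p g)) := by
  induction g generalizing p x with
  | nil => rfl
  | cons m g ih =>
    have h1 := (Block.letter m p).run_word
    change (startFlag p).run (letterWord m p) =
      (Block.letter m p).motion.act (startFlag (p.next m)) at h1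
    rw [lettersWord, Flag.run_append, ← Motion.act_run, h1, ← Motion.act_mul,
      ← frameMotion_move (q := x.1) hx m p, ih]
    · rfl
    · exact isOrthonormal_turn hx m

theorem Flag.IsProper.exists_add_two_smul {φ ψ : Flag} (hφ : φ.IsProper) (hψ : ψ.IsProper) :
    ∃ z : IntVec, φ.vertex .A = ψ.vertex .A + (2 : ℤ) • z := by
  obtain ⟨c, hc⟩ := hφ.even
  obtain ⟨d, hd⟩ := hψ.even
  have h : ∀ i, ∃ z : ℤ, φ.vertex .A i = ψ.vertex .A i + 2 * z := by
    intro i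
    have h1 := hφ.sum_eq i
    have h2 := hψ.sum_eq i
    simp only [Flag.vertex, hc, hd, Pi.add_apply] at h1 h2 ⊢
    simp only [cubeCentre] at h1 h2 ⊢
    refine ⟨(2 * c i + (φ.u i + φ.g i + φ.h i) - (2 * d i + (ψ.u i + ψ.g i + ψ.h i))) / 2, ?_⟩
    omega
  choose z hz using h
  exact ⟨z, by ext i; simp [hz]⟩

/-- A threefold rotation preserves the colours of the vertices. -/
theorem coordSum_act_of_pow_three {X : Motion} (hX : X.IsOrthogonal) (h3 : X ^ 3 = 1) {φ : Flag}
    (hφ : φ.IsProper) :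
    coordSum ((X.act φ).vertex .A) % 4 = coordSum (φ.vertex .A) % 4 := by
  have hvert : ∀ φ : Flag, (X.act φ).vertex .A = X.lin *ᵥ φ.vertex .A + (2 : ℤ) • X.cube := by
    intro φ
    simp only [Flag.vertex, Motion.act, mulVec_add]
    abel
  have hdiff : ∀ φ ψ : Flag, φ.IsProper → ψ.IsProper →
      (coordSum ((X.act φ).vertex .A) - coordSum (φ.vertex .A) -
        (coordSum ((X.act ψ).vertex .A) - coordSum (ψ.vertex .A))) % 4 = 0 := by
    intro φ ψ h1 h2
    obtain ⟨z, hz⟩ := h1.exists_add_two_smul h2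
    rw [hvert, hvert, hz, mulVec_add, mulVec_smul]
    simp only [coordSum_add, coordSum_smul]
    have := coordSum_mulVec_mod_two hX z
    omega
  have p1 := hφ.act hX
  have p2 := p1.act hX
  have d1 := hdiff _ _ p1 hφ
  have d2 := hdiff _ _ p2 hφ
  have e : X.act (X.act (X.act φ)) = φ := by
    rw [← Motion.act_mul, ← Motion.act_mul]
    have : X * X * X = X ^ 3 := by rw [pow_succ, sq]
    rw [this, h3, Motion.act_one]
  -- The change of the coordinate sum modulo 4 is the same for all proper flags. Three equal changes
  -- add up to 0, and 3 is invertible modulo 4.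
  rw [e] at d2
  omega

/-- The last cube of the piece has the parity that is presupposed by the word of the gluing. -/
theorem finalParity_eq {R : ThreefoldRotation} {c : IntVec} {F : Frame} {g : List Move}
    {s : GluingType} (h : IsBarGluing R c F g s) :
    finalParity .even g = (Block.glue s).parity := by
  by_contra hne
  set X := frameMotion (c, F)
  have hX : X.IsDirect := isDirect_frameMotion c h.frame
  set Z := frameMotion (follow c F g g.length) with hZ
  have hZd : Z.IsDirect := isDirect_frameMotion _ (isOrthonormal_follow c h.frame g _)
  have prop : ∀ p, (startFlag p).IsProper := Flag.isProper_startFlag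
  have h1 : coordSum ((Z.act (startFlag (finalParity .even g))).vertex .A) % 4 =
      coordSum ((X.act (startFlag .even)).vertex .A) % 4 := by
    have := ((prop .even).act hX.1).coordSum_run_A (lettersWord .even g)
    rw [run_lettersWord g .even (c, F) h.frame] at this
    rw [← this, hZ, follow, List.take_length]
  have h2 : coordSum ((Z.act (startFlag (Block.glue s).parity)).vertex .A) % 4 =
      coordSum ((X.act (startFlag .even)).vertex .A) % 4 := by
    have h3 := ((prop (Block.glue s).parity).act hZd.1).coordSum_run_A (Block.glue s).word
    rw [← Motion.act_run, Block.run_word, ← Motion.act_mul, frameMotion_glue h, Motion.act_mul]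
      at h3
    rw [← h3]
    exact coordSum_act_of_pow_three R.isDirect_motion.1 R.motion_pow_three
      ((prop .even).act hX.1)
  -- The start flags of the two parities differ in the sign of `h`. As `h` has odd coordinate sum,
  -- the wrong parity would change the class of the vertex `A` by 2 modulo 4.
  have swap : ∀ p q : Parity, p ≠ q → Z.act (startFlag p) =
      ⟨(Z.act (startFlag q)).o, (Z.act (startFlag q)).u, (Z.act (startFlag q)).g,
        -(Z.act (startFlag q)).h⟩ := by
    intro p q hpq
    have e : (![0, 0, -1] : IntVec) = -![0, 0, 1] := by decide
    cases p <;> cases q <;> first | exact absurd rfl hpq | skip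
    all_goals simp only [Motion.act, startFlag, e, mulVec_neg, neg_neg]
  have h4 := ((prop (Block.glue s).parity).act hZd.1).coordSum_h
  rw [swap _ _ hne, ← h2] at h1
  simp only [Flag.vertex, coordSum_add] at h1
  have hneg : ∀ v : IntVec, coordSum (-v) = -coordSum v := by
    intro v; simp only [coordSum, Pi.neg_apply]; ring
  rw [hneg] at h1
  omega

theorem parity_blockSeq_succ {R : ThreefoldRotation} {c : IntVec} {F : Frame} {g : List Move}
    {s : GluingType} (h : IsBarGluing R c F g s) (j : ℕ) :
    (blockSeq g s (j + 1)).parity = (blockSeq g s j).nextParity := by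
  have hfin := finalParity_eq h
  have hlen := length_pieceBlocks s .even g
  have hlt : j % (g.length + 1) < g.length + 1 := Nat.mod_lt _ (Nat.succ_pos _)
  rcases Nat.lt_or_ge (j % (g.length + 1) + 1) (g.length + 1) with hj | hj
  · have h1 : (j + 1) % (g.length + 1) = j % (g.length + 1) + 1 := by
      rw [← Nat.mod_add_mod, Nat.mod_eq_of_lt hj]
    have := parity_pieceBlocks hfin (j % (g.length + 1)) (by rw [hlen]; exact hj)
    simp only [blockSeq, h1]
    exact this
  · have h1 : j % (g.length + 1) = g.length := by omega
    have h2 : (j + 1) % (g.length + 1) = 0 := by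
      rw [← Nat.mod_add_mod, h1, Nat.mod_self]
    simp only [blockSeq, h1, h2]
    rw [parity_head_pieceBlocks hfin, last_pieceBlocks]
    rfl

/-! ### The position of the first pyramid -/

/-- Positivity of the orientation is what makes the motion direct; with the other orientation a
reflection would be needed, and the mirror image of the knot would arise. -/
theorem exists_motion_of_isPositive (P : Pyramid) (hP : P.IsPositive) :
    ∃ X : Motion, X.IsDirect ∧ (X.act (startFlag .even)).vertex = P.vertex := by
  obtain ⟨c, u, a, b, huu, ha, hb, hau, hbu, hab, hD, hC, hA, hB, -, -⟩ := P.isPyramid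
  have h1 : ∀ i, ∃ z : ℤ, a i - b i = 2 * z := by
    intro i
    rcases ha i with h | h <;> rcases hb i with h' | h' <;> rw [h, h']
    exacts [⟨0, rfl⟩, ⟨1, rfl⟩, ⟨-1, rfl⟩, ⟨0, rfl⟩]
  choose h hh using h1
  set g : IntVec := b + h - u with hg
  have eb : b = u + g - h := by rw [hg]; abel
  have ea : a = u + g + h := by
    have : a = b + (2 : ℤ) • h := by
      ext i; simp [← hh]
    rw [this, hg]
    module
  have sq : ∀ v : IntVec, (∀ i, v i = 1 ∨ v i = -1) → v ⬝ᵥ v = 3 := by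
    intro v hv
    rw [dot_self]
    rcases hv 0 with h0 | h0 <;> rcases hv 1 with h1 | h1 <;> rcases hv 2 with h2 | h2 <;>
      rw [h0, h1, h2] <;> rfl
  have haa := sq a ha
  have hbb := sq b hb
  rw [ea] at haa hau
  rw [eb] at hbb hbu
  rw [show a - b = (2 : ℤ) • h by rw [ea, eb]; module] at hab
  simp only [add_dotProduct, sub_dotProduct, dotProduct_add, dotProduct_sub, smul_dotProduct,
    dotProduct_smul, smul_eq_mul, dotProduct_comm g u, dotProduct_comm h u,
    dotProduct_comm h g, huu] at haa hbb hau hbu hab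
  have ehh : h ⬝ᵥ h = 1 := by linarith
  have ehu : u ⬝ᵥ h = 0 := by linarith
  have egu : u ⬝ᵥ g = 0 := by linarith
  have egh : g ⬝ᵥ h = 0 := by linarith
  have egg : g ⬝ᵥ g = 1 := by linarith
  -- The even start flag has `u = -N`, `g = -T` and `h = B`, so the frame must be `(-g, -u, h)`.
  let A : IntMat := (Matrix.of ![-g, -u, h])ᵀ
  have hA' : Aᵀ * A = 1 := by
    have key : ∀ i j, (Aᵀ * A) i j = ![-g, -u, h] i ⬝ᵥ ![-g, -u, h] j := fun i j => rfl
    have egu' := egu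
    have ehu' := ehu
    have egh' := egh
    rw [dotProduct_comm] at egu' ehu' egh'
    ext i j
    rw [key]
    fin_cases i <;> fin_cases j <;> simp [huu, egg, ehh, egu, ehu, egh, egu', ehu', egh']
  have hdet : A.det = 1 := by
    have h2 : A.det * A.det = 1 := by
      have := congrArg Matrix.det hA'
      rwa [det_mul, det_transpose, det_one] at this
    -- The vectors from `D` to `A`, `B`, `C` are `u + g + h`, `u + g - h` and `u`; their determinant
    -- is twice that of the frame.
    have h3 : 0 < 2 * A.det := by
      unfold Pyramid.IsPositive at hP
      have e1 : P.vertex .A - P.vertex .D = u + g + h := by rw [hA, hD, ea]; abel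
      have e2 : P.vertex .B - P.vertex .D = u + g - h := by rw [hB, hD, eb]; abel
      have e3 : P.vertex .C - P.vertex .D = u := by rw [hC, hD]; abel
      rw [e1, e2, e3] at hP
      convert hP using 1
      rw [det_transpose, det_fin_three, det_fin_three]
      simp
      ring
    rcases mul_self_eq_one_iff.1 h2 with h4 | h4
    · exact h4
    · rw [h4] at h3
      norm_num at h3
  have col : ∀ v : IntVec, A *ᵥ v = v 0 • (-g) + v 1 • (-u) + v 2 • h := by
    intro v
    ext i
    simp [A, mulVec, dotProduct, Fin.sum_univ_three]
    ring
  refine ⟨⟨A, c⟩, ⟨hA', hdet⟩, ?_⟩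
  have hact : (⟨A, c⟩ : Motion).act (startFlag .even) = ⟨cubeCentre c, u, g, h⟩ := by
    simp only [Motion.act, startFlag, col, cubeCentre_eq]
    simp
  rw [hact]
  funext Y
  cases Y
  · rw [hA, ea]; rfl
  · rw [hB, eb]; rfl
  · rw [hC]; rfl
  · rw [hD]; rfl

/-! ### The word of the closed gallery -/

theorem image_polygon (f : Space →ᵃ[ℝ] Space) (n : ℕ) (p : ℕ → Space) :
    f '' polygon n p = polygon n (fun i => f (p i)) := by
  simp only [polygon, Set.image_iUnion, image_segment]

namespace Chain

variable {c : Chain} {M : ℕ}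

/-- The words of the first blocks. -/
def blockWord (c : Chain) (J : ℕ) : List Colour :=
  (List.range J).flatMap fun j => (c.block j).word

/-- Moving `DC` to the front of every block telescopes to a single shift by two letters of the whole
word. -/
theorem blockWord_rotate (c : Chain) (J : ℕ) :
    [.D, .C] ++ c.blockWord J = c.prefixWord J ++ [.D, .C] := by
  induction J with
  | zero => rfl
  | succ J ih =>
    have h : c.blockWord (J + 1) = c.blockWord J ++ (c.block J).word := by
      simp [blockWord, List.range_succ]
    rw [h, ← List.append_assoc, ih, prefixWord_succ, List.append_assoc, Block.word_rotate,
      List.append_assoc]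

theorem length_blockWord (c : Chain) (J : ℕ) : (c.blockWord J).length = c.offset J := by
  have := congrArg List.length (c.blockWord_rotate J)
  rw [List.length_append, List.length_append, length_prefixWord] at this
  simp only [List.length_cons, List.length_nil] at this
  omega

theorem gallery_add_two {i J : ℕ} (h : i ≤ c.offset J) : c.gallery (i + 2) =
    ((c.place 0).act (startFlag (c.block 0).parity)).run ((c.blockWord J).take i) := by
  have h1 : i + 2 ≤ c.offset (J + 2) := by
    have := c.size_pos J
    have := c.size_pos (J + 1)
    rw [offset_succ, offset_succ]
    omega
  have h2 : (c.blockWord (J + 2)).take i = (c.blockWord J).take i := by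
    have : c.blockWord (J + 2) = c.blockWord J ++ ((c.block J).word ++ (c.block (J + 1)).word) := by
      simp [blockWord, List.range_succ]
    rw [this, List.take_append_of_le_length (by rw [length_blockWord]; exact h)]
  have h3 : (c.prefixWord (J + 2)).take (i + 2) = [.D, .C] ++ (c.blockWord (J + 2)).take i := by
    rw [← List.take_append_of_le_length (l₂ := [Colour.D, Colour.C])
      (by rw [length_prefixWord]; exact h1), ← blockWord_rotate]
    rfl
  rw [gallery_eq h1, h3, h2, Flag.run_append, ← Motion.act_run, run_preFlag]

theorem Closes.run_blockWord (hc : c.Closes M) :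
    ((c.place 0).act (startFlag (c.block 0).parity)).run (c.blockWord M) =
      (c.place 0).act (startFlag (c.block 0).parity) := by
  have h1 := c.gallery_add_two le_rfl (J := M)
  have h2 := c.gallery_add_two (Nat.zero_le (c.offset M))
  rw [← length_blockWord, List.take_length, length_blockWord, add_comm, hc.gallery_add] at h1
  rw [← h1]
  exact h2

end Chain

theorem parity_blockSeq_zero {R : ThreefoldRotation} {c : IntVec} {F : Frame} {g : List Move}
    {s : GluingType} (h : IsBarGluing R c F g s) : (blockSeq g s 0).parity = .even :=
  parity_head_pieceBlocks (finalParity_eq h) (by rw [length_pieceBlocks]; omega)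

theorem flatMap_word_blockSeq (g : List Move) (s : GluingType) :
    ((List.range (g.length + 1)).flatMap fun j => (blockSeq g s j).word) = pieceWord g s := by
  have h : (List.range (g.length + 1)).map (blockSeq g s) = pieceBlocks s .even g := by
    apply List.ext_getElem
    · simp [length_pieceBlocks]
    · intro i h1 h2
      rw [length_pieceBlocks] at h2
      simp only [List.getElem_map, List.getElem_range, blockSeq, Nat.mod_eq_of_lt h2]
  rw [pieceWord, ← flatMap_word_pieceBlocks, ← h, List.flatMap_map]

theorem flatMap_word_blockSeq_mul (g : List Move) (s : GluingType) :
    ((List.range (3 * (g.length + 1))).flatMap fun j => (blockSeq g s j).word) =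
      pieceWord g s ++ pieceWord g s ++ pieceWord g s := by
  have h := flatMap_word_blockSeq g s
  have hadd := blockSeq_add g s
  revert h hadd
  generalize g.length + 1 = k
  intro h hadd
  have h1 : ∀ j, blockSeq g s (k + j) = blockSeq g s j := fun j => by rw [add_comm, hadd]
  rw [show 3 * k = k + k + k by ring, List.range_add, List.range_add]
  simp only [List.flatMap_append, List.flatMap_map, add_assoc, h1, h]

/-- The motion `ρ` of one piece is conjugate to `R` by the first frame, hence `ρ³ = 1`. -/
theorem blockMotion_blockSeq_add {R : ThreefoldRotation} {c : IntVec} {F : Frame} {g : List Move}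
    {s : GluingType} (h : IsBarGluing R c F g s) (j : ℕ) :
    blockMotion (blockSeq g s) (j + 3 * (g.length + 1)) = blockMotion (blockSeq g s) j := by
  have hX := (isDirect_frameMotion c h.frame).orthogonal
  have hadd := blockMotion_add (blockSeq_add g s)
  have hpiece := blockMotion_piece h
  set X := frameMotion (c, F)
  set ρ := blockMotion (blockSeq g s) (g.length + 1)
  have h3 : ρ * ρ * ρ = 1 := by
    have h4 : X * (ρ * ρ * ρ) = X := by
      rw [← mul_assoc, ← mul_assoc, hpiece, mul_assoc R.motion, hpiece, mul_assoc, mul_assoc, hpiece,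
        ← mul_assoc, ← mul_assoc, ← sq, ← pow_succ, R.motion_pow_three, one_mul]
    rw [← one_mul (ρ * ρ * ρ), ← hX.inverse_mul, mul_assoc, h4]
  rw [show j + 3 * (g.length + 1) = j + (g.length + 1) + (g.length + 1) + (g.length + 1) by ring,
    hadd, hadd, hadd, ← mul_assoc, ← mul_assoc, h3, one_mul]

/-- The cubes of the path in the coordinates of the first cube of a chain. -/
theorem cube_chainOf {R : ThreefoldRotation} {c : IntVec} {F : Frame} {g : List Move}
    {s : GluingType} (h : IsBarGluing R c F g s) {Y : Motion} (hY : Y.IsOrthogonal) (i : ℕ) :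
    (chainOf (blockSeq g s) Y hY).cube i =
      (Y * (frameMotion (c, F)).inverse).lin *ᵥ cubePath R c F g i +
        (Y * (frameMotion (c, F)).inverse).cube := by
  rw [cubePath_eq h, ← Motion.mul_cube, mul_assoc, ← mul_assoc (frameMotion (c, F)).inverse,
    (isDirect_frameMotion c h.frame).orthogonal.inverse_mul, one_mul]
  rfl

theorem IsSimpleClosedPolygon.injOn {n : ℕ} {p : ℕ → Space} (h : IsSimpleClosedPolygon n p)
    {i j : ℕ} (hi : i < n) (hj : j < n) (hp : p i = p j) : i = j := by
  refine (h.2.2 i hi j hj 0 ⟨le_rfl, one_pos⟩ 0 ⟨le_rfl, one_pos⟩ ?_).1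
  rw [AffineMap.lineMap_apply_zero, AffineMap.lineMap_apply_zero, hp]

theorem closes_chainOf {R : ThreefoldRotation} {c : IntVec} {F : Frame} {g : List Move}
    {s : GluingType} (h : IsBarGluing R c F g s)
    (hsimple : IsSimpleClosedPolygon (3 * (g.length + 1))
      (fun i => pt (cubeCentre (cubePath R c F g i)))) {Y : Motion} (hY : Y.IsOrthogonal) :
    (chainOf (blockSeq g s) Y hY).Closes (3 * (g.length + 1)) where
  pos := by omega
  block_add j := by
    change blockSeq g s _ = blockSeq g s _
    simp only [blockSeq, Nat.add_mul_mod_self_right]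
  place_add j := by
    change Y * _ = Y * _
    rw [blockMotion_blockSeq_add h]
  cube_injective i hi j hj hij := by
    rw [cube_chainOf h, cube_chainOf h] at hij
    have h1 := congrArg ((Y * (frameMotion (c, F)).inverse).linᵀ *ᵥ ·) (add_right_cancel hij)
    have h2 : (Y * (frameMotion (c, F)).inverse).IsOrthogonal :=
      hY.mul (isDirect_frameMotion c h.frame).orthogonal.inverse
    simp only [mulVec_mulVec] at h1
    rw [h2, one_mulVec, one_mulVec] at h1
    exact hsimple.injOn hi hj (by simp only [h1])
  parity_succ j := parity_blockSeq_succ h j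

theorem Flag.isColoured_of_vertex_eq {φ : Flag} (h : φ.IsProper) {P : Pyramid}
    (hP : φ.vertex = P.vertex) : φ.IsColoured := by
  refine ⟨h, ?_⟩
  obtain ⟨c, u, a, b, -, -, -, -, -, -, -, -, -, -, hA, -⟩ := P.isPyramid
  rw [hP, hA]

theorem wordSymmetry_append (P : Pyramid) (v w : List Colour) :
    wordSymmetry P (v ++ w) = wordSymmetry P v * wordSymmetry P w := by
  simp only [wordSymmetry, List.map_append, List.prod_append]

end CoxeterKnot

/-! ### The theorem -/

theorem theorem5
    (R : ThreefoldRotation) (c : IntVec) (F : Frame) (g : List Move) (s : GluingType)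
    (hglue : IsBarGluing R c F g s)
    (hsimple : IsSimpleClosedPolygon (3 * (g.length + 1))
      (fun i => pt (cubeCentre (cubePath R c F g i))))
    (K : Set Space)
    (hK : AmbientIsotopic K
      (polygon (3 * (g.length + 1)) (fun i => pt (cubeCentre (cubePath R c F g i)))))
    (P₀ : Pyramid) (hP₀ : P₀.IsPositive) :
    orderOf (wordSymmetry P₀ (pieceWord g s)) = 3 ∧
    ∃ P : ℕ → Pyramid, P 0 = P₀ ∧
      IsGallery (pieceWord g s ++ pieceWord g s ++ pieceWord g s) P ∧
      P (3 * (pieceWord g s).length) = P 0 ∧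
      IsSimpleClosedPolygon (3 * (pieceWord g s).length) (fun i => (P i).centre) ∧
      AmbientIsotopic K
        (polygon (3 * (pieceWord g s).length) (fun i => (P i).centre)) := by
  obtain ⟨Y, hY, hYP⟩ := exists_motion_of_isPositive P₀ hP₀
  have hc := closes_chainOf hglue hsimple hY.orthogonal
  have hcube := cube_chainOf hglue hY.orthogonal
  have hG := hY.mul (isDirect_frameMotion c hglue.frame).inverse
  set ch := chainOf (blockSeq g s) Y hY.orthogonal with hch
  set G := Y * (frameMotion (c, F)).inverse
  set φ := Y.act (startFlag .even) with hφ
  have hstart : (ch.place 0).act (startFlag (ch.block 0).parity) = φ := by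
    rw [show ch.block 0 = blockSeq g s 0 from rfl, parity_blockSeq_zero hglue,
      show ch.place 0 = Y * 1 from rfl, mul_one]
  have hword : ch.blockWord (3 * (g.length + 1)) =
      pieceWord g s ++ pieceWord g s ++ pieceWord g s := flatMap_word_blockSeq_mul g s
  have hlen : 3 * (pieceWord g s).length = ch.offset (3 * (g.length + 1)) := by
    rw [← ch.length_blockWord, hword, List.length_append, List.length_append]
    omega
  have hproper : φ.IsProper := (Flag.isProper_startFlag _).act hY.orthogonal
  have hcol : φ.IsColoured := Flag.isColoured_of_vertex_eq hproper hYP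
  have hgal : ∀ i, (ch.gallery (i + 2)).IsColoured := by
    intro i
    rw [ch.gallery_add_two (ch.le_offset i), hstart]
    exact hcol.run _
  refine ⟨?_, fun i => (ch.gallery (i + 2)).toPyramid (hgal i), ?_, ?_, ?_, ?_, ?_⟩
  · have hloop := hc.run_blockWord
    rw [hword, hstart] at hloop
    have hfix : ∀ w Z, wordSymmetry P₀ w (pt (φ.vertex Z)) = pt ((φ.run w).vertex Z) :=
      Flag.wordSymmetry_vertex hproper hYP.symm
    have : Fact (Nat.Prime 3) := ⟨Nat.prime_three⟩
    apply orderOf_eq_prime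
    -- The gallery of the triple word closes, so its symmetry fixes all vertices of the first
    -- pyramid and is the identity.
    · rw [pow_succ, sq, ← wordSymmetry_append, ← wordSymmetry_append]
      apply hproper.eq_one
      intro Z
      rw [hfix, hloop]
    -- If one copy of the word gave the identity, its gallery would return to the centre of the
    -- first cube; but the first cube of the rotated piece is a different one.
    · intro h1
      have h2 := hfix (pieceWord g s) .D
      rw [h1] at h2
      have h3 : φ.vertex .D = (φ.run (pieceWord g s)).vertex .D := pt_injective h2
      have h4 : ∀ J, (φ.run (ch.blockWord J)).vertex .D = (2 : ℤ) • ch.cube J := by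
        intro J
        have h5 : φ.run (ch.blockWord J) = (ch.place J).act (startFlag (ch.block J).parity) := by
          have h6 := ch.blockWord_rotate J
          rw [← hstart, ← run_preFlag, Motion.act_run, ← Flag.run_append, h6, Flag.run_append,
            hc.run_prefixWord, ← Motion.act_run, run_preFlag]
        rw [h5]
        cases (ch.block J).parity <;> simp [Flag.vertex, Motion.act, startFlag, Chain.cube]
      have h5 := h4 (g.length + 1)
      rw [show ch.blockWord (g.length + 1) = pieceWord g s from flatMap_word_blockSeq g s, ← h3,
        show φ.vertex .D = _ from h4 0] at h5
      have h6 := hc.cube_injective 0 (by omega) (g.length + 1) (by omega)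
        (smul_right_injective _ two_ne_zero h5)
      omega
  · have h1 : (ch.gallery (0 + 2)).vertex = P₀.vertex := by
      rw [ch.gallery_add_two (Nat.zero_le (ch.offset 0)), hstart]
      exact hYP
    cases P₀
    simp only [Flag.toPyramid, Pyramid.mk.injEq]
    exact h1
  · intro i hi
    have hi' : i < ch.offset (3 * (g.length + 1)) := by
      rwa [← hword, ch.length_blockWord] at hi
    have h1 : ch.gallery (i + 1 + 2) = (ch.gallery (i + 2)).step
        (pieceWord g s ++ pieceWord g s ++ pieceWord g s)[i] := by
      rw [ch.gallery_add_two hi', ch.gallery_add_two hi'.le, hword, List.take_succ_eq_append_getElem hi,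
        Flag.run_append]
      rfl
    have h2 := hgal (i + 1)
    have key : ∀ ψ (hψ : ψ.IsColoured), ψ = (ch.gallery (i + 2)).step
        (pieceWord g s ++ pieceWord g s ++ pieceWord g s)[i] →
        Crosses (pieceWord g s ++ pieceWord g s ++ pieceWord g s)[i]
          ((ch.gallery (i + 2)).toPyramid (hgal i)) (ψ.toPyramid hψ) := by
      rintro ψ hψ rfl
      exact Flag.crosses_step _ hψ
    exact key _ h2 h1
  · have h1 := hc.gallery_add (0 + 2)
    rw [← hlen] at h1
    simp only [Flag.toPyramid, Pyramid.mk.injEq]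
    rw [← h1]
    congr 2
    omega
  · simp only [Flag.centre_toPyramid, hlen]
    exact hc.isSimpleClosedPolygon
  · simp only [Flag.centre_toPyramid, hlen]
    have h1 := hc.ambientIsotopic_curve
    rw [hc.curve_straightArc, hc.curve_galleryArc] at h1
    refine hK.trans (AmbientIsotopic.trans ?_ h1)
    -- The motion `G` takes the given path to the one that starts at the cube of `P₀`. It need not
    -- respect the colours: only the knot type of the straight curve is transported.
    have h2 := ambientIsotopic_latticeMap hG.orthogonal hG.det_eq_one (pt ((2 : ℤ) • G.cube))
      (polygon (3 * (g.length + 1)) (fun i => pt (cubeCentre (cubePath R c F g i))))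
    have h3 := image_polygon ((latticeMap G.lin).toAffineMap +
      AffineMap.const ℝ Space (pt ((2 : ℤ) • G.cube))) (3 * (g.length + 1))
      (fun i => pt (cubeCentre (cubePath R c F g i)))
    have h4 : ∀ i, ((latticeMap G.lin).toAffineMap +
        AffineMap.const ℝ Space (pt ((2 : ℤ) • G.cube)))
        (pt (cubeCentre (cubePath R c F g i))) = pt ((2 : ℤ) • ch.cube i) := by
      intro i
      change latticeMap G.lin _ + pt _ = _
      rw [latticeMap_pt, ← pt_add, cubeCentre_eq, Matrix.mulVec_smul, ← smul_add, ← hcube]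
    simp only [h4] at h3
    rw [← h3]
    exact h2
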